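/- Let $d\ge 2$. A compact hyperbolic manifold of dimension $d$ is a compact connected smooth Riemannian manifold $M$ of dimension $d$, without boundary, of constant sectional curvature $-1$. Let $\Delta=-\mathrm{div}\,\nabla$ be its (positive) Laplace–Beltrami operator, which reads $\Delta f=-\frac1{\sqrt{g}}\sum_{i,j}\partial_i(\sqrt{g}\,g^{ij}\partial_j f)$ in local coordinates. For $t\ge 0$ let $A_t$ be the spherical mean $$A_tf(x)=\int_{T^1_xM} f(\gamma((x,v),t))\,d\sigma_x(v),$$ where $\gamma((x,v),\cdot)$ is the geodesic with initial position $x$ and initial velocity $v$, and $\sigma_x$ is the uniform probability measure on the unit sphere $T^1_xM$ of $T_xM$. **Proposition.** For every $d\ge2$ there are functions $\nu_t$, $t\ge 0$, from $\mathbb R_+$ to $\mathbb R$ (depending only on $d$ and $t$) such that the following hold. 1. Let $M$ be a compact hyperbolic manifold of dimension $d$ and let $\varphi\ne 0$ be a smooth (real or complex valued) eigenfunction of $\Delta$ on $M$ with real eigenvalue $\lambda$. Then $\lambda\ge 0$ and, for every $t\ge0$, $\varphi$ is an eigenfunction of $A_t$ with eigenvalue $\nu_t(\lambda)$: $A_t\varphi=\nu_t(\lambda)\varphi$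 on $M$. 2. If $t\ge 0$ and $\lambda=\frac{(d-1)^2}{4}+u^2$ with $u\in\mathbb R\cup i\left[-\frac{d-1}{2},\frac{d-1}{2}\right]$, then $$\nu_t(\lambda)=c_d\int_{-1}^{1}(\cosh t+x\sinh t)^{iu-\frac{d-1}{2}}(1-x^2)^{\frac{d-3}{2}}\,dx,\qquad c_d=\frac{\Gamma\left(\frac d2\right)}{\sqrt{\pi}\,\Gamma\left(\frac{d-1}{2}\right)}.$$ 3. If $d=3$, $t>0$ and $\lambda=1+u^2$ with $u$ as in 2, then $\nu_t(\lambda)=\dfrac{\sin(ut)}{u\sinh t}$ if $u\neq0$, and $\nu_t(\lambda)=\dfrac{t}{\sinh t}$ if $u=0$. -/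

import Mathlib

open scoped Manifold ContDiff Bundle

universe u v

noncomputable section

namespace SphericalMean

section Coordinates

variable {d : ℕ} {M : Type*} [TopologicalSpace M] [ChartedSpace (EuclideanSpace ℝ (Fin d)) M]
  [IsManifold (𝓡 d) ∞ M] [Bundle.RiemannianBundle (fun x : M => TangentSpace (𝓡 d) x)]

/-- The partial derivative `∂ᵢ f (y)` of a function on `ℝᵈ`. -/
def pd {F : Type*} [NormedAddCommGroup F] [NormedSpace ℝ F]
    (i : Fin d) (f : EuclideanSpace ℝ (Fin d) → F) (y : EuclideanSpace ℝ (Fin d)) : F :=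
  fderiv ℝ f y (EuclideanSpace.single i 1)

/-- The coordinate vector field `∂ᵢ` of the chart `c`, at the point with coordinates `y`. -/
def coordVector (c : OpenPartialHomeomorph M (EuclideanSpace ℝ (Fin d)))
    (y : EuclideanSpace ℝ (Fin d)) (i : Fin d) : TangentSpace (𝓡 d) (c.symm y) :=
  mfderiv (𝓡 d) (𝓡 d) c.symm y (EuclideanSpace.single i (1 : ℝ))

/-- The matrix `g_{ij}` of the Riemannian metric in the chart `c`, as a function of the
coordinates `y`. -/
def metric (c : OpenPartialHomeomorph M (EuclideanSpace ℝ (Fin d)))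
    (y : EuclideanSpace ℝ (Fin d)) : Matrix (Fin d) (Fin d) ℝ :=
  Matrix.of fun i j => inner ℝ (coordVector c y i) (coordVector c y j)

/-- The Christoffel symbol `Γᵏᵢⱼ` of the Levi-Civita connection in the chart `c`. -/
def christoffel (c : OpenPartialHomeomorph M (EuclideanSpace ℝ (Fin d)))
    (k i j : Fin d) (y : EuclideanSpace ℝ (Fin d)) : ℝ :=
  (1 / 2) * ∑ l, (metric c y)⁻¹ k l *
    (pd i (fun z => metric c z j l) y + pd j (fun z => metric c z i l) y
      - pd l (fun z => metric c z i j) y)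

/-- The coefficient `Rˡₖᵢⱼ` of the Riemann curvature tensor in the chart `c`:
`R(∂ᵢ, ∂ⱼ) ∂ₖ = ∑ₗ Rˡₖᵢⱼ ∂ₗ`, where `R(X, Y) = ∇_X ∇_Y - ∇_Y ∇_X - ∇_[X, Y]`. -/
def riemann (c : OpenPartialHomeomorph M (EuclideanSpace ℝ (Fin d)))
    (l k i j : Fin d) (y : EuclideanSpace ℝ (Fin d)) : ℝ :=
  pd i (christoffel c l j k) y - pd j (christoffel c l i k) y
    + ∑ m, (christoffel c l i m y * christoffel c m j k y
      - christoffel c l j m y * christoffel c m i k y)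

/-- The scalar product, at the point with coordinates `y` in the chart `c`, of the tangent vectors
with components `v` and `w`. -/
def coordInner (c : OpenPartialHomeomorph M (EuclideanSpace ℝ (Fin d)))
    (y : EuclideanSpace ℝ (Fin d)) (v w : Fin d → ℝ) : ℝ :=
  ∑ i, ∑ j, metric c y i j * v i * w j

/-- The sectional curvature `⟨R(v, w) w, v⟩ / (|v|² |w|² - ⟨v, w⟩²)` of the plane spanned by the
tangent vectors with components `v` and `w` in the chart `c`. -/
def sectionalCurvature (c : OpenPartialHomeomorph M (EuclideanSpace ℝ (Fin d)))
    (y : EuclideanSpace ℝ (Fin d)) (v w : Fin d → ℝ) : ℝ :=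
  coordInner c y (fun l => ∑ k, ∑ i, ∑ j, riemann c l k i j y * v i * w j * w k) v
    / (coordInner c y v v * coordInner c y w w - coordInner c y v w ^ 2)

variable (M) in
/-- All sectional curvatures of `M` are equal to `κ` (they are read off in any smooth chart). -/
def HasConstantSectionalCurvature (κ : ℝ) : Prop :=
  ∀ c ∈ IsManifold.maximalAtlas (𝓡 d) ∞ M, ∀ y ∈ c.target, ∀ v w : Fin d → ℝ,
    LinearIndependent ℝ ![v, w] → sectionalCurvature c y v w = κ

/-- The expression in the chart `c` of the (positive) Laplace-Beltrami operator
`Δ f = - (1 / √g) ∑ᵢⱼ ∂ᵢ (√g gⁱʲ ∂ⱼ f)`, where `g = det (g_{ij})`. -/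
def laplaceBeltrami {F : Type*} [NormedAddCommGroup F] [NormedSpace ℝ F]
    (c : OpenPartialHomeomorph M (EuclideanSpace ℝ (Fin d))) (f : M → F)
    (y : EuclideanSpace ℝ (Fin d)) : F :=
  -((1 / √(metric c y).det) • ∑ i, ∑ j,
    pd i (fun z => (√(metric c z).det * (metric c z)⁻¹ i j) • pd j (f ∘ c.symm) z) y)

/-- `φ` is a (smooth, not identically zero) eigenfunction of the positive Laplace-Beltrami operator
with eigenvalue `lam`: `Δ φ = lam φ` in local coordinates. -/
structure IsLaplaceEigenfunction {F : Type*} [NormedAddCommGroup F] [NormedSpace ℝ F]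
    (φ : M → F) (lam : ℝ) : Prop where
  smooth : ContMDiff (𝓡 d) 𝓘(ℝ, F) ∞ φ
  ne_zero : φ ≠ 0
  eigen : ∀ c ∈ IsManifold.maximalAtlas (𝓡 d) ∞ M, ∀ y ∈ c.target,
    laplaceBeltrami c φ y = lam • φ (c.symm y)

/-- `γ : ℝ → M` is a geodesic: in every smooth chart it solves the geodesic equation
`γ̈ᵏ + ∑ᵢⱼ Γᵏᵢⱼ(γ) γ̇ⁱ γ̇ʲ = 0`. -/
structure IsGeodesic (γ : ℝ → M) : Prop where
  smooth : ContMDiff 𝓘(ℝ, ℝ) (𝓡 d) 2 γ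
  eqn : ∀ c ∈ IsManifold.maximalAtlas (𝓡 d) ∞ M, ∀ t : ℝ, γ t ∈ c.source → ∀ k : Fin d,
    deriv (deriv fun s => c (γ s) k) t
      + ∑ i, ∑ j, christoffel c k i j (c (γ t))
          * deriv (fun s => c (γ s) i) t * deriv (fun s => c (γ s) j) t = 0

open Classical in
/-- The geodesic flow: `geodesic z t` is the position at time `t` of the geodesic with initial
position and velocity `z = (x, v)`. (Such a geodesic is unique, and it exists for all times if `M` is
compact; the value is `x` if it does not exist.) -/
def geodesic (z : TangentBundle (𝓡 d) M) (t : ℝ) : M :=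
  if h : ∃ γ : ℝ → M, IsGeodesic (d := d) γ ∧
      (⟨γ 0, mfderiv 𝓘(ℝ, ℝ) (𝓡 d) γ 0 (1 : ℝ)⟩ : TangentBundle (𝓡 d) M) = z
  then h.choose t else z.proj

/-- Each tangent space carries its Borel σ-algebra. -/
instance tangentMeasurableSpace (x : M) : MeasurableSpace (TangentSpace (𝓡 d) x) := borel _

instance tangentBorelSpace (x : M) : BorelSpace (TangentSpace (𝓡 d) x) := ⟨rfl⟩

instance tangentFiniteDimensional (x : M) : FiniteDimensional ℝ (TangentSpace (𝓡 d) x) :=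
  inferInstanceAs (FiniteDimensional ℝ (EuclideanSpace ℝ (Fin d)))

/-- The uniform probability measure `σ_x` on the unit sphere `T¹ₓM` of the Euclidean space `TₓM`:
the normalised surface measure. -/
def unitTangentMeasure (x : M) :
    MeasureTheory.Measure (Metric.sphere (0 : TangentSpace (𝓡 d) x) 1) :=
  ((MeasureTheory.volume : MeasureTheory.Measure (TangentSpace (𝓡 d) x)).toSphere Set.univ)⁻¹ •
    (MeasureTheory.volume : MeasureTheory.Measure (TangentSpace (𝓡 d) x)).toSphere

variable (d) in
/-- The spherical mean of radius `t`: `A_t f (x) = ∫ f(γ((x, v), t)) dσ_x(v)` over `v ∈ T¹ₓM`. -/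
def sphericalMean {F : Type*} [NormedAddCommGroup F] [NormedSpace ℝ F]
    (t : ℝ) (f : M → F) (x : M) : F :=
  ∫ v : Metric.sphere (0 : TangentSpace (𝓡 d) x) 1,
    f (geodesic (⟨x, v⟩ : TangentBundle (𝓡 d) M) t) ∂(unitTangentMeasure x)

end Coordinates

end SphericalMean

end

/-!
# Laplace eigenfunctions and spherical means on compact hyperbolic manifolds

Fix a point `x` and an eigenfunction `φ` with eigenvalue `lam`. As a function of `t`, the spherical mean
`A_t φ (x)` solves the radial eigenvalue equation of hyperbolic space,
`f'' + (d - 1) coth t f' + lam f = 0`. This singular equation has only one solution regular at `0` with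
given value there (`IsRadialSolution.eq_of_eq_zero`, an energy estimate), so that `A_t φ (x)` is the
product of `φ x` with the solution `ν_t(lam)` of value `1` at `0`.

The radial equation for the means is `IsPolarFamily.exists_isRadialSolution`. Its geometric input is that
the exponential map at `x` pulls the metric back to the metric of the ball model of hyperbolic space, away
from the centre (`IsPolarFamily.pullbackInner_ball`). This follows from Gauss's lemma and the Jacobi
equation: in curvature `-1` a normal Jacobi field vanishing at `0` has squared length proportional to
`sinh² t`. All these computations take place in a chart, where the metric and the Christoffel symbols form
an `IsCoordMetric`; quantities with an invariant meaning are expressed through `pullbackInner`. The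
exponential map need not be injective, but it is a local diffeomorphism on the punctured ball, and so its
local inverses are charts in which the eigenvalue equation can be read
(`IsLaplaceEigenfunction.conformal`). Averaging over the sphere removes the spherical part of the
Laplacian (`integral_sphere_laplacian`), which is a sum of squares of infinitesimal rotations.

For geodesics to be defined for all times and to depend smoothly on their initial velocity, one needs
completeness of the geodesic flow (`exists_isGeodesic`, from conservation of speed and compactness) and
smooth dependence of solutions of differential equations on initial conditions. The latter is
`exists_smooth_flow_of_contDiff`: the flow is obtained from the inverse function theorem, applied to the
integral equation in a space of continuous curves.

The explicit solution of the radial equation is the spherical function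
`c_d ∫ (cosh t + cos θ sinh t) ^ s sin θ ^ (d - 2) dθ` with `s (s + d - 1) = -lam`
(`exists_isRadialSolution_sphericalFun`): the equation holds for the integrand up to a total derivative in
`θ`. Uniqueness shows that it is independent of the choice of `s`, and real when `lam` is. The substitution
`x = cos θ` gives the integral formula, and for `d = 3` the integrand has an elementary primitive.

Nonnegativity of `lam` comes from the radial equation too: at a point where `|φ|` is maximal the spherical
mean is bounded by its initial value, whereas a radial solution with `lam < 0` increases
(`IsRadialSolution.nonneg_of_le`).
-/

noncomputable section

namespace SphericalMean

open Set Filter Topology Metric MeasureTheory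
open scoped Pointwise

set_option maxSynthPendingDepth 3
set_option linter.unusedSectionVars false

/-! ### The smooth inverse function theorem -/

section SmoothInverse

/-- Inverse function theorem in the smooth category: the local inverse is smooth on a whole
neighbourhood, namely where the derivative stays invertible. -/
theorem exists_smooth_local_inverse {E F : Type*} [NormedAddCommGroup E] [NormedSpace ℝ E]
    [CompleteSpace E] [NormedAddCommGroup F] [NormedSpace ℝ F] {f : E → F} {U : Set E}
    (hU : IsOpen U) (hf : ContDiffOn ℝ ∞ f U) {x : E} (hx : x ∈ U) (f' : E ≃L[ℝ] F)
    (hf' : HasFDerivAt f (f' : E →L[ℝ] F) x) :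
    ∃ e : OpenPartialHomeomorph E F, (e : E → F) = f ∧ x ∈ e.source ∧ e.source ⊆ U ∧
      ContDiffOn ℝ ∞ e.symm e.target := by
  have hfx : ContDiffAt ℝ ∞ f x := hf.contDiffAt (hU.mem_nhds hx)
  let e₀ := hfx.toOpenPartialHomeomorph f hf' (by simp)
  have hcont : ContinuousOn (fderiv ℝ f) U := hf.continuousOn_fderiv_of_isOpen hU (by simp)
  have hV : ∃ V ⊆ U, IsOpen V ∧ x ∈ V ∧
      ∀ y ∈ V, fderiv ℝ f y ∈ range ((↑) : (E ≃L[ℝ] F) → E →L[ℝ] F) := by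
    have h1 : range ((↑) : (E ≃L[ℝ] F) → E →L[ℝ] F) ∈ 𝓝 (fderiv ℝ f x) := by
      rw [hf'.fderiv]; exact ContinuousLinearEquiv.nhds f'
    have h2 := (hcont.continuousAt (hU.mem_nhds hx)).preimage_mem_nhds h1
    obtain ⟨V, hVs, hVo, hxV⟩ := _root_.mem_nhds_iff.1 (inter_mem h2 (hU.mem_nhds hx))
    exact ⟨V, fun y hy => (hVs hy).2, hVo, hxV, fun y hy => (hVs hy).1⟩
  obtain ⟨V, hVU, hVo, hxV, hVr⟩ := hV
  let e := e₀.restrOpen V hVo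
  have hes : e.source = e₀.source ∩ V := rfl
  refine ⟨e, rfl, ?_, ?_, ?_⟩
  · exact ⟨hfx.mem_toOpenPartialHomeomorph_source hf' (by simp), hxV⟩
  · exact fun y hy => hVU hy.2
  · intro y hy
    have hy' : e.symm y ∈ e.source := e.map_target hy
    obtain ⟨g, hg⟩ := hVr _ hy'.2
    have hd : DifferentiableAt ℝ f (e.symm y) :=
      (hf.contDiffAt (hU.mem_nhds (hVU hy'.2))).differentiableAt (by simp)
    refine (e.contDiffAt_symm (f₀' := g) hy ?_ ?_).contDiffWithinAt
    · rw [hg]; exact hd.hasFDerivAt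
    · exact hf.contDiffAt (hU.mem_nhds (hVU hy'.2))

end SmoothInverse

/-! ### Composition operators on spaces of continuous functions -/

section Superposition

variable {K : Type*} [TopologicalSpace K] [CompactSpace K]
  {X Y Z : Type} [NormedAddCommGroup X] [NormedSpace ℝ X] [NormedAddCommGroup Y] [NormedSpace ℝ Y]
  [NormedAddCommGroup Z] [NormedSpace ℝ Z]

/-- A continuous bilinear map, applied pointwise to continuous functions. -/
def pointwiseBilinear (B : Y →L[ℝ] X →L[ℝ] Z) : C(K, Y) →L[ℝ] C(K, X) →L[ℝ] C(K, Z) :=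
  LinearMap.mkContinuous₂
    (LinearMap.mk₂ ℝ (fun (A : C(K, Y)) (h : C(K, X)) =>
        (⟨fun s => B (A s) (h s), by fun_prop⟩ : C(K, Z)))
      (fun _ _ _ => by ext; simp) (fun _ _ _ => by ext; simp)
      (fun _ _ _ => by ext; simp) (fun _ _ _ => by ext; simp))
    ‖B‖ (by
      intro A h
      rw [ContinuousMap.norm_le _ (by positivity)]
      intro s
      refine (B.le_opNorm₂ _ _).trans ?_
      gcongr
      · exact A.norm_coe_le_norm s
      · exact h.norm_coe_le_norm s)

/-- The pointwise application of a continuous family of operators. -/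
abbrev pointwiseApply : C(K, X →L[ℝ] Z) →L[ℝ] C(K, X) →L[ℝ] C(K, Z) :=
  pointwiseBilinear (ContinuousLinearMap.id ℝ (X →L[ℝ] Z))

/-- Composition with a `C¹` map `f` is differentiable on `C(K, X)`, the derivative being the pointwise
application of the derivative of `f`. -/
theorem hasFDerivAt_comp_continuousMap {f : X → Z} {f' : X → X →L[ℝ] Z}
    (hf : ∀ x, HasFDerivAt f (f' x) x) (hf' : Continuous f') (γ : C(K, X)) :
    HasFDerivAt (fun η : C(K, X) =>
        (⟨f, continuous_iff_continuousAt.2 fun x => (hf x).continuousAt⟩ : C(X, Z)).comp η)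
      (pointwiseApply ((⟨f', hf'⟩ : C(X, X →L[ℝ] Z)).comp γ)) γ := by
  set F' : C(X, X →L[ℝ] Z) := ⟨f', hf'⟩
  rw [hasFDerivAt_iff_isLittleO_nhds_zero, Asymptotics.isLittleO_iff]
  intro ε hε
  have hc : ContinuousAt (fun η : C(K, X) => F'.comp η) γ :=
    (ContinuousMap.continuous_postcomp (X := K) F').continuousAt
  obtain ⟨δ, hδ, hδ'⟩ :=
    (Metric.continuousAt_iff (α := C(K, X)) (β := C(K, X →L[ℝ] Z))).1 hc ε hε
  filter_upwards [Metric.ball_mem_nhds (0 : C(K, X)) hδ] with h hh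
  rw [mem_ball_zero_iff] at hh
  rw [ContinuousMap.norm_le _ (by positivity)]
  intro s
  -- continuity of the composition with `f'` at `γ`, tested on translates of `γ`, makes `f'` uniformly
  -- continuous along `γ`
  have key : ∀ y ∈ ball (γ s) δ, ‖f' y - f' (γ s)‖ ≤ ε := by
    intro y hy
    have h1 : dist (γ + ContinuousMap.const K (y - γ s)) γ < δ := by
      rw [dist_eq_norm, add_sub_cancel_left]
      refine lt_of_le_of_lt ((ContinuousMap.norm_le _ (norm_nonneg (y - γ s))).2 fun _ => le_rfl) ?_
      rwa [mem_ball, dist_eq_norm] at hy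
    have h2 := (ContinuousMap.dist_apply_le_dist (f := F'.comp (γ + ContinuousMap.const K (y - γ s)))
      (g := F'.comp γ) s).trans (hδ' h1).le
    simpa [dist_eq_norm, F'] using h2
  have hs : γ s + h s ∈ ball (γ s) δ := by
    rw [mem_ball, dist_eq_norm, add_sub_cancel_left]
    exact (h.norm_coe_le_norm s).trans_lt hh
  have := (convex_ball (γ s) δ).norm_image_sub_le_of_norm_hasFDerivWithin_le' (𝕜 := ℝ)
    (fun y _ => (hf y).hasFDerivWithinAt) key (mem_ball_self hδ) hs
  rw [add_sub_cancel_left] at this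
  exact this.trans (mul_le_mul_of_nonneg_left (h.norm_coe_le_norm s) hε.le)

end Superposition

/-- Composition with a smooth map is a smooth operator between spaces of continuous functions on a
compact space. -/
theorem contDiff_comp_continuousMap {K : Type*} [TopologicalSpace K] [CompactSpace K] (n : ℕ)
    {X Z : Type} [NormedAddCommGroup X] [NormedSpace ℝ X] [NormedAddCommGroup Z] [NormedSpace ℝ Z]
    {f : X → Z} (hf : ContDiff ℝ ∞ f) :
    ContDiff ℝ n (fun η : C(K, X) => (⟨f, hf.continuous⟩ : C(X, Z)).comp η) := by
  induction n generalizing Z with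
  | zero =>
    exact contDiff_zero.2 (ContinuousMap.continuous_postcomp _)
  | succ n ih =>
    have hf' : ContDiff ℝ ∞ (fderiv ℝ f) := hf.fderiv_right (by simp)
    have hd : ∀ x, HasFDerivAt f (fderiv ℝ f x) x :=
      fun x => (hf.differentiable (by simp) x).hasFDerivAt
    push_cast
    rw [contDiff_succ_iff_hasFDerivAt]
    refine ⟨_, ?_, fun γ => hasFDerivAt_comp_continuousMap hd hf'.continuous γ⟩
    exact (pointwiseApply (K := K) (X := X) (Z := Z)).contDiff.comp (ih hf')

/-! ### Smooth flows of ordinary differential equations -/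

section Flow

variable {X : Type} [NormedAddCommGroup X] [NormedSpace ℝ X]

/-- The time interval on which the integral equation of the flow is solved. -/
abbrev FlowTime : Type := Icc (-1 : ℝ) 1

/-- The integration operator `γ ↦ ∫₀ˢ γ` on continuous functions on `[-1, 1]`. -/
def volterra : C(FlowTime, X) →L[ℝ] C(FlowTime, X) :=
  LinearMap.mkContinuous
    { toFun := fun γ => ⟨fun s => ∫ u in (0 : ℝ)..s, γ (projIcc (-1) 1 (by norm_num) u), by
        have hc : Continuous fun u : ℝ => γ (projIcc (-1) 1 (by norm_num) u) :=
          γ.continuous.comp continuous_projIcc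
        exact (intervalIntegral.continuous_primitive
          (fun a b => hc.intervalIntegrable a b) 0).comp continuous_subtype_val⟩
      map_add' := by
        intro γ η
        ext s
        have hc (γ : C(FlowTime, X)) : Continuous fun u : ℝ => γ (projIcc (-1) 1 (by norm_num) u) :=
          γ.continuous.comp continuous_projIcc
        simp only [ContinuousMap.coe_mk, ContinuousMap.add_apply]
        exact intervalIntegral.integral_add ((hc γ).intervalIntegrable _ _)
          ((hc η).intervalIntegrable _ _)
      map_smul' := by
        intro c γ
        ext s
        simp only [ContinuousMap.coe_mk, ContinuousMap.smul_apply, RingHom.id_apply]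
        exact intervalIntegral.integral_smul _ _ }
    1 (by
      intro γ
      rw [one_mul, ContinuousMap.norm_le _ (norm_nonneg _)]
      intro s
      refine (intervalIntegral.norm_integral_le_of_norm_le_const (C := ‖γ‖)
        fun u _ => γ.norm_coe_le_norm _).trans ?_
      have : |(s : ℝ) - 0| ≤ 1 := by rw [sub_zero, abs_le]; exact s.2
      nlinarith [norm_nonneg γ])

theorem volterra_apply (γ : C(FlowTime, X)) (s : FlowTime) :
    volterra γ s = ∫ u in (0 : ℝ)..s, γ (projIcc (-1) 1 (by norm_num) u) := rfl

/-- The curve `s ↦ γ (r s)`, for a factor `r ∈ [-1, 1]`. -/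
def rescale (r : FlowTime) (γ : C(FlowTime, X)) : C(FlowTime, X) :=
  ⟨fun s => γ ⟨r * s, by
    have h1 := abs_le.2 r.2
    have h2 := abs_le.2 s.2
    exact abs_le.1 (by rw [abs_mul]; nlinarith [abs_nonneg (r : ℝ), abs_nonneg (s : ℝ)])⟩,
    by fun_prop⟩

/-- Shrinking time by the factor `r` turns a solution of `γ = x + t ∫ f(γ)` into a solution of the same
equation with `r t` in place of `t`. -/
theorem volterra_rescale (r : FlowTime) (γ : C(FlowTime, X)) (s : FlowTime) :
    (r : ℝ) • volterra (rescale r γ) s = rescale r (volterra γ) s := by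
  have key : EqOn (fun u => rescale r γ (projIcc (-1) 1 (by norm_num) u))
      (fun u => γ (projIcc (-1) 1 (by norm_num) (r * u))) (uIcc (0 : ℝ) s) := by
    intro u hu
    have hu' : u ∈ Icc (-1 : ℝ) 1 := by
      rcases mem_uIcc.1 hu with h | h
      · exact ⟨by linarith [h.1], h.2.trans s.2.2⟩
      · exact ⟨s.2.1.trans h.1, by linarith [h.2]⟩
    have h1 := abs_le.2 r.2
    have h2 := abs_le.2 hu'
    have h3 : (r : ℝ) * u ∈ Icc (-1 : ℝ) 1 :=
      abs_le.1 (by rw [abs_mul]; nlinarith [abs_nonneg (r : ℝ), abs_nonneg u])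
    simp only [projIcc_of_mem _ hu', projIcc_of_mem _ h3, rescale, ContinuousMap.coe_mk]
  rw [volterra_apply, intervalIntegral.integral_congr key]
  change (r : ℝ) • (∫ u in (0 : ℝ)..s, (fun v => γ (projIcc (-1) 1 (by norm_num) v)) (r * u)) = _
  rw [intervalIntegral.smul_integral_comp_mul_left
    (f := fun v => γ (projIcc (-1) 1 (by norm_num) v)), mul_zero]
  rfl

/-- Smooth dependence on the initial condition for an autonomous ODE with a globally defined smooth
vector field `f`: apply the inverse function theorem to `(x, ε, γ) ↦ (x, ε, γ - x - ε ∫ f(γ))`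
at `ε = 0`, and use that `γ` at time `1` for the field `ε f` is the solution at time `ε`. -/
theorem exists_smooth_flow_of_contDiff [CompleteSpace X] {f : X → X} (hf : ContDiff ℝ ∞ f) (x₀ : X) :
    ∃ ε > 0, ∃ Y : X → ℝ → X,
      ContDiffOn ℝ ∞ (fun p : X × ℝ => Y p.1 p.2) (ball x₀ ε ×ˢ Ioo (-ε) ε) ∧
      ∀ x ∈ ball x₀ ε, Y x 0 = x ∧ ∀ t ∈ Ioo (-ε) ε, HasDerivAt (Y x) (f (Y x t)) t := by
  let fC : C(X, X) := ⟨f, hf.continuous⟩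
  let N : C(FlowTime, X) → C(FlowTime, X) := fun η => fC.comp η
  have hN : ContDiff ℝ ∞ N := contDiff_infty.2 fun n => contDiff_comp_continuousMap n hf
  let cst : X →L[ℝ] C(FlowTime, X) := ContinuousLinearMap.const ℝ FlowTime
  have hcst : ∀ x s, cst x s = x := fun _ _ => rfl
  let W := (X × ℝ) × C(FlowTime, X)
  let Ψ : W → W := fun p => (p.1, p.2 - cst p.1.1 - p.1.2 • volterra (N p.2))
  have h1 : ContDiff ℝ ∞ fun p : W => volterra (N p.2) :=
    volterra.contDiff.comp (hN.comp contDiff_snd)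
  have hΨ : ContDiff ℝ ∞ Ψ := by
    have h2 : ContDiff ℝ ∞ fun p : W => cst p.1.1 :=
      cst.contDiff.comp (contDiff_fst.comp contDiff_fst)
    exact contDiff_fst.prodMk ((contDiff_snd.sub h2).sub
        ((contDiff_snd.comp contDiff_fst).smul h1))
  let p₀ : W := ((x₀, 0), cst x₀)
  have hΨp₀ : Ψ p₀ = ((x₀, 0), 0) := by simp [Ψ, p₀]
  let v₀ : C(FlowTime, X) := volterra (N (cst x₀))
  let B : X × ℝ →L[ℝ] C(FlowTime, X) :=
    cst.comp (ContinuousLinearMap.fst ℝ X ℝ) + (ContinuousLinearMap.snd ℝ X ℝ).smulRight v₀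
  let Ψ' : W ≃L[ℝ] W := (ContinuousLinearEquiv.refl ℝ (X × ℝ)).skewProd
    (ContinuousLinearEquiv.refl ℝ C(FlowTime, X)) (-B)
  have hΨ' : HasFDerivAt Ψ (Ψ' : W →L[ℝ] W) p₀ := by
    have hfst : HasFDerivAt (fun p : W => p.1) (ContinuousLinearMap.fst ℝ _ _) p₀ :=
      hasFDerivAt_fst
    have hsnd : HasFDerivAt (fun p : W => p.2) (ContinuousLinearMap.snd ℝ _ _) p₀ :=
      hasFDerivAt_snd
    have hV := (h1.differentiable (by simp) p₀).hasFDerivAt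
    have h3 := ((hsnd.sub (cst.hasFDerivAt.comp p₀ (hasFDerivAt_fst.comp p₀ hfst))).sub
      ((hasFDerivAt_snd.comp p₀ hfst).smul hV))
    refine (hfst.prodMk h3).congr_fderiv ?_
    refine ContinuousLinearMap.ext fun q => ?_
    refine Prod.ext ?_ ?_
    · rfl
    · change q.2 - cst q.1.1 - ((0 : ℝ) • fderiv ℝ (fun p : W => volterra (N p.2)) p₀ q +
        q.1.2 • v₀) = q.2 + -(cst q.1.1 + q.1.2 • v₀)
      rw [zero_smul, zero_add, sub_sub, sub_eq_add_neg]
  obtain ⟨e, he, hp₀, -, hes⟩ := exists_smooth_local_inverse isOpen_univ hΨ.contDiffOn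
    (mem_univ p₀) Ψ' hΨ'
  have htgt : ((x₀, (0 : ℝ)), (0 : C(FlowTime, X))) ∈ e.target := by
    rw [← hΨp₀, ← he]; exact e.map_source hp₀
  have hsymm₀ : e.symm ((x₀, (0 : ℝ)), (0 : C(FlowTime, X))) = p₀ := by
    rw [← hΨp₀, ← he]; exact e.left_inv hp₀
  obtain ⟨δ, hδ, hδs⟩ := Metric.isOpen_iff.1 e.open_source p₀ hp₀
  have hnear : {q : W | q ∈ e.target ∧ e.symm q ∈ ball p₀ δ} ∈
      𝓝 ((x₀, (0 : ℝ)), (0 : C(FlowTime, X))) := by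
    refine inter_mem (e.open_target.mem_nhds htgt) (t := e.symm ⁻¹' ball p₀ δ) ?_
    refine (e.continuousAt_symm htgt).preimage_mem_nhds ?_
    rw [hsymm₀]; exact ball_mem_nhds _ hδ
  obtain ⟨ε', hε', hball⟩ := Metric.mem_nhds_iff.1 hnear
  set ε := min ε' δ with hε_def
  have hε : 0 < ε := lt_min hε' hδ
  have hin : ∀ x ∈ ball x₀ ε, ∀ t ∈ Ioo (-ε) ε, ((x, t), (0 : C(FlowTime, X))) ∈ e.target ∧
      e.symm ((x, t), 0) ∈ ball p₀ δ := by
    intro x hx t ht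
    refine hball ?_
    have ht' : |t| < ε := abs_lt.2 ht
    simp only [mem_ball, Prod.dist_eq, dist_self, Real.dist_eq, sub_zero] at hx ⊢
    have := min_le_left ε' δ
    exact max_lt (max_lt (by linarith) (by linarith)) hε'
  let γ : X → ℝ → C(FlowTime, X) := fun x t => (e.symm ((x, t), 0)).2
  have hsol : ∀ x ∈ ball x₀ ε, ∀ t ∈ Ioo (-ε) ε, e.symm ((x, t), 0) = ((x, t), γ x t) ∧
      γ x t = cst x + t • volterra (N (γ x t)) := by
    intro x hx t ht
    have h := e.right_inv (hin x hx t ht).1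
    rw [he] at h
    have h2 : (e.symm ((x, t), 0)).1 = (x, t) := congrArg Prod.fst h
    refine ⟨Prod.ext h2 rfl, ?_⟩
    have h3 := congrArg Prod.snd h
    simp only [Ψ, h2] at h3
    rw [sub_sub, sub_eq_zero] at h3
    exact h3
  let one : FlowTime := ⟨1, by norm_num⟩
  -- the solution for the field `t f` at time `r` is the solution for `r t f` at time `1`
  have hscale : ∀ x ∈ ball x₀ ε, ∀ t ∈ Ioo (-ε) ε, ∀ r : FlowTime,
      γ x (r * t) one = γ x t r := by
    intro x hx t ht r
    have hrt : (r : ℝ) * t ∈ Ioo (-ε) ε := by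
      have h1 := abs_le.2 r.2
      have h2 := abs_lt.2 ht
      refine abs_lt.1 ?_
      rw [abs_mul]
      nlinarith [abs_nonneg (r : ℝ), abs_nonneg t]
    have hb := (hin x hx t ht).2
    rw [(hsol x hx t ht).1] at hb
    have hbs : dist (γ x t) (cst x₀) < δ := by
      rw [mem_ball, Prod.dist_eq] at hb
      exact (le_max_right _ _).trans_lt hb
    have hbs' : dist (rescale r (γ x t)) (cst x₀) < δ := by
      refine lt_of_le_of_lt ((ContinuousMap.dist_le dist_nonneg).2 fun s => ?_) hbs
      exact ContinuousMap.dist_apply_le_dist (f := γ x t) (g := cst x₀) _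
    have hmem : (((x, (r : ℝ) * t), rescale r (γ x t)) : W) ∈ e.source := by
      refine hδs ?_
      have hrt' : |(r : ℝ) * t| < ε := abs_lt.2 hrt
      have := min_le_right ε' δ
      rw [mem_ball] at hx
      rw [mem_ball, Prod.dist_eq, Prod.dist_eq]
      refine max_lt (max_lt (hx.trans_le this) ?_) hbs'
      change dist ((r : ℝ) * t) 0 < δ
      rw [Real.dist_eq, sub_zero]
      linarith
    have hval : e ((x, (r : ℝ) * t), rescale r (γ x t)) = ((x, (r : ℝ) * t), 0) := by
      rw [he]
      refine Prod.ext rfl ?_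
      change rescale r (γ x t) - cst x - ((r : ℝ) * t) • volterra (N (rescale r (γ x t))) = 0
      rw [sub_sub, sub_eq_zero]
      ext s
      have h4 := volterra_rescale r (N (γ x t)) s
      have h5 : N (rescale r (γ x t)) = rescale r (N (γ x t)) := rfl
      have h6 := congrArg (fun η => rescale r η s) (hsol x hx t ht).2
      change rescale r (γ x t) s = x + ((r : ℝ) * t) • volterra (N (rescale r (γ x t))) s
      rw [h5, mul_comm, mul_smul, h4]
      exact h6
    have h7 := e.left_inv hmem
    rw [hval] at h7
    have h8 : γ x (r * t) = rescale r (γ x t) := congrArg Prod.snd h7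
    rw [h8]
    change γ x t _ = γ x t r
    congr 1
    exact Subtype.ext (mul_one _)
  refine ⟨ε, hε, fun x t => γ x t one, ?_, fun x hx => ⟨?_, ?_⟩⟩
  · have h1 : ContDiffOn ℝ ∞ (fun p : X × ℝ => e.symm ((p.1, p.2), 0))
        (ball x₀ ε ×ˢ Ioo (-ε) ε) := by
      refine hes.comp (t := e.target) (ContDiff.contDiffOn ?_) fun p hp =>
        (hin p.1 hp.1 p.2 hp.2).1
      exact contDiff_id.prodMk contDiff_const
    let ev : C(FlowTime, X) →L[ℝ] X := ContinuousMap.evalCLM ℝ one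
    exact ev.contDiff.comp_contDiffOn (contDiff_snd.comp_contDiffOn h1)
  · have h := congrArg (fun η => η one) (hsol x hx 0 ⟨by linarith, hε⟩).2
    simpa [hcst] using h
  · intro t ht
    set T := (|t| + ε) / 2 with hT
    have ht' := abs_lt.2 ht
    have hT0 : 0 < T := by positivity
    have hTm : T ∈ Ioo (-ε) ε := ⟨by linarith, by linarith⟩
    have htT : |t| < T := by linarith
    have hIcc : ∀ s : ℝ, |s| < T → s / T ∈ Icc (-1 : ℝ) 1 := by
      intro s hs
      refine abs_le.1 ?_
      rw [abs_div, abs_of_pos hT0, div_le_one hT0]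
      exact hs.le
    have hg : Continuous fun u : ℝ => f (γ x T (projIcc (-1) 1 (by norm_num) u)) :=
      hf.continuous.comp ((γ x T).continuous.comp continuous_projIcc)
    have heq : (fun s => γ x s one) =ᶠ[𝓝 t] fun s =>
        x + T • ∫ u in (0 : ℝ)..(s / T), f (γ x T (projIcc (-1) 1 (by norm_num) u)) := by
      have hopen : {s : ℝ | |s| < T} ∈ 𝓝 t := (isOpen_lt continuous_abs continuous_const).mem_nhds htT
      filter_upwards [hopen] with s hs
      have h1 := hscale x hx T hTm ⟨s / T, hIcc s hs⟩
      rw [div_mul_cancel₀ _ hT0.ne'] at h1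
      rw [h1]
      exact congrArg (fun η => η ⟨s / T, hIcc s hs⟩) (hsol x hx T hTm).2
    have hder : HasDerivAt (fun s => x + T • ∫ u in (0 : ℝ)..(s / T),
        f (γ x T (projIcc (-1) 1 (by norm_num) u))) (T • ((1 / T) •
          f (γ x T (projIcc (-1) 1 (by norm_num) (t / T))))) t := by
      refine HasDerivAt.const_add x (HasDerivAt.const_smul T ?_)
      exact HasDerivAt.scomp t (hg.integral_hasStrictDerivAt 0 (t / T)).hasDerivAt
        ((hasDerivAt_id t).div_const T)
    rw [smul_smul, mul_one_div_cancel hT0.ne', one_smul, projIcc_of_mem _ (hIcc t htT)] at hder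
    have h1 := hscale x hx T hTm ⟨t / T, hIcc t htT⟩
    rw [div_mul_cancel₀ _ hT0.ne'] at h1
    rw [← h1] at hder
    exact hder.congr_of_eventuallyEq heq

/-- Local smooth flow of a vector field that is smooth on an open set; a cut-off reduces it to a
globally defined field. -/
theorem exists_smooth_flow [FiniteDimensional ℝ X] {f : X → X} {U : Set X} (hU : IsOpen U)
    (hf : ContDiffOn ℝ ∞ f U) {x₀ : X} (hx₀ : x₀ ∈ U) :
    ∃ ε > 0, ∃ Y : X → ℝ → X,
      ContDiffOn ℝ ∞ (fun p : X × ℝ => Y p.1 p.2) (ball x₀ ε ×ˢ Ioo (-ε) ε) ∧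
      ∀ x ∈ ball x₀ ε, Y x 0 = x ∧
        ∀ t ∈ Ioo (-ε) ε, Y x t ∈ U ∧ HasDerivAt (Y x) (f (Y x t)) t := by
  have : CompleteSpace X := FiniteDimensional.complete ℝ X
  obtain ⟨R, hR, hRU⟩ := Metric.isOpen_iff.1 hU x₀ hx₀
  let χ : ContDiffBump x₀ := ⟨R / 3, R / 2, by positivity, by linarith⟩
  have hsupp : tsupport χ ⊆ U := by
    rw [χ.tsupport_eq]
    exact (closedBall_subset_ball (by change R / 2 < R; linarith)).trans hRU
  have hF : ContDiff ℝ ∞ fun x => χ x • f x := by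
    rw [contDiff_iff_contDiffAt]
    intro x
    by_cases hx : x ∈ tsupport χ
    · exact χ.contDiff.contDiffAt.smul (hf.contDiffAt (hU.mem_nhds (hsupp hx)))
    · have : (fun x => χ x • f x) =ᶠ[𝓝 x] fun _ => 0 := by
        filter_upwards [(isClosed_tsupport χ).isOpen_compl.mem_nhds hx] with y hy
        rw [image_eq_zero_of_notMem_tsupport hy, zero_smul]
      exact contDiffAt_const.congr_of_eventuallyEq this
  obtain ⟨ε, hε, Y, hY, hYx⟩ := exists_smooth_flow_of_contDiff hF x₀
  have hc : ContinuousAt (fun p : X × ℝ => Y p.1 p.2) (x₀, 0) :=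
    hY.continuousOn.continuousAt (prod_mem_nhds (ball_mem_nhds _ hε)
      (Ioo_mem_nhds (by linarith) hε))
  have hY0 : Y x₀ 0 = x₀ := (hYx x₀ (mem_ball_self hε)).1
  have h1 : ∀ᶠ p : X × ℝ in 𝓝 (x₀, 0), Y p.1 p.2 ∈ ball x₀ (R / 3) := by
    refine hc.eventually_mem ?_
    rw [hY0]; exact ball_mem_nhds _ (by positivity)
  obtain ⟨ε', hε', hb⟩ := Metric.mem_nhds_iff.1 h1
  have hle := min_le_left ε ε'
  have hle' := min_le_right ε ε'
  have hsub1 : ball x₀ (min ε ε') ⊆ ball x₀ ε := ball_subset_ball hle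
  have hsub2 : Ioo (-min ε ε') (min ε ε') ⊆ Ioo (-ε) ε := Ioo_subset_Ioo (by linarith) hle
  refine ⟨min ε ε', lt_min hε hε', Y, hY.mono (prod_mono hsub1 hsub2), fun x hx =>
    ⟨(hYx x (hsub1 hx)).1, fun t ht => ?_⟩⟩
  have hin : Y x t ∈ ball x₀ (R / 3) := by
    refine hb (a := (x, t)) ?_
    rw [← ball_prod_same]
    refine ⟨ball_subset_ball hle' hx, ?_⟩
    rw [mem_ball, Real.dist_eq, sub_zero]
    exact (abs_lt.2 ht).trans_le hle'
  refine ⟨hRU (ball_subset_ball (by linarith) hin), ?_⟩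
  have h2 := (hYx x (hsub1 hx)).2 t (hsub2 ht)
  rwa [χ.one_of_mem_closedBall (ball_subset_closedBall hin), one_smul] at h2

end Flow

/-! ### Riemannian geometry in coordinates -/

section CoordinateGeometry

variable {V : Type*} [NormedAddCommGroup V] [NormedSpace ℝ V]

/-- A Riemannian metric `g` on an open set `U` of a vector space, together with its Christoffel
symbol `Γ`, as smooth bilinear maps; `koszul` is the Koszul formula characterising `Γ`. -/
structure IsCoordMetric (U : Set V) (g : V → V →L[ℝ] V →L[ℝ] ℝ) (Γ : V → V →L[ℝ] V →L[ℝ] V) :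
    Prop where
  isOpen : IsOpen U
  smooth : ContDiffOn ℝ ∞ g U
  smooth_christoffel : ContDiffOn ℝ ∞ Γ U
  symm : ∀ y ∈ U, ∀ u v, g y u v = g y v u
  pos : ∀ y ∈ U, ∀ v, v ≠ 0 → 0 < g y v v
  koszul : ∀ y ∈ U, ∀ u v w, g y (Γ y u v) w =
    (1 / 2) * (fderiv ℝ g y u v w + fderiv ℝ g y v u w - fderiv ℝ g y w u v)

/-- The curvature `R(u, v) w` of the connection with Christoffel symbol `Γ`. -/
def coordCurvature (Γ : V → V →L[ℝ] V →L[ℝ] V) (y u v w : V) : V :=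
  fderiv ℝ Γ y u v w - fderiv ℝ Γ y v u w + Γ y u (Γ y v w) - Γ y v (Γ y u w)

variable {U : Set V} {g : V → V →L[ℝ] V →L[ℝ] ℝ} {Γ : V → V →L[ℝ] V →L[ℝ] V}

namespace IsCoordMetric

theorem hasFDerivAt (h : IsCoordMetric U g Γ) {y : V} (hy : y ∈ U) :
    HasFDerivAt g (fderiv ℝ g y) y :=
  ((h.smooth.contDiffAt (h.isOpen.mem_nhds hy)).differentiableAt (by simp)).hasFDerivAt

theorem hasFDerivAt_christoffel (h : IsCoordMetric U g Γ) {y : V} (hy : y ∈ U) :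
    HasFDerivAt Γ (fderiv ℝ Γ y) y :=
  ((h.smooth_christoffel.contDiffAt (h.isOpen.mem_nhds hy)).differentiableAt (by simp)).hasFDerivAt

theorem hasFDerivAt_fderiv (h : IsCoordMetric U g Γ) {y : V} (hy : y ∈ U) :
    HasFDerivAt (fderiv ℝ g) (fderiv ℝ (fderiv ℝ g) y) y :=
  (((h.smooth.contDiffAt (h.isOpen.mem_nhds hy)).fderiv_right (m := ∞) (by simp)).differentiableAt
    (by simp)).hasFDerivAt

theorem fderiv_symm (h : IsCoordMetric U g Γ) {y : V} (hy : y ∈ U) (u v w : V) :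
    fderiv ℝ g y u v w = fderiv ℝ g y u w v := by
  have h1 := ((h.hasFDerivAt hy).clm_apply (hasFDerivAt_const v y)).clm_apply
    (hasFDerivAt_const w y)
  have h2 := ((h.hasFDerivAt hy).clm_apply (hasFDerivAt_const w y)).clm_apply
    (hasFDerivAt_const v y)
  have h3 : (fun z => g z v w) =ᶠ[𝓝 y] fun z => g z w v := by
    filter_upwards [h.isOpen.mem_nhds hy] with z hz using h.symm z hz v w
  have := congrArg (fun L => L u) ((h1.congr_of_eventuallyEq h3.symm).unique h2)
  simpa using this

theorem fderiv2_symm_right (h : IsCoordMetric U g Γ) {y : V} (hy : y ∈ U) (a u v w : V) :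
    fderiv ℝ (fderiv ℝ g) y a u v w = fderiv ℝ (fderiv ℝ g) y a u w v := by
  have h0 := (h.hasFDerivAt_fderiv hy).clm_apply (hasFDerivAt_const u y)
  have h1 := (h0.clm_apply (hasFDerivAt_const v y)).clm_apply (hasFDerivAt_const w y)
  have h2 := (h0.clm_apply (hasFDerivAt_const w y)).clm_apply (hasFDerivAt_const v y)
  have h3 : (fun z => fderiv ℝ g z u v w) =ᶠ[𝓝 y] fun z => fderiv ℝ g z u w v := by
    filter_upwards [h.isOpen.mem_nhds hy] with z hz using h.fderiv_symm hz u v w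
  have := congrArg (fun L => L a) ((h1.congr_of_eventuallyEq h3.symm).unique h2)
  simpa using this

theorem fderiv2_symm_left (h : IsCoordMetric U g Γ) {y : V} (hy : y ∈ U) (a u v w : V) :
    fderiv ℝ (fderiv ℝ g) y a u v w = fderiv ℝ (fderiv ℝ g) y u a v w := by
  have hs : IsSymmSndFDerivAt ℝ g y :=
    (h.smooth.contDiffAt (h.isOpen.mem_nhds hy)).isSymmSndFDerivAt
      (by rw [minSmoothness_of_isRCLikeNormedField]; exact ENat.LEInfty.out)
  rw [hs.eq a u]

/-- A vector is determined by its inner products. -/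
theorem eq_of_inner (h : IsCoordMetric U g Γ) {y : V} (hy : y ∈ U) {u v : V}
    (huv : ∀ w, g y u w = g y v w) : u = v := by
  by_contra hne
  have := h.pos y hy (u - v) (sub_ne_zero.2 hne)
  have h2 := huv (u - v)
  rw [map_sub (g y), sub_apply, h2, sub_self] at this
  exact lt_irrefl _ this

theorem christoffel_symm (h : IsCoordMetric U g Γ) {y : V} (hy : y ∈ U) (u v : V) :
    Γ y u v = Γ y v u := by
  refine h.eq_of_inner hy fun w => ?_
  rw [h.koszul y hy, h.koszul y hy, h.fderiv_symm hy w u v]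
  ring

theorem fderiv_christoffel_symm (h : IsCoordMetric U g Γ) {y : V} (hy : y ∈ U) (a u v : V) :
    fderiv ℝ Γ y a u v = fderiv ℝ Γ y a v u := by
  have h1 := ((h.hasFDerivAt_christoffel hy).clm_apply (hasFDerivAt_const u y)).clm_apply
    (hasFDerivAt_const v y)
  have h2 := ((h.hasFDerivAt_christoffel hy).clm_apply (hasFDerivAt_const v y)).clm_apply
    (hasFDerivAt_const u y)
  have h3 : (fun z => Γ z u v) =ᶠ[𝓝 y] fun z => Γ z v u := by
    filter_upwards [h.isOpen.mem_nhds hy] with z hz using h.christoffel_symm hz u v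
  have := congrArg (fun L => L a) ((h1.congr_of_eventuallyEq h3.symm).unique h2)
  simpa using this

/-- The Levi-Civita connection is compatible with the metric. -/
theorem fderiv_eq (h : IsCoordMetric U g Γ) {y : V} (hy : y ∈ U) (u v w : V) :
    fderiv ℝ g y u v w = g y (Γ y u v) w + g y v (Γ y u w) := by
  rw [h.symm y hy v, h.koszul y hy, h.koszul y hy, h.fderiv_symm hy u w v, h.fderiv_symm hy w u v,
    h.fderiv_symm hy v u w]
  ring

/-- The differentiated Koszul formula. -/
theorem inner_fderiv_christoffel (h : IsCoordMetric U g Γ) {y : V} (hy : y ∈ U) (u v w z : V) :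
    g y (fderiv ℝ Γ y u v w) z = (1 / 2) * (fderiv ℝ (fderiv ℝ g) y u v w z +
      fderiv ℝ (fderiv ℝ g) y u w v z - fderiv ℝ (fderiv ℝ g) y u z v w)
      - g y (Γ y u (Γ y v w)) z - g y (Γ y v w) (Γ y u z) := by
  have hD := h.hasFDerivAt_fderiv hy
  have c (a : V) := hasFDerivAt_const (𝕜 := ℝ) a y
  have e (a b d : V) := ((hD.clm_apply (c a)).clm_apply (c b)).clm_apply (c d)
  have h1 := ((h.hasFDerivAt hy).clm_apply
    (((h.hasFDerivAt_christoffel hy).clm_apply (c v)).clm_apply (c w))).clm_apply (c z)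
  have h2 := (((e v w z).add (e w v z)).sub (e z v w)).const_mul (1 / 2)
  have h3 : (fun x => g x (Γ x v w) z) =ᶠ[𝓝 y] fun x =>
      (1 / 2) * (fderiv ℝ g x v w z + fderiv ℝ g x w v z - fderiv ℝ g x z v w) := by
    filter_upwards [h.isOpen.mem_nhds hy] with x hx using h.koszul x hx v w z
  have h4 := congrArg (fun L => L u) ((h1.congr_of_eventuallyEq h3.symm).unique h2)
  simp only [add_apply, sub_apply,
    smul_apply, ContinuousLinearMap.comp_apply,
    ContinuousLinearMap.flip_apply, zero_apply, map_zero, smul_eq_mul,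
    zero_add] at h4
  have h5 := h.fderiv_eq hy u (Γ y v w) z
  linarith

/-- The curvature tensor in terms of the second derivatives of the metric and of the Christoffel
symbols. -/
theorem inner_curvature (h : IsCoordMetric U g Γ) {y : V} (hy : y ∈ U) (u v w z : V) :
    g y (coordCurvature Γ y u v w) z = (1 / 2) * (fderiv ℝ (fderiv ℝ g) y u w v z
      - fderiv ℝ (fderiv ℝ g) y u z v w - fderiv ℝ (fderiv ℝ g) y v w u z
      + fderiv ℝ (fderiv ℝ g) y v z u w)
      - g y (Γ y v w) (Γ y u z) + g y (Γ y u w) (Γ y v z) := by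
  simp only [coordCurvature, map_add, map_sub, add_apply,
    sub_apply]
  rw [h.inner_fderiv_christoffel hy, h.inner_fderiv_christoffel hy, h.fderiv2_symm_left hy v u]
  ring

/-- The operator `J ↦ R(J, T) T` is self-adjoint, so the sectional curvatures determine it by
polarisation. -/
theorem inner_curvature_symm (h : IsCoordMetric U g Γ) {y : V} (hy : y ∈ U) (J T K : V) :
    g y (coordCurvature Γ y J T T) K = g y (coordCurvature Γ y K T T) J := by
  rw [h.inner_curvature hy, h.inner_curvature hy, h.fderiv2_symm_left hy K T T J,
    h.fderiv2_symm_left hy J T T K, h.fderiv2_symm_left hy K J T T,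
    h.fderiv2_symm_right hy T T K J, h.fderiv2_symm_right hy T K J T,
    h.fderiv2_symm_right hy T J K T, h.christoffel_symm hy K J, h.christoffel_symm hy T K,
    h.christoffel_symm hy T J, h.symm y hy (Γ y J T)]
  ring

/-- In constant curvature `-1`, `R(J, T) T = -J` if `T` is a unit vector orthogonal to `J`. -/
theorem inner_curvature_of_const (h : IsCoordMetric U g Γ) {y : V} (hy : y ∈ U)
    (hK : ∀ v w, g y (coordCurvature Γ y v w w) v = -(g y v v * g y w w - g y v w ^ 2))
    {J T : V} (hT : g y T T = 1) (hJ : g y J T = 0) : coordCurvature Γ y J T T = -J := by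
  refine h.eq_of_inner hy fun K => ?_
  -- polarisation: compare the sectional curvature form at `J + K`, `J` and `K`
  have h1 := hK (J + K) T
  have h2 := hK J T
  have h3 := hK K T
  have h4 := h.inner_curvature_symm hy J T K
  have hadd : coordCurvature Γ y (J + K) T T =
      coordCurvature Γ y J T T + coordCurvature Γ y K T T := by
    simp only [coordCurvature, map_add, add_apply]; abel
  rw [hadd] at h1
  simp only [map_add, map_neg, add_apply, neg_apply,
    hT, hJ] at h1 h2 h3 ⊢
  have h5 := h.symm y hy J K
  linarith

/-- The product rule for the metric along a curve `y`, in terms of covariant derivatives. -/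
theorem hasDerivAt_inner (h : IsCoordMetric U g Γ) {y X Y : ℝ → V} {y' X' Y' : V} {t : ℝ}
    (hyt : y t ∈ U) (hy : HasDerivAt y y' t) (hX : HasDerivAt X X' t) (hY : HasDerivAt Y Y' t) :
    HasDerivAt (fun s => g (y s) (X s) (Y s))
      (g (y t) (X' + Γ (y t) y' (X t)) (Y t) + g (y t) (X t) (Y' + Γ (y t) y' (Y t))) t := by
  have h1 := (((h.hasFDerivAt hyt).comp_hasDerivAt t hy).clm_apply hX).clm_apply hY
  refine h1.congr_deriv ?_
  simp only [Function.comp_apply, map_add, add_apply, h.fderiv_eq hyt]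
  ring

/-- The Jacobi equation: the second covariant derivative of a solution `J` of the linearised
geodesic equation along a geodesic `y` with velocity `T` is `-R(J, T) T`. -/
theorem hasDerivAt_covariant (h : IsCoordMetric U g Γ) {y T J J₁ : ℝ → V} {t : ℝ} (hyt : y t ∈ U)
    (hy : HasDerivAt y (T t) t) (hT : HasDerivAt T (-Γ (y t) (T t) (T t)) t)
    (hJ : HasDerivAt J (J₁ t) t)
    (hJ₁ : HasDerivAt J₁ (-(fderiv ℝ Γ (y t) (J t) (T t) (T t))
      - (2 : ℝ) • Γ (y t) (T t) (J₁ t)) t) :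
    HasDerivAt (fun s => J₁ s + Γ (y s) (T s) (J s))
      (-coordCurvature Γ (y t) (J t) (T t) (T t)
        - Γ (y t) (T t) (J₁ t + Γ (y t) (T t) (J t))) t := by
  have h1 := (((h.hasFDerivAt_christoffel hyt).comp_hasDerivAt t hy).clm_apply hT).clm_apply hJ
  refine (hJ₁.add h1).congr_deriv ?_
  simp only [Function.comp_apply, map_add, map_neg, add_apply,
    neg_apply, coordCurvature, two_smul]
  rw [h.christoffel_symm hyt (J t) (T t), h.christoffel_symm hyt (J t) (Γ (y t) (T t) (T t)),
    h.fderiv_christoffel_symm hyt (T t) (T t) (J t)]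
  abel

/-- Behaviour of the Koszul expression under a change of coordinates `τ`. -/
theorem transform {U' : Set V} {g' : V → V →L[ℝ] V →L[ℝ] ℝ} {Γ' : V → V →L[ℝ] V →L[ℝ] V}
    (h : IsCoordMetric U g Γ) (h' : IsCoordMetric U' g' Γ') {τ : V → V} {z : V} (hz : z ∈ U')
    (hτz : τ z ∈ U) (hτ : ContDiffAt ℝ ∞ τ z)
    (hg : ∀ᶠ x in 𝓝 z, ∀ u v, g' x u v = g (τ x) (fderiv ℝ τ x u) (fderiv ℝ τ x v))
    (u w : V) :
    g' z (Γ' z u u) w = g (τ z) (Γ (τ z) (fderiv ℝ τ z u) (fderiv ℝ τ z u)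
      + fderiv ℝ (fderiv ℝ τ) z u u) (fderiv ℝ τ z w) := by
  have hd : HasFDerivAt τ (fderiv ℝ τ z) z := (hτ.differentiableAt (by simp)).hasFDerivAt
  have hd2 : HasFDerivAt (fderiv ℝ τ) (fderiv ℝ (fderiv ℝ τ) z) z :=
    ((hτ.fderiv_right (m := ∞) (by simp)).differentiableAt (by simp)).hasFDerivAt
  have hsym : IsSymmSndFDerivAt ℝ τ z := hτ.isSymmSndFDerivAt
      (by rw [minSmoothness_of_isRCLikeNormedField]; exact ENat.LEInfty.out)
  have c (a : V) := hasFDerivAt_const (𝕜 := ℝ) a z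
  -- differentiate the isometry relation `g' = τ^* g` at `z`
  have key (a b e : V) : fderiv ℝ g' z a b e =
      fderiv ℝ g (τ z) (fderiv ℝ τ z a) (fderiv ℝ τ z b) (fderiv ℝ τ z e)
      + g (τ z) (fderiv ℝ (fderiv ℝ τ) z a b) (fderiv ℝ τ z e)
      + g (τ z) (fderiv ℝ τ z b) (fderiv ℝ (fderiv ℝ τ) z a e) := by
    have h1 := ((h'.hasFDerivAt hz).clm_apply (c b)).clm_apply (c e)
    have h2 := (((h.hasFDerivAt hτz).comp z hd).clm_apply (hd2.clm_apply (c b))).clm_apply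
      (hd2.clm_apply (c e))
    have h3 : (fun x => g' x b e) =ᶠ[𝓝 z]
        fun x => (g ∘ τ) x (fderiv ℝ τ x b) (fderiv ℝ τ x e) := by
      filter_upwards [hg] with x hx using hx b e
    have h4 := congrArg (fun L => L a) ((h1.congr_of_eventuallyEq h3.symm).unique h2)
    simp only [add_apply, ContinuousLinearMap.comp_apply,
      ContinuousLinearMap.flip_apply, zero_apply, map_zero,
      zero_add, Function.comp_apply] at h4
    linarith
  rw [h'.koszul z hz, key, key, map_add, add_apply, h.koszul _ hτz,
    hsym.eq w u, h.symm _ hτz (fderiv ℝ (fderiv ℝ τ) z u w)]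
  ring

/-- The transformation law of the Christoffel symbols under an isometric change of coordinates. -/
theorem christoffel_change [FiniteDimensional ℝ V] {U' : Set V} {g' : V → V →L[ℝ] V →L[ℝ] ℝ}
    {Γ' : V → V →L[ℝ] V →L[ℝ] V} (h : IsCoordMetric U g Γ) (h' : IsCoordMetric U' g' Γ')
    {τ : V → V} {z : V} (hz : z ∈ U') (hτz : τ z ∈ U) (hτ : ContDiffAt ℝ ∞ τ z)
    (hg : ∀ᶠ x in 𝓝 z, ∀ u v, g' x u v = g (τ x) (fderiv ℝ τ x u) (fderiv ℝ τ x v)) (u : V) :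
    fderiv ℝ τ z (Γ' z u u) = Γ (τ z) (fderiv ℝ τ z u) (fderiv ℝ τ z u) +
      fderiv ℝ (fderiv ℝ τ) z u u := by
  have hinj : Function.Injective (fderiv ℝ τ z) := by
    refine (injective_iff_map_eq_zero _).2 fun v hv => ?_
    by_contra hne
    have := h'.pos z hz v hne
    rw [hg.self_of_nhds, hv] at this
    simp at this
  have hsurj : Function.Surjective (fderiv ℝ τ z) :=
    (LinearMap.injective_iff_surjective (f := (fderiv ℝ τ z : V →ₗ[ℝ] V))).1 hinj
  refine h.eq_of_inner hτz fun w => ?_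
  obtain ⟨w, rfl⟩ := hsurj w
  rw [← h.transform h' hz hτz hτ hg, hg.self_of_nhds]

/-- Isometric changes of coordinates map geodesics to geodesics. -/
theorem hasDerivAt_change [FiniteDimensional ℝ V] {U' : Set V} {g' : V → V →L[ℝ] V →L[ℝ] ℝ}
    {Γ' : V → V →L[ℝ] V →L[ℝ] V} (h : IsCoordMetric U g Γ) (h' : IsCoordMetric U' g' Γ')
    {τ : V → V} {y T : ℝ → V} {t : ℝ} (hz : y t ∈ U') (hτz : τ (y t) ∈ U)
    (hτ : ContDiffAt ℝ ∞ τ (y t))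
    (hg : ∀ᶠ x in 𝓝 (y t), ∀ u v, g' x u v = g (τ x) (fderiv ℝ τ x u) (fderiv ℝ τ x v))
    (hy : HasDerivAt y (T t) t) (hT : HasDerivAt T (-Γ' (y t) (T t) (T t)) t) :
    HasDerivAt (fun s => fderiv ℝ τ (y s) (T s))
      (-Γ (τ (y t)) (fderiv ℝ τ (y t) (T t)) (fderiv ℝ τ (y t) (T t))) t := by
  have h3 : HasFDerivAt (fderiv ℝ τ) (fderiv ℝ (fderiv ℝ τ) (y t)) (y t) :=
    ((hτ.fderiv_right (m := ∞) (by simp)).differentiableAt (by simp)).hasFDerivAt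
  refine ((h3.comp_hasDerivAt t hy).clm_apply hT).congr_deriv ?_
  rw [map_neg, Function.comp_apply, h.christoffel_change h' hz hτz hτ hg]
  abel

end IsCoordMetric

end CoordinateGeometry

/-! ### Bilinear maps with given components -/

section Components

variable {d : ℕ}

/-- The `j`-th coordinate, as a continuous linear form. -/
abbrev coord (j : Fin d) : EuclideanSpace ℝ (Fin d) →L[ℝ] ℝ := EuclideanSpace.proj j

/-- The bilinear form on `ℝᵈ` with a given matrix. -/
def bilinForm (A : Matrix (Fin d) (Fin d) ℝ) :
    EuclideanSpace ℝ (Fin d) →L[ℝ] EuclideanSpace ℝ (Fin d) →L[ℝ] ℝ :=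
  ∑ i, ∑ j, A i j • (coord i).smulRight (coord j)

theorem bilinForm_apply (A : Matrix (Fin d) (Fin d) ℝ) (u v : EuclideanSpace ℝ (Fin d)) :
    bilinForm A u v = ∑ i, ∑ j, A i j * u i * v j := by
  simp [bilinForm, sum_apply, smul_apply, mul_assoc]

theorem bilinForm_single (A : Matrix (Fin d) (Fin d) ℝ) (i j : Fin d) :
    bilinForm A (EuclideanSpace.single i 1) (EuclideanSpace.single j 1) = A i j := by
  rw [bilinForm_apply, Finset.sum_eq_single i, Finset.sum_eq_single j]
  all_goals simp +contextual

/-- The bilinear map on `ℝᵈ` with given components. -/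
def bilinMap (A : Fin d → Fin d → Fin d → ℝ) :
    EuclideanSpace ℝ (Fin d) →L[ℝ] EuclideanSpace ℝ (Fin d) →L[ℝ] EuclideanSpace ℝ (Fin d) :=
  ∑ k, ∑ i, ∑ j, A k i j • (coord i).smulRight
    ((coord j).smulRight (EuclideanSpace.single k (1 : ℝ)))

theorem bilinMap_apply (A : Fin d → Fin d → Fin d → ℝ) (u v : EuclideanSpace ℝ (Fin d))
    (k : Fin d) : bilinMap A u v k = ∑ i, ∑ j, A k i j * u i * v j := by
  simp only [bilinMap, sum_apply, smul_apply, ContinuousLinearMap.smulRight_apply,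
    PiLp.proj_apply, WithLp.ofLp_sum, Finset.sum_apply,
    WithLp.ofLp_smul, Pi.smul_apply, smul_eq_mul]
  rw [Finset.sum_eq_single k]
  · simp [mul_assoc]
  · intro b _ hb
    simp [hb.symm]
  · simp

theorem bilinMap_single (A : Fin d → Fin d → Fin d → ℝ) (k i j : Fin d) :
    bilinMap A (EuclideanSpace.single i 1) (EuclideanSpace.single j 1) k = A k i j := by
  rw [bilinMap_apply, Finset.sum_eq_single i, Finset.sum_eq_single j]
  all_goals simp +contextual

theorem eq_zero_of_isLinearMap {P : EuclideanSpace ℝ (Fin d) → ℝ} (h : IsLinearMap ℝ P)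
    (h0 : ∀ i, P (EuclideanSpace.single i 1) = 0) (u : EuclideanSpace ℝ (Fin d)) : P u = 0 := by
  have := (EuclideanSpace.basisFun (Fin d) ℝ).toBasis.ext (f₁ := h.mk' P) (f₂ := 0)
    (fun i => by simpa using h0 i)
  exact congrArg (fun L => L u) this

/-- A trilinear function vanishing on basis vectors vanishes. -/
theorem eq_zero_of_trilinear
    {P : EuclideanSpace ℝ (Fin d) → EuclideanSpace ℝ (Fin d) → EuclideanSpace ℝ (Fin d) → ℝ}
    (h1 : ∀ v w, IsLinearMap ℝ fun u => P u v w) (h2 : ∀ u w, IsLinearMap ℝ fun v => P u v w)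
    (h3 : ∀ u v, IsLinearMap ℝ fun w => P u v w)
    (h0 : ∀ i j k, P (EuclideanSpace.single i 1) (EuclideanSpace.single j 1)
      (EuclideanSpace.single k 1) = 0) (u v w : EuclideanSpace ℝ (Fin d)) : P u v w = 0 :=
  eq_zero_of_isLinearMap (h1 v w) (fun i => eq_zero_of_isLinearMap (h2 _ w) (fun j =>
    eq_zero_of_isLinearMap (h3 _ _) (fun k => h0 i j k) w) v) u

end Components

/-! ### The metric, the connection and the curvature in charts -/

section Charts

variable {d : ℕ} {M : Type*} [TopologicalSpace M] [ChartedSpace (EuclideanSpace ℝ (Fin d)) M]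
  {c : OpenPartialHomeomorph M (EuclideanSpace ℝ (Fin d))}

theorem mdifferentiable_of_mem_maximalAtlas (hc : c ∈ IsManifold.maximalAtlas (𝓡 d) ∞ M) :
    c.MDifferentiable (𝓡 d) (𝓡 d) :=
  ⟨(contMDiffOn_of_mem_maximalAtlas hc).mdifferentiableOn (by simp),
    (contMDiffOn_symm_of_mem_maximalAtlas hc).mdifferentiableOn (by simp)⟩

variable [IsManifold (𝓡 d) ∞ M] [Bundle.RiemannianBundle (fun x : M => TangentSpace (𝓡 d) x)]

/-- The Riemannian inner product at `x`, as a function on the model space `ℝᵈ`; this form makes it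
possible to rewrite the base point. -/
def tangentInner (x : M) (u v : EuclideanSpace ℝ (Fin d)) : ℝ :=
  inner ℝ (show TangentSpace (𝓡 d) x from u) (show TangentSpace (𝓡 d) x from v)

/-- The Riemannian metric in the chart `c`, as a bilinear form. -/
def chartMetric (c : OpenPartialHomeomorph M (EuclideanSpace ℝ (Fin d)))
    (y : EuclideanSpace ℝ (Fin d)) :
    EuclideanSpace ℝ (Fin d) →L[ℝ] EuclideanSpace ℝ (Fin d) →L[ℝ] ℝ :=
  bilinForm (metric c y)

/-- The Christoffel symbol in the chart `c`, as a bilinear map. -/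
def chartChristoffel (c : OpenPartialHomeomorph M (EuclideanSpace ℝ (Fin d)))
    (y : EuclideanSpace ℝ (Fin d)) :
    EuclideanSpace ℝ (Fin d) →L[ℝ] EuclideanSpace ℝ (Fin d) →L[ℝ] EuclideanSpace ℝ (Fin d) :=
  bilinMap fun k i j => christoffel c k i j y

theorem chartMetric_eq_tangentInner (c : OpenPartialHomeomorph M (EuclideanSpace ℝ (Fin d)))
    (y u v : EuclideanSpace ℝ (Fin d)) :
    chartMetric c y u v = tangentInner (c.symm y) (mfderiv (𝓡 d) (𝓡 d) c.symm y u)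
      (mfderiv (𝓡 d) (𝓡 d) c.symm y v) := by
  have hexp (u : EuclideanSpace ℝ (Fin d)) : mfderiv (𝓡 d) (𝓡 d) c.symm y u =
      ∑ i, u i • coordVector c y i := by
    have h1 := (EuclideanSpace.basisFun (Fin d) ℝ).sum_repr u
    simp only [EuclideanSpace.basisFun_repr, EuclideanSpace.basisFun_apply] at h1
    conv_lhs => rw [← h1]
    exact (map_sum (mfderiv (𝓡 d) (𝓡 d) c.symm y) _ _).trans
      (Finset.sum_congr rfl fun i _ => map_smul (mfderiv (𝓡 d) (𝓡 d) c.symm y) _ _)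
  rw [chartMetric, bilinForm_apply, hexp, hexp]
  change _ = inner ℝ (∑ i, u i • coordVector c y i) (∑ i, v i • coordVector c y i)
  simp only [sum_inner, inner_sum, real_inner_smul_left, real_inner_smul_right, metric,
    Matrix.of_apply]
  rw [Finset.sum_comm]
  exact Finset.sum_congr rfl fun i _ => Finset.sum_congr rfl fun j _ => by ring

/-- The metric read in a chart computes the inner products of the derivatives of a map into `M`. -/
theorem tangentInner_mfderiv (hc : c ∈ IsManifold.maximalAtlas (𝓡 d) ∞ M) {X : Type*}
    [NormedAddCommGroup X] [NormedSpace ℝ X] {f : X → M} {h : X → EuclideanSpace ℝ (Fin d)} {p : X}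
    (hp : h p ∈ c.target) (hh : DifferentiableAt ℝ h p) (hf : f =ᶠ[𝓝 p] c.symm ∘ h) (u v : X) :
    tangentInner (f p) (mfderiv 𝓘(ℝ, X) (𝓡 d) f p u) (mfderiv 𝓘(ℝ, X) (𝓡 d) f p v) =
      chartMetric c (h p) (fderiv ℝ h p u) (fderiv ℝ h p v) := by
  rw [hf.mfderiv_eq, chartMetric_eq_tangentInner, hf.eq_of_nhds, Function.comp_apply,
    mfderiv_comp p ((mdifferentiable_of_mem_maximalAtlas hc).mdifferentiableAt_symm hp)
      hh.mdifferentiableAt, mfderiv_eq_fderiv]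
  rfl

theorem contDiffOn_metric [IsContMDiffRiemannianBundle (𝓡 d) ∞ (EuclideanSpace ℝ (Fin d))
    (fun x : M => TangentSpace (𝓡 d) x)] (hc : c ∈ IsManifold.maximalAtlas (𝓡 d) ∞ M)
    (i j : Fin d) : ContDiffOn ℝ ∞ (fun y => metric c y i j) c.target := by
  have hs : ContMDiffOn (𝓡 d) (𝓡 d) ∞ c.symm c.target := contMDiffOn_symm_of_mem_maximalAtlas hc
  have hv (i : Fin d) : ContMDiffOn (𝓡 d) (𝓡 d).tangent ∞
      (fun y => (⟨c.symm y, coordVector c y i⟩ : TangentBundle (𝓡 d) M)) c.target := by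
    have h1 := hs.contMDiffOn_tangentMapWithin (m := ∞) (by simp)
      c.open_target.uniqueMDiffOn
    have h2 : ContMDiff (𝓡 d) (𝓡 d).tangent ∞ (fun y : EuclideanSpace ℝ (Fin d) =>
        (⟨y, EuclideanSpace.single i (1 : ℝ)⟩ :
          TangentBundle (𝓡 d) (EuclideanSpace ℝ (Fin d)))) :=
      contMDiff_vectorSpace_iff_contDiff.2 contDiff_const
    refine (h1.comp h2.contMDiffOn (s := c.target) fun y hy => hy).congr fun y hy => ?_
    simp only [Function.comp_apply, tangentMapWithin, coordVector]
    rw [mfderivWithin_of_isOpen c.open_target hy]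
  exact (ContMDiffOn.inner_bundle (hv i) (hv j)).contDiffOn

theorem metric_symm (c : OpenPartialHomeomorph M (EuclideanSpace ℝ (Fin d)))
    (y : EuclideanSpace ℝ (Fin d)) (i j : Fin d) : metric c y i j = metric c y j i :=
  real_inner_comm (coordVector c y j) (coordVector c y i)

theorem chartMetric_symm (c : OpenPartialHomeomorph M (EuclideanSpace ℝ (Fin d)))
    (y u v : EuclideanSpace ℝ (Fin d)) : chartMetric c y u v = chartMetric c y v u := by
  rw [chartMetric_eq_tangentInner, chartMetric_eq_tangentInner]
  exact real_inner_comm _ _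

theorem chartMetric_pos (hc : c ∈ IsManifold.maximalAtlas (𝓡 d) ∞ M)
    {y : EuclideanSpace ℝ (Fin d)} (hy : y ∈ c.target) {v : EuclideanSpace ℝ (Fin d)}
    (hv : v ≠ 0) : 0 < chartMetric c y v v := by
  rw [chartMetric_eq_tangentInner]
  have hne : mfderiv (𝓡 d) (𝓡 d) c.symm y v ≠ 0 := fun h0 => hv
    ((mdifferentiable_of_mem_maximalAtlas hc).symm.mfderiv_injective hy (h0.trans (map_zero _).symm))
  exact real_inner_self_pos.2 hne

theorem isUnit_det_metric (hc : c ∈ IsManifold.maximalAtlas (𝓡 d) ∞ M)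
    {y : EuclideanSpace ℝ (Fin d)} (hy : y ∈ c.target) : IsUnit (metric c y).det := by
  rw [isUnit_iff_ne_zero]
  intro h0
  obtain ⟨v, hv, hv0⟩ := Matrix.exists_mulVec_eq_zero_iff.2 h0
  have h1 := chartMetric_pos hc hy (v := WithLp.toLp 2 v) (by simpa using hv)
  refine h1.ne' ?_
  rw [chartMetric, bilinForm_apply]
  have h2 (i : Fin d) : ∑ j, metric c y i j * v j = 0 := congrFun hv0 i
  calc ∑ i, ∑ j, metric c y i j * v i * v j = ∑ i, v i * ∑ j, metric c y i j * v j := by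
        refine Finset.sum_congr rfl fun i _ => ?_
        rw [Finset.mul_sum]
        exact Finset.sum_congr rfl fun j _ => by ring
    _ = 0 := by simp [h2]

variable [IsContMDiffRiemannianBundle (𝓡 d) ∞ (EuclideanSpace ℝ (Fin d))
    (fun x : M => TangentSpace (𝓡 d) x)]

theorem contDiffOn_metric_inv (hc : c ∈ IsManifold.maximalAtlas (𝓡 d) ∞ M) (i j : Fin d) :
    ContDiffOn ℝ ∞ (fun y => (metric c y)⁻¹ i j) c.target := by
  have hdet : ContDiffOn ℝ ∞ (fun y => (metric c y).det) c.target := by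
    simp only [Matrix.det_apply]
    exact ContDiffOn.sum fun σ _ => (contDiffOn_prod fun i _ => contDiffOn_metric hc _ _).const_smul _
  have hadj : ContDiffOn ℝ ∞ (fun y => (metric c y).adjugate i j) c.target := by
    simp only [Matrix.adjugate_apply, Matrix.det_apply]
    refine ContDiffOn.sum fun σ _ => (contDiffOn_prod fun k _ => ?_).const_smul _
    by_cases hk : σ k = j
    · simp only [hk, Matrix.updateRow_self]; exact contDiffOn_const
    · simp only [Matrix.updateRow_ne hk]; exact contDiffOn_metric hc _ _
  simp only [Matrix.inv_def, Matrix.smul_apply, Ring.inverse_eq_inv', smul_eq_mul]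
  exact (hdet.inv fun y hy => (isUnit_det_metric hc hy).ne_zero).mul hadj

theorem contDiffOn_pd {U : Set (EuclideanSpace ℝ (Fin d))} (hU : IsOpen U)
    {F : Type*} [NormedAddCommGroup F] [NormedSpace ℝ F] {f : EuclideanSpace ℝ (Fin d) → F}
    (hf : ContDiffOn ℝ ∞ f U) (i : Fin d) : ContDiffOn ℝ ∞ (pd i f) U :=
  (hf.fderiv_of_isOpen hU (by simp)).clm_apply contDiffOn_const

theorem contDiffOn_christoffel (hc : c ∈ IsManifold.maximalAtlas (𝓡 d) ∞ M) (k i j : Fin d) :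
    ContDiffOn ℝ ∞ (christoffel c k i j) c.target := by
  have h (i j l : Fin d) := contDiffOn_pd c.open_target (contDiffOn_metric hc i j) l
  refine contDiffOn_const.mul (ContDiffOn.sum fun l _ => ?_)
  exact (contDiffOn_metric_inv hc k l).mul (((h _ _ _).add (h _ _ _)).sub (h _ _ _))

theorem contDiffOn_chartMetric (hc : c ∈ IsManifold.maximalAtlas (𝓡 d) ∞ M) :
    ContDiffOn ℝ ∞ (chartMetric c) c.target := by
  unfold chartMetric bilinForm
  exact ContDiffOn.sum fun i _ => ContDiffOn.sum fun j _ =>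
    (contDiffOn_metric hc i j).smul contDiffOn_const

theorem contDiffOn_chartChristoffel (hc : c ∈ IsManifold.maximalAtlas (𝓡 d) ∞ M) :
    ContDiffOn ℝ ∞ (chartChristoffel c) c.target := by
  unfold chartChristoffel bilinMap
  exact ContDiffOn.sum fun k _ => ContDiffOn.sum fun i _ => ContDiffOn.sum fun j _ =>
    (contDiffOn_christoffel hc k i j).smul contDiffOn_const

theorem fderiv_chartMetric_single (hc : c ∈ IsManifold.maximalAtlas (𝓡 d) ∞ M)
    {y : EuclideanSpace ℝ (Fin d)} (hy : y ∈ c.target) (l i j : Fin d) :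
    fderiv ℝ (chartMetric c) y (EuclideanSpace.single l 1) (EuclideanSpace.single i 1)
      (EuclideanSpace.single j 1) = pd l (fun z => metric c z i j) y := by
  have h1 : HasFDerivAt (chartMetric c) (fderiv ℝ (chartMetric c) y) y :=
    (((contDiffOn_chartMetric hc).contDiffAt (c.open_target.mem_nhds hy)).differentiableAt
      (by simp)).hasFDerivAt
  have h2 := (h1.clm_apply (hasFDerivAt_const (EuclideanSpace.single i (1 : ℝ)) y)).clm_apply
    (hasFDerivAt_const (EuclideanSpace.single j (1 : ℝ)) y)
  simp only [chartMetric, bilinForm_single] at h2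
  rw [pd, h2.fderiv]
  simp

theorem fderiv_chartChristoffel_single (hc : c ∈ IsManifold.maximalAtlas (𝓡 d) ∞ M)
    {y : EuclideanSpace ℝ (Fin d)} (hy : y ∈ c.target) (l k i j : Fin d) :
    fderiv ℝ (chartChristoffel c) y (EuclideanSpace.single l 1) (EuclideanSpace.single i 1)
      (EuclideanSpace.single j 1) k = pd l (christoffel c k i j) y := by
  have h1 : HasFDerivAt (chartChristoffel c) (fderiv ℝ (chartChristoffel c) y) y :=
    (((contDiffOn_chartChristoffel hc).contDiffAt (c.open_target.mem_nhds hy)).differentiableAt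
      (by simp)).hasFDerivAt
  have h2 := (h1.clm_apply (hasFDerivAt_const (EuclideanSpace.single i (1 : ℝ)) y)).clm_apply
    (hasFDerivAt_const (EuclideanSpace.single j (1 : ℝ)) y)
  have h3 := (coord k).hasFDerivAt.comp y h2
  have h4 : (coord k) ∘ (fun z => chartChristoffel c z (EuclideanSpace.single i 1)
      (EuclideanSpace.single j 1)) = christoffel c k i j := by
    funext z
    exact bilinMap_single _ k i j
  rw [h4] at h3
  rw [pd, h3.fderiv]
  simp

/-- In every smooth chart, the metric and the Christoffel symbols form a coordinate metric. -/
theorem isCoordMetric (hc : c ∈ IsManifold.maximalAtlas (𝓡 d) ∞ M) :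
    IsCoordMetric c.target (chartMetric c) (chartChristoffel c) where
  isOpen := c.open_target
  smooth := contDiffOn_chartMetric hc
  smooth_christoffel := contDiffOn_chartChristoffel hc
  symm y _ u v := chartMetric_symm c y u v
  pos y hy v hv := chartMetric_pos hc hy hv
  koszul y hy u v w := by
    rw [← sub_eq_zero]
    refine eq_zero_of_trilinear (P := fun u v w => chartMetric c y (chartChristoffel c y u v) w -
      (1 / 2) * (fderiv ℝ (chartMetric c) y u v w + fderiv ℝ (chartMetric c) y v u w -
        fderiv ℝ (chartMetric c) y w u v)) ?_ ?_ ?_ ?_ u v w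
    iterate 3
      intro a b
      constructor
      · intro x x'
        simp only [map_add, add_apply]
        ring
      · intro r x
        simp only [map_smul, smul_apply, smul_eq_mul]
        ring
    intro i j l
    simp only [fderiv_chartMetric_single hc hy]
    rw [sub_eq_zero, chartMetric, bilinForm_apply]
    simp only [chartChristoffel, bilinMap_single, christoffel]
    have h1 (k : Fin d) : ∑ m, metric c y k m * ((1 : ℝ) / 2 * ∑ n, (metric c y)⁻¹ k n *
        (pd i (fun z => metric c z j n) y + pd j (fun z => metric c z i n) y -
          pd n (fun z => metric c z i j) y)) * (EuclideanSpace.single l (1 : ℝ)).ofLp m =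
        (1 / 2) * ∑ n, (metric c y l k * (metric c y)⁻¹ k n) *
        (pd i (fun z => metric c z j n) y + pd j (fun z => metric c z i n) y -
          pd n (fun z => metric c z i j) y) := by
      rw [Finset.sum_eq_single l]
      · rw [metric_symm c y k l]
        simp only [PiLp.single_apply, if_true, mul_one, Finset.mul_sum]
        exact Finset.sum_congr rfl fun n _ => by ring
      · intro m _ hm
        simp [hm]
      · simp
    rw [Finset.sum_congr rfl fun k _ => h1 k, ← Finset.mul_sum, Finset.sum_comm]
    have h2 (n : Fin d) : ∑ k, metric c y l k * (metric c y)⁻¹ k n = if l = n then 1 else 0 := by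
      have := congrFun (congrFun (Matrix.mul_nonsing_inv _ (isUnit_det_metric hc hy)) l) n
      rwa [Matrix.mul_apply, Matrix.one_apply] at this
    simp only [← Finset.sum_mul, h2, ite_mul, one_mul, zero_mul, Finset.sum_ite_eq,
      Finset.mem_univ, if_true]

/-- The invariantly defined curvature of the Christoffel symbols has the components `riemann`: both
sides are trilinear and agree on the basis vectors. -/
theorem coordCurvature_apply (hc : c ∈ IsManifold.maximalAtlas (𝓡 d) ∞ M)
    {y : EuclideanSpace ℝ (Fin d)} (hy : y ∈ c.target) (u v w : EuclideanSpace ℝ (Fin d))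
    (l : Fin d) : coordCurvature (chartChristoffel c) y u v w l =
      ∑ k, ∑ i, ∑ j, riemann c l k i j y * u i * v j * w k := by
  rw [← sub_eq_zero]
  refine eq_zero_of_trilinear (P := fun u v w => coordCurvature (chartChristoffel c) y u v w l -
    ∑ k, ∑ i, ∑ j, riemann c l k i j y * u i * v j * w k) ?_ ?_ ?_ ?_ u v w
  iterate 3
    intro a b
    constructor
    · intro x x'
      simp only [coordCurvature, map_add, add_apply, PiLp.add_apply, PiLp.sub_apply, mul_add,
        add_mul, Finset.sum_add_distrib]
      ring
    · intro r x
      simp only [coordCurvature, map_smul, smul_apply, PiLp.smul_apply, PiLp.add_apply,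
        PiLp.sub_apply, smul_eq_mul, mul_sub, mul_add, Finset.mul_sum]
      congr 1
      exact Finset.sum_congr rfl fun _ _ => Finset.sum_congr rfl fun _ _ =>
        Finset.sum_congr rfl fun _ _ => by ring
  intro i j k
  have h1 : ∑ k', ∑ i', ∑ j', riemann c l k' i' j' y * (EuclideanSpace.single i (1 : ℝ)).ofLp i' *
      (EuclideanSpace.single j (1 : ℝ)).ofLp j' * (EuclideanSpace.single k (1 : ℝ)).ofLp k' =
      riemann c l k i j y := by
    rw [Finset.sum_eq_single k, Finset.sum_eq_single i, Finset.sum_eq_single j]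
    all_goals simp +contextual
  have h2 (i : Fin d) (X : EuclideanSpace ℝ (Fin d)) :
      chartChristoffel c y (EuclideanSpace.single i 1) X l = ∑ m, christoffel c l i m y * X m := by
    rw [chartChristoffel, bilinMap_apply, Finset.sum_eq_single i]
    all_goals simp +contextual
  have h3 (i j m : Fin d) : chartChristoffel c y (EuclideanSpace.single i 1)
      (EuclideanSpace.single j 1) m = christoffel c m i j y := bilinMap_single _ m i j
  rw [h1, sub_eq_zero]
  simp only [coordCurvature, PiLp.add_apply, PiLp.sub_apply, fderiv_chartChristoffel_single hc hy,
    h2, h3, riemann, Finset.sum_sub_distrib]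
  ring

/-- Constant sectional curvature `-1`, as an identity without denominators, which also holds for
linearly dependent vectors. -/
theorem inner_coordCurvature (hM : HasConstantSectionalCurvature (d := d) M (-1))
    (hc : c ∈ IsManifold.maximalAtlas (𝓡 d) ∞ M)
    {y : EuclideanSpace ℝ (Fin d)} (hy : y ∈ c.target) (v w : EuclideanSpace ℝ (Fin d)) :
    chartMetric c y (coordCurvature (chartChristoffel c) y v w w) v =
      -(chartMetric c y v v * chartMetric c y w w - chartMetric c y v w ^ 2) := by
  have hin (a b : EuclideanSpace ℝ (Fin d)) : coordInner c y a b = chartMetric c y a b := by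
    rw [coordInner, chartMetric, bilinForm_apply]
  by_cases hli : LinearIndependent ℝ ![v, w]
  · have hli' : LinearIndependent ℝ ![v.ofLp, w.ofLp] := by
      rw [LinearIndependent.pair_iff] at hli ⊢
      intro r t hrt
      exact hli r t (by ext i; exact congrFun hrt i)
    have h1 := hM c hc y hy v.ofLp w.ofLp hli'
    have h2 : (fun l => ∑ k, ∑ i, ∑ j, riemann c l k i j y * v.ofLp i * w.ofLp j * w.ofLp k) =
        (coordCurvature (chartChristoffel c) y v w w).ofLp := by
      funext l
      rw [coordCurvature_apply hc hy]
    rw [sectionalCurvature, h2] at h1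
    simp only [hin] at h1
    have hD : chartMetric c y v v * chartMetric c y w w - chartMetric c y v w ^ 2 ≠ 0 := by
      -- division by zero would give the value `0` instead of `-1`
      intro h0
      rw [h0, div_zero] at h1
      norm_num at h1
    rw [div_eq_iff hD] at h1
    linarith
  · have key : ∃ a b : ℝ, ∃ z : EuclideanSpace ℝ (Fin d), v = a • z ∧ w = b • z := by
      rw [LinearIndependent.pair_iff] at hli
      push Not at hli
      obtain ⟨s, t, hst, hne⟩ := hli
      by_cases hs : s = 0
      · have ht := hne hs
        refine ⟨1, 0, v, by simp, ?_⟩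
        rw [hs, zero_smul, zero_add, smul_eq_zero] at hst
        simpa using hst.resolve_left ht
      · refine ⟨-(s⁻¹ * t), 1, w, ?_, by simp⟩
        have : s⁻¹ • (s • v + t • w) = 0 := by rw [hst, smul_zero]
        rw [smul_add, smul_smul, inv_mul_cancel₀ hs, one_smul, smul_smul] at this
        rw [neg_smul]
        exact eq_neg_of_add_eq_zero_left this
    obtain ⟨a, b, z, rfl, rfl⟩ := key
    have h0 : coordCurvature (chartChristoffel c) y z z z = 0 := by
      simp [coordCurvature]
    have h1 : coordCurvature (chartChristoffel c) y (a • z) (b • z) (b • z) =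
        (a * b * b) • coordCurvature (chartChristoffel c) y z z z := by
      simp only [coordCurvature, map_smul, smul_apply, smul_sub, smul_add, smul_smul]
      ring_nf
    rw [h1, h0]
    simp only [smul_zero, map_zero, map_smul, smul_apply, zero_apply, smul_eq_mul]
    ring

end Charts

/-! ### The geodesic equation and local uniqueness -/

section Geodesics

variable {d : ℕ} {M : Type*} [TopologicalSpace M] [ChartedSpace (EuclideanSpace ℝ (Fin d)) M]
  [IsManifold (𝓡 d) ∞ M] [Bundle.RiemannianBundle (fun x : M => TangentSpace (𝓡 d) x)]
  {c c' : OpenPartialHomeomorph M (EuclideanSpace ℝ (Fin d))} {γ γ' : ℝ → M} {t : ℝ}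

/-- The curve `γ` solves the geodesic equation in the chart `c` on a neighbourhood of `t`. -/
structure IsChartGeodesicAt (c : OpenPartialHomeomorph M (EuclideanSpace ℝ (Fin d))) (γ : ℝ → M)
    (t : ℝ) : Prop where
  mem : γ t ∈ c.source
  cont : ContinuousAt γ t
  eqn : ∀ᶠ s in 𝓝 t, HasDerivAt (c ∘ γ) (deriv (c ∘ γ) s) s ∧ HasDerivAt (deriv (c ∘ γ))
    (-chartChristoffel c (c (γ s)) (deriv (c ∘ γ) s) (deriv (c ∘ γ) s)) s

/-- The curve `γ` is a geodesic on a neighbourhood of `t`. -/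
def IsGeodesicAt (γ : ℝ → M) (t : ℝ) : Prop :=
  ∃ c ∈ IsManifold.maximalAtlas (𝓡 d) ∞ M, IsChartGeodesicAt c γ t

namespace IsChartGeodesicAt

theorem eventually_mem (h : IsChartGeodesicAt c γ t) : ∀ᶠ s in 𝓝 t, γ s ∈ c.source :=
  h.cont.eventually_mem (c.open_source.mem_nhds h.mem)

theorem eventuallyEq_symm (h : IsChartGeodesicAt c γ t) : γ =ᶠ[𝓝 t] c.symm ∘ (c ∘ γ) := by
  filter_upwards [h.eventually_mem] with s hs using (c.left_inv hs).symm

theorem eventually_isChartGeodesicAt (h : IsChartGeodesicAt c γ t) :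
    ∀ᶠ s in 𝓝 t, IsChartGeodesicAt c γ s := by
  filter_upwards [h.eqn.eventually_nhds, h.eventually_mem,
    h.eventuallyEq_symm.eventuallyEq_nhds] with s hs hm he
  refine ⟨hm, ?_, hs⟩
  have h1 : ContinuousAt (c ∘ γ) s := hs.self_of_nhds.1.continuousAt
  exact ((c.continuousAt_symm (c.map_source hm)).comp_of_eq h1 rfl).congr he.symm

theorem congr (h : IsChartGeodesicAt c γ t) (he : γ =ᶠ[𝓝 t] γ') : IsChartGeodesicAt c γ' t := by
  refine ⟨he.eq_of_nhds ▸ h.mem, h.cont.congr he, ?_⟩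
  have he1 : c ∘ γ =ᶠ[𝓝 t] c ∘ γ' := he.fun_comp c
  filter_upwards [h.eqn, he.eventuallyEq_nhds] with s hs hs'
  have he2 : c ∘ γ =ᶠ[𝓝 s] c ∘ γ' := hs'.fun_comp c
  rw [← he2.deriv_eq, ← hs'.eq_of_nhds]
  exact ⟨hs.1.congr_of_eventuallyEq he2.symm, hs.2.congr_of_eventuallyEq he2.symm.deriv⟩

theorem hasDerivAt (h : IsChartGeodesicAt c γ t) : HasDerivAt (c ∘ γ) (deriv (c ∘ γ) t) t :=
  h.eqn.self_of_nhds.1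

theorem hasDerivAt_deriv (h : IsChartGeodesicAt c γ t) : HasDerivAt (deriv (c ∘ γ))
    (-chartChristoffel c (c (γ t)) (deriv (c ∘ γ) t) (deriv (c ∘ γ) t)) t :=
  h.eqn.self_of_nhds.2

end IsChartGeodesicAt

/-- A change of charts relates the metrics in both charts. -/
theorem chartMetric_change (hc : c ∈ IsManifold.maximalAtlas (𝓡 d) ∞ M)
    (hc' : c' ∈ IsManifold.maximalAtlas (𝓡 d) ∞ M) {z : EuclideanSpace ℝ (Fin d)}
    (hz : z ∈ c.target) (hz' : c.symm z ∈ c'.source) :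
    ContDiffAt ℝ ∞ (c' ∘ c.symm) z ∧ ∀ u v, chartMetric c z u v =
      chartMetric c' ((c' ∘ c.symm) z) (fderiv ℝ (c' ∘ c.symm) z u)
        (fderiv ℝ (c' ∘ c.symm) z v) := by
  have h1 : ContDiffAt ℝ ∞ (c' ∘ c.symm) z :=
    ((contMDiffAt_of_mem_maximalAtlas hc' hz').comp z
      (contMDiffAt_symm_of_mem_maximalAtlas hc hz)).contDiffAt
  refine ⟨h1, fun u v => ?_⟩
  rw [← tangentInner_mfderiv hc' (f := c.symm) (c'.map_source hz')
    (h1.differentiableAt (by simp)) ?_, chartMetric_eq_tangentInner]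
  have h2 : ∀ᶠ x in 𝓝 z, c.symm x ∈ c'.source :=
    (c.continuousAt_symm hz).eventually_mem (c'.open_source.mem_nhds hz')
  filter_upwards [h2] with x hx using (c'.left_inv hx).symm

theorem IsGeodesicAt.congr (h : IsGeodesicAt (d := d) γ t) (he : γ =ᶠ[𝓝 t] γ') :
    IsGeodesicAt (d := d) γ' t :=
  let ⟨c, hc, hg⟩ := h
  ⟨c, hc, hg.congr he⟩

theorem IsGeodesicAt.continuousAt (h : IsGeodesicAt (d := d) γ t) : ContinuousAt γ t :=
  let ⟨_, _, hg⟩ := h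
  hg.cont

theorem chart_mem_maximalAtlas_infty (x : M) :
    chartAt (EuclideanSpace ℝ (Fin d)) x ∈ IsManifold.maximalAtlas (𝓡 d) ∞ M :=
  IsManifold.chart_mem_maximalAtlas x

variable [IsContMDiffRiemannianBundle (𝓡 d) ∞ (EuclideanSpace ℝ (Fin d))
    (fun x : M => TangentSpace (𝓡 d) x)]

/-- The geodesic equation does not depend on the chart. -/
theorem IsChartGeodesicAt.change (h : IsChartGeodesicAt c γ t)
    (hc : c ∈ IsManifold.maximalAtlas (𝓡 d) ∞ M) (hc' : c' ∈ IsManifold.maximalAtlas (𝓡 d) ∞ M)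
    (ht : γ t ∈ c'.source) : IsChartGeodesicAt c' γ t := by
  refine ⟨ht, h.cont, ?_⟩
  set τ := c' ∘ c.symm with hτ
  have hmem' : ∀ᶠ s in 𝓝 t, γ s ∈ c'.source := h.cont.eventually_mem (c'.open_source.mem_nhds ht)
  have heq : c' ∘ γ =ᶠ[𝓝 t] τ ∘ (c ∘ γ) := by
    filter_upwards [h.eventually_mem] with s hs
    simp only [hτ, Function.comp_apply, c.left_inv hs]
  -- the transition map is smooth and isometric near the points of the curve
  have htr : ∀ s, γ s ∈ c.source → γ s ∈ c'.source → ContDiffAt ℝ ∞ τ (c (γ s)) ∧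
      ∀ᶠ x in 𝓝 (c (γ s)), ∀ u v, chartMetric c x u v =
        chartMetric c' (τ x) (fderiv ℝ τ x u) (fderiv ℝ τ x v) := by
    intro s hs hs'
    have h0 := c.map_source hs
    have h1 : c.symm (c (γ s)) ∈ c'.source := by rwa [c.left_inv hs]
    refine ⟨(chartMetric_change hc hc' h0 h1).1, ?_⟩
    filter_upwards [c.open_target.mem_nhds h0,
      (c.continuousAt_symm h0).eventually_mem (c'.open_source.mem_nhds h1)] with x hx hx'
    exact (chartMetric_change hc hc' hx hx').2
  have hd1 : ∀ᶠ s in 𝓝 t, HasDerivAt (c' ∘ γ) (fderiv ℝ τ (c (γ s)) (deriv (c ∘ γ) s)) s := by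
    filter_upwards [h.eqn, h.eventually_mem, hmem', heq.eventuallyEq_nhds] with s hs hm hm' he
    have h2 := ((htr s hm hm').1.differentiableAt (by simp)).hasFDerivAt
    exact (h2.comp_hasDerivAt s hs.1).congr_of_eventuallyEq he
  have hd1' : deriv (c' ∘ γ) =ᶠ[𝓝 t] fun s => fderiv ℝ τ (c (γ s)) (deriv (c ∘ γ) s) := by
    filter_upwards [hd1] with s hs using hs.deriv
  filter_upwards [h.eqn, h.eventually_mem, hmem', hd1, hd1'.eventuallyEq_nhds] with
    s hs hm hm' hs1 hs1'
  refine ⟨hs1.deriv.symm ▸ hs1, ?_⟩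
  obtain ⟨hτs, hg⟩ := htr s hm hm'
  have hτz : τ (c (γ s)) = c' (γ s) := by simp only [hτ, Function.comp_apply, c.left_inv hm]
  have hτm : τ (c (γ s)) ∈ c'.target := hτz ▸ c'.map_source hm'
  have h6 := (isCoordMetric hc').hasDerivAt_change (isCoordMetric hc) (y := c ∘ γ)
    (c.map_source hm) hτm hτs hg hs.1 hs.2
  rw [hs1.deriv, ← hτz]
  exact h6.congr_of_eventuallyEq hs1'

theorem IsGeodesicAt.isChartGeodesicAt (h : IsGeodesicAt (d := d) γ t)
    (hc : c ∈ IsManifold.maximalAtlas (𝓡 d) ∞ M) (ht : γ t ∈ c.source) :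
    IsChartGeodesicAt c γ t := by
  obtain ⟨c', hc', h'⟩ := h
  exact h'.change hc' hc ht

theorem IsGeodesicAt.contMDiffAt (h : IsGeodesicAt (d := d) γ t) :
    ContMDiffAt 𝓘(ℝ, ℝ) (𝓡 d) 2 γ t := by
  obtain ⟨c, hc, h⟩ := h
  have hcont : ContDiffAt ℝ 2 (c ∘ γ) t := by
    have hΓ : ∀ s, γ s ∈ c.source → ContinuousAt (chartChristoffel c) (c (γ s)) := fun s hs =>
      ((contDiffOn_chartChristoffel hc).contDiffAt
        (c.open_target.mem_nhds (c.map_source hs))).continuousAt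
    obtain ⟨u, hu, huo, htu⟩ := _root_.eventually_nhds_iff.1 (h.eqn.and h.eventually_mem)
    have hdu : ContinuousOn (deriv (c ∘ γ)) u := fun s hs =>
      (hu s hs).1.2.continuousAt.continuousWithinAt
    have h2 : ContDiffOn ℝ (1 + 1) (c ∘ γ) u := by
      rw [contDiffOn_succ_iff_deriv_of_isOpen huo, ← zero_add (1 : WithTop ℕ∞),
        contDiffOn_succ_iff_deriv_of_isOpen huo]
      refine ⟨fun s hs => (hu s hs).1.1.differentiableAt.differentiableWithinAt, by simp,
        fun s hs => (hu s hs).1.2.differentiableAt.differentiableWithinAt, by simp, ?_⟩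
      rw [contDiffOn_zero]
      refine ContinuousOn.congr (f := fun s => -chartChristoffel c (c (γ s)) (deriv (c ∘ γ) s)
        (deriv (c ∘ γ) s)) ?_ fun s hs => (hu s hs).1.2.deriv
      refine ContinuousOn.neg (ContinuousOn.clm_apply (ContinuousOn.clm_apply
        (fun s hs => ContinuousAt.continuousWithinAt ?_) hdu) hdu)
      exact (hΓ s (hu s hs).2).comp (f := c ∘ γ) (hu s hs).1.1.continuousAt
    rw [one_add_one_eq_two] at h2
    exact h2.contDiffAt (huo.mem_nhds htu)
  exact ((contMDiffAt_symm_of_mem_maximalAtlas hc (c.map_source h.mem)).of_le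
    ENat.LEInfty.out |>.comp t hcont.contMDiffAt).congr_of_eventuallyEq h.eventuallyEq_symm

theorem hasDerivAt_euclidean_iff {f : ℝ → EuclideanSpace ℝ (Fin d)}
    {f' : EuclideanSpace ℝ (Fin d)} :
    HasDerivAt f f' t ↔ ∀ k, HasDerivAt (fun s => f s k) (f' k) t := by
  refine ⟨fun h k => (coord k).hasFDerivAt.comp_hasDerivAt t h, fun h => ?_⟩
  rw [hasDerivAt_iff_hasFDerivAt, ← hasFDerivWithinAt_univ, hasFDerivWithinAt_euclidean]
  intro k
  rw [hasFDerivWithinAt_univ]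
  refine (h k).hasFDerivAt.congr_fderiv ?_
  ext
  simp

/-- A curve is a geodesic if and only if it is one near each time, in some chart. -/
theorem isGeodesic_iff : IsGeodesic (d := d) γ ↔ ∀ t, IsGeodesicAt (d := d) γ t := by
  constructor
  · intro h t
    refine ⟨_, chart_mem_maximalAtlas_infty (γ t), mem_chart_source _ _,
      h.smooth.continuous.continuousAt, ?_⟩
    set c := chartAt (EuclideanSpace ℝ (Fin d)) (γ t)
    have hc : c ∈ IsManifold.maximalAtlas (𝓡 d) ∞ M := chart_mem_maximalAtlas_infty (γ t)
    have hmem : ∀ᶠ s in 𝓝 t, γ s ∈ c.source :=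
      h.smooth.continuous.continuousAt.eventually_mem
        (c.open_source.mem_nhds (mem_chart_source _ _))
    have hC : ∀ s, γ s ∈ c.source → ContDiffAt ℝ 2 (c ∘ γ) s := fun s hs =>
      (((contMDiffAt_of_mem_maximalAtlas hc hs).of_le ENat.LEInfty.out).comp s
        (h.smooth s)).contDiffAt
    have hd : ∀ s, γ s ∈ c.source → HasDerivAt (c ∘ γ) (deriv (c ∘ γ) s) s := fun s hs =>
      ((hC s hs).differentiableAt (by simp)).hasDerivAt
    have hdk : ∀ s, γ s ∈ c.source → ∀ k, HasDerivAt (fun r => c (γ r) k) (deriv (c ∘ γ) s k) s :=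
      fun s hs => hasDerivAt_euclidean_iff.1 (hd s hs)
    filter_upwards [hmem.eventually_nhds] with s hs
    have hs0 := hs.self_of_nhds
    refine ⟨hd s hs0, ?_⟩
    have hdd : HasDerivAt (deriv (c ∘ γ)) (deriv (deriv (c ∘ γ)) s) s := by
      have h1 : ContDiffAt ℝ 1 (deriv (c ∘ γ)) s := (hC s hs0).derivWithin (by rw [one_add_one_eq_two])
      exact (h1.differentiableAt (by simp)).hasDerivAt
    have hddk := hasDerivAt_euclidean_iff.1 hdd
    refine hasDerivAt_euclidean_iff.2 fun k => ?_
    refine (hddk k).congr_deriv ?_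
    have h2 := h.eqn c hc s hs0 k
    have h3 : (deriv fun r => c (γ r) k) =ᶠ[𝓝 s] fun r => deriv (c ∘ γ) r k := by
      filter_upwards [hs] with r hr using (hdk r hr k).deriv
    rw [h3.deriv_eq, (hddk k).deriv] at h2
    simp only [(hdk s hs0 _).deriv] at h2
    rw [PiLp.neg_apply, chartChristoffel, bilinMap_apply]
    linarith
  · intro h
    refine ⟨fun t => (h t).contMDiffAt, fun c hc t ht k => ?_⟩
    have h1 := (h t).isChartGeodesicAt hc ht
    have h2 : (deriv fun r => c (γ r) k) =ᶠ[𝓝 t] fun r => deriv (c ∘ γ) r k := by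
      filter_upwards [h1.eqn] with r hr using (hasDerivAt_euclidean_iff.1 hr.1 k).deriv
    have h3 := fun k => (hasDerivAt_euclidean_iff.1 h1.hasDerivAt k).deriv
    simp only [Function.comp_apply] at h3
    rw [h2.deriv_eq, (hasDerivAt_euclidean_iff.1 h1.hasDerivAt_deriv k).deriv]
    simp only [h3]
    rw [PiLp.neg_apply, chartChristoffel, bilinMap_apply]
    ring

/-- The geodesic equation as a first order system for position and velocity. -/
def spray (c : OpenPartialHomeomorph M (EuclideanSpace ℝ (Fin d)))
    (z : EuclideanSpace ℝ (Fin d) × EuclideanSpace ℝ (Fin d)) :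
    EuclideanSpace ℝ (Fin d) × EuclideanSpace ℝ (Fin d) :=
  (z.2, -chartChristoffel c z.1 z.2 z.2)

theorem contDiffOn_spray (hc : c ∈ IsManifold.maximalAtlas (𝓡 d) ∞ M) :
    ContDiffOn ℝ ∞ (spray c) (c.target ×ˢ univ) := by
  have h1 : ContDiffOn ℝ ∞ (fun z : EuclideanSpace ℝ (Fin d) × EuclideanSpace ℝ (Fin d) =>
      chartChristoffel c z.1) (c.target ×ˢ univ) :=
    (contDiffOn_chartChristoffel hc).comp contDiffOn_fst fun z hz => hz.1
  exact contDiffOn_snd.prodMk ((h1.clm_apply contDiffOn_snd).clm_apply contDiffOn_snd).neg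

/-- Two geodesics with the same position and velocity at one time coincide near that time: in a
chart both solve the first order system `spray`. -/
theorem IsChartGeodesicAt.eventuallyEq (h : IsChartGeodesicAt c γ t)
    (h' : IsChartGeodesicAt c γ' t) (hc : c ∈ IsManifold.maximalAtlas (𝓡 d) ∞ M)
    (h0 : γ t = γ' t) (h1 : deriv (c ∘ γ) t = deriv (c ∘ γ') t) : γ =ᶠ[𝓝 t] γ' := by
  have hU : IsOpen (c.target ×ˢ (univ : Set (EuclideanSpace ℝ (Fin d)))) :=
    c.open_target.prod isOpen_univ
  have hS : ContDiffAt ℝ 1 (spray c) (c (γ t), deriv (c ∘ γ) t) :=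
    ((contDiffOn_spray hc).contDiffAt (hU.mem_nhds ⟨c.map_source h.mem, mem_univ _⟩)).of_le
      (by simp)
  obtain ⟨K, s, hs, hl⟩ := hS.exists_lipschitzOnWith
  have key : ∀ η : ℝ → M, IsChartGeodesicAt c η t → γ t = η t →
      deriv (c ∘ γ) t = deriv (c ∘ η) t → ∀ᶠ r in 𝓝 t,
      HasDerivAt (fun r => (c (η r), deriv (c ∘ η) r)) (spray c (c (η r), deriv (c ∘ η) r)) r ∧
        (c (η r), deriv (c ∘ η) r) ∈ s := by
    intro η hη e0 e1
    have hcont : ContinuousAt (fun r => (c (η r), deriv (c ∘ η) r)) t :=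
      ContinuousAt.prodMk hη.hasDerivAt.continuousAt hη.hasDerivAt_deriv.continuousAt
    rw [e0, e1] at hs
    filter_upwards [hη.eqn, hcont.eventually_mem hs] with r hr hr'
    exact ⟨hr.1.prodMk hr.2, hr'⟩
  have := ODE_solution_unique_of_eventually (v := fun _ => spray c) (s := fun _ => s)
    (Eventually.of_forall fun _ => hl) (key γ h rfl rfl) (key γ' h' h0 h1)
    (Prod.ext (congrArg c h0) h1)
  filter_upwards [this, h.eventually_mem, h'.eventually_mem] with r hr hm hm'
  exact c.injOn hm hm' (congrArg Prod.fst hr)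

/-- Two geodesics on an interval with the same germ at one time coincide: the set of times at which
the germs agree is open, and relatively closed by local uniqueness. -/
theorem eqOn_of_isGeodesicAt [T2Space M] {J : Set ℝ} (hJ : IsPreconnected J)
    (h : ∀ s ∈ J, IsGeodesicAt (d := d) γ s) (h' : ∀ s ∈ J, IsGeodesicAt (d := d) γ' s)
    (ht : t ∈ J) (h0 : γ =ᶠ[𝓝 t] γ') : EqOn γ γ' J := by
  have hsub := hJ.subset_of_closure_inter_subset
    (u := {s | γ =ᶠ[𝓝 s] γ'}) isOpen_setOfPred_eventually_nhds ⟨t, ht, h0⟩ ?_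
  · exact fun s hs => (hsub hs).eq_of_nhds
  rintro s ⟨hcl, hs⟩
  have hne : (𝓝[{s | γ =ᶠ[𝓝 s] γ'}] s).NeBot := mem_closure_iff_nhdsWithin_neBot.1 hcl
  have e0 : γ s = γ' s := by
    refine tendsto_nhds_unique ((h s hs).continuousAt.tendsto.mono_left
      (nhdsWithin_le_nhds (s := {s | γ =ᶠ[𝓝 s] γ'}))) ?_
    refine ((h' s hs).continuousAt.tendsto.mono_left nhdsWithin_le_nhds).congr' ?_
    filter_upwards [self_mem_nhdsWithin] with r hr using hr.eq_of_nhds.symm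
  have hc := chart_mem_maximalAtlas_infty (d := d) (γ s)
  have g1 := (h s hs).isChartGeodesicAt hc (mem_chart_source _ _)
  have g2 := (h' s hs).isChartGeodesicAt hc (e0 ▸ mem_chart_source _ _)
  refine g1.eventuallyEq g2 hc e0 ?_
  refine tendsto_nhds_unique (g1.hasDerivAt_deriv.continuousAt.tendsto.mono_left
      (nhdsWithin_le_nhds (s := {s | γ =ᶠ[𝓝 s] γ'}))) ?_
  refine (g2.hasDerivAt_deriv.continuousAt.tendsto.mono_left nhdsWithin_le_nhds).congr' ?_
  filter_upwards [self_mem_nhdsWithin] with r hr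
  exact ((hr.fun_comp (chartAt (EuclideanSpace ℝ (Fin d)) (γ s))).deriv_eq).symm

end Geodesics

/-! ### Constant speed and the local geodesic flow -/

section Completeness

variable {d : ℕ} {M : Type*} [TopologicalSpace M] [ChartedSpace (EuclideanSpace ℝ (Fin d)) M]
  [IsManifold (𝓡 d) ∞ M] [Bundle.RiemannianBundle (fun x : M => TangentSpace (𝓡 d) x)]
  {c c' : OpenPartialHomeomorph M (EuclideanSpace ℝ (Fin d))} {γ γ' : ℝ → M} {t : ℝ}

/-- The velocity of a curve, as a vector of the model space. -/
def velocity (γ : ℝ → M) (t : ℝ) : EuclideanSpace ℝ (Fin d) :=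
  mfderiv 𝓘(ℝ, ℝ) (𝓡 d) γ t (1 : ℝ)

/-- The squared speed of a curve. -/
def speedSq (γ : ℝ → M) (t : ℝ) : ℝ :=
  tangentInner (d := d) (γ t) (velocity γ t) (velocity γ t)

theorem IsChartGeodesicAt.speedSq_eq (h : IsChartGeodesicAt c γ t)
    (hc : c ∈ IsManifold.maximalAtlas (𝓡 d) ∞ M) :
    speedSq (d := d) γ t = chartMetric c (c (γ t)) (deriv (c ∘ γ) t) (deriv (c ∘ γ) t) := by
  have h1 := tangentInner_mfderiv (X := ℝ) (f := γ) (h := c ∘ γ) (p := t) hc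
    (c.map_source h.mem) h.hasDerivAt.differentiableAt h.eventuallyEq_symm (1 : ℝ) (1 : ℝ)
  exact h1

theorem IsChartGeodesicAt.velocity_eq (h : IsChartGeodesicAt c γ t)
    (hc : c ∈ IsManifold.maximalAtlas (𝓡 d) ∞ M) :
    velocity γ t = mfderiv (𝓡 d) (𝓡 d) c.symm (c (γ t)) (deriv (c ∘ γ) t) := by
  rw [velocity, h.eventuallyEq_symm.mfderiv_eq, mfderiv_comp t
    ((mdifferentiable_of_mem_maximalAtlas hc).mdifferentiableAt_symm (c.map_source h.mem))
    h.hasDerivAt.differentiableAt.mdifferentiableAt, mfderiv_eq_fderiv]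
  rfl

theorem IsChartGeodesicAt.deriv_eq (h : IsChartGeodesicAt c γ t)
    (hc : c ∈ IsManifold.maximalAtlas (𝓡 d) ∞ M) :
    deriv (c ∘ γ) t = mfderiv (𝓡 d) (𝓡 d) c (γ t) (velocity γ t) := by
  have h1 := congrArg (fun L => L (deriv (c ∘ γ) t))
    ((mdifferentiable_of_mem_maximalAtlas hc).comp_symm_deriv (c.map_source h.mem))
  rw [h.velocity_eq hc]
  have h2 : c.symm (c (γ t)) = γ t := c.left_inv h.mem
  rw [h2] at h1
  exact h1.symm

theorem IsChartGeodesicAt.comp_sub (h : IsChartGeodesicAt c γ t) (a : ℝ) :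
    IsChartGeodesicAt c (fun s => γ (s - a)) (t + a) := by
  have hta : t + a - a = t := by ring
  have hT : Tendsto (fun s : ℝ => s - a) (𝓝 (t + a)) (𝓝 t) := by
    have : ContinuousAt (fun s : ℝ => s - a) (t + a) := by fun_prop
    rwa [ContinuousAt, hta] at this
  have hd : deriv (c ∘ fun s => γ (s - a)) = fun s => deriv (c ∘ γ) (s - a) := by
    funext s
    exact deriv_comp_sub_const (f := c ∘ γ) a s
  refine ⟨by simpa using h.mem, ?_, ?_⟩
  · exact ContinuousAt.comp_of_eq (g := γ) (by simpa using h.cont) (by fun_prop) hta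
  · filter_upwards [hT.eventually h.eqn] with s hs
    rw [hd]
    exact ⟨hs.1.comp_sub_const s a, hs.2.comp_sub_const s a⟩

variable [IsContMDiffRiemannianBundle (𝓡 d) ∞ (EuclideanSpace ℝ (Fin d))
    (fun x : M => TangentSpace (𝓡 d) x)]

theorem IsGeodesicAt.hasDerivAt_speedSq (h : IsGeodesicAt (d := d) γ t) :
    HasDerivAt (speedSq (d := d) γ) 0 t := by
  obtain ⟨c, hc, h⟩ := h
  have h1 := (isCoordMetric hc).hasDerivAt_inner (y := c ∘ γ) (c.map_source h.mem) h.hasDerivAt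
    h.hasDerivAt_deriv h.hasDerivAt_deriv
  simp only [Function.comp_apply, neg_add_cancel, map_zero, zero_apply, add_zero] at h1
  refine h1.congr_of_eventuallyEq ?_
  filter_upwards [h.eventually_isChartGeodesicAt] with s hs using hs.speedSq_eq hc

/-- Geodesics have constant speed. -/
theorem speedSq_eq_of_isGeodesicAt {J : Set ℝ} (hJ : IsOpen J) (hJ' : IsPreconnected J)
    (h : ∀ s ∈ J, IsGeodesicAt (d := d) γ s) {a b : ℝ} (ha : a ∈ J) (hb : b ∈ J) :
    speedSq (d := d) γ a = speedSq (d := d) γ b :=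
  hJ.is_const_of_deriv_eq_zero hJ'
    (fun s hs => (h s hs).hasDerivAt_speedSq.differentiableAt.differentiableWithinAt)
    (fun s hs => (h s hs).hasDerivAt_speedSq.deriv) ha hb

/-- On `U`, the geodesics of squared speed less than `R` exist for times in `(-ε, ε)` and are given
in the chart `c` by a smooth map `Y` of the initial position, the initial velocity and the time. -/
structure IsLocalGeodesicFlow (c : OpenPartialHomeomorph M (EuclideanSpace ℝ (Fin d))) (U : Set M)
    (R ε : ℝ) (Y : EuclideanSpace ℝ (Fin d) × EuclideanSpace ℝ (Fin d) → ℝ →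
      EuclideanSpace ℝ (Fin d)) : Prop where
  mem_atlas : c ∈ IsManifold.maximalAtlas (𝓡 d) ∞ M
  isOpen : IsOpen U
  subset : U ⊆ c.source
  smooth : ∀ q ∈ U, ∀ w, chartMetric c (c q) w w < R → ∀ t, |t| < ε → ContDiffAt ℝ ∞
    (fun p : (EuclideanSpace ℝ (Fin d) × EuclideanSpace ℝ (Fin d)) × ℝ => Y p.1 p.2) ((c q, w), t)
  target : ∀ q ∈ U, ∀ w, chartMetric c (c q) w w < R → ∀ t, |t| < ε → Y (c q, w) t ∈ c.target
  init : ∀ q ∈ U, ∀ w, chartMetric c (c q) w w < R → Y (c q, w) 0 = c q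
  geodesic : ∀ q ∈ U, ∀ w, chartMetric c (c q) w w < R → ∀ t, |t| < ε →
    IsChartGeodesicAt c (fun s => c.symm (Y (c q, w) s)) t
  velocity : ∀ q ∈ U, ∀ w, chartMetric c (c q) w w < R →
    deriv (c ∘ fun s => c.symm (Y (c q, w) s)) 0 = w

theorem IsLocalGeodesicFlow.mono {U : Set M} {R ε ε' : ℝ}
    {Y : EuclideanSpace ℝ (Fin d) × EuclideanSpace ℝ (Fin d) → ℝ → EuclideanSpace ℝ (Fin d)}
    (h : IsLocalGeodesicFlow c U R ε Y) (hε : ε' ≤ ε) : IsLocalGeodesicFlow c U R ε' Y where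
  mem_atlas := h.mem_atlas
  isOpen := h.isOpen
  subset := h.subset
  smooth q hq w hw t ht := h.smooth q hq w hw t (ht.trans_le hε)
  target q hq w hw t ht := h.target q hq w hw t (ht.trans_le hε)
  init := h.init
  geodesic q hq w hw t ht := h.geodesic q hq w hw t (ht.trans_le hε)
  velocity := h.velocity

/-- Near a point the metric in a chart is bounded below by a multiple of the Euclidean metric. -/
theorem exists_chartMetric_lower_bound (hc : c ∈ IsManifold.maximalAtlas (𝓡 d) ∞ M)
    {y : EuclideanSpace ℝ (Fin d)} (hy : y ∈ c.target) :
    ∃ m > 0, ∀ᶠ z in 𝓝 y, ∀ w, m * ‖w‖ ^ 2 ≤ chartMetric c z w w := by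
  obtain ⟨m, hm, hmin⟩ := (isCompact_sphere (0 : EuclideanSpace ℝ (Fin d)) 1).exists_forall_le'
    (f := fun w => chartMetric c y w w) (by fun_prop) (a := 0)
    (fun w hw => chartMetric_pos hc hy (by rintro rfl; simp at hw))
  have hcont : ContinuousAt (chartMetric c) y :=
    ((contDiffOn_chartMetric hc).contDiffAt (c.open_target.mem_nhds hy)).continuousAt
  refine ⟨m / 2, by positivity, ?_⟩
  filter_upwards [Metric.continuousAt_iff'.1 hcont (m / 2) (by positivity)] with z hz w
  rw [dist_eq_norm] at hz
  have h1 : m * ‖w‖ ^ 2 ≤ chartMetric c y w w := by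
    rcases eq_or_ne w 0 with rfl | hw
    · simp
    · have hn : 0 < ‖w‖ := norm_pos_iff.2 hw
      have h2 := hmin (‖w‖⁻¹ • w) (by simp [norm_smul, hn.ne'])
      simp only [map_smul, smul_apply, smul_eq_mul] at h2
      rw [← mul_assoc, ← mul_inv, ← sq, ← div_eq_inv_mul, le_div_iff₀ (by positivity)] at h2
      exact h2
  have h3 : |(chartMetric c z - chartMetric c y) w w| ≤ m / 2 * ‖w‖ ^ 2 := by
    refine (((chartMetric c z - chartMetric c y).le_opNorm₂ w w)).trans ?_
    rw [mul_assoc, ← sq]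
    gcongr
  have h4 := (abs_le.1 h3).1
  simp only [sub_apply] at h4
  linarith

/-- Every point has a neighbourhood on which the geodesics of bounded speed are given by the flow of
`spray` near the zero vector; the bound on the speed is reached by rescaling time. -/
theorem exists_isLocalGeodesicFlow (p : M) {R : ℝ} (hR : 0 < R) :
    ∃ ε > 0, ∃ c U Y, p ∈ U ∧ IsLocalGeodesicFlow (M := M) (d := d) c U R ε Y := by
  set c := chartAt (EuclideanSpace ℝ (Fin d)) p with hcdef
  have hc : c ∈ IsManifold.maximalAtlas (𝓡 d) ∞ M := chart_mem_maximalAtlas_infty p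
  have hp : p ∈ c.source := mem_chart_source _ p
  have hUo : IsOpen (c.target ×ˢ (univ : Set (EuclideanSpace ℝ (Fin d)))) :=
    c.open_target.prod isOpen_univ
  obtain ⟨ε₀, hε₀, Z, hZs, hZ⟩ := exists_smooth_flow hUo (contDiffOn_spray hc)
    (x₀ := (c p, 0)) ⟨c.map_source hp, mem_univ _⟩
  obtain ⟨m, hm, hlow⟩ := exists_chartMetric_lower_bound hc (c.map_source hp)
  -- velocities are scaled by `r` to bring them into the ball where the flow is defined
  set r := ε₀ * √(m / (2 * R)) with hr
  have hr0 : 0 < r := by positivity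
  have hr2 : r ^ 2 * R < ε₀ ^ 2 * m := by
    rw [hr, mul_pow, Real.sq_sqrt (by positivity)]
    have : ε₀ ^ 2 * (m / (2 * R)) * R = ε₀ ^ 2 * m / 2 := by field_simp
    rw [this]
    have : 0 < ε₀ ^ 2 * m := by positivity
    linarith
  have hnear : ∀ᶠ q in 𝓝 p, q ∈ c.source ∧ dist (c q) (c p) < ε₀ ∧
      ∀ w, m * ‖w‖ ^ 2 ≤ chartMetric c (c q) w w := by
    have hcc := c.continuousAt hp
    filter_upwards [c.open_source.mem_nhds hp, hcc.eventually hlow,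
      hcc.eventually_mem (ball_mem_nhds (c p) hε₀)] with q h1 h2 h3 using ⟨h1, h3, h2⟩
  obtain ⟨U, hU, hUo', hpU⟩ := _root_.eventually_nhds_iff.1 hnear
  have hball : ∀ q ∈ U, ∀ w, chartMetric c (c q) w w < R →
      (c q, r • w) ∈ ball (c p, (0 : EuclideanSpace ℝ (Fin d))) ε₀ := by
    intro q hq w hw
    obtain ⟨-, h2, h3⟩ := hU q hq
    rw [mem_ball, Prod.dist_eq]
    refine max_lt h2 ?_
    rw [dist_zero_right, norm_smul, Real.norm_of_nonneg hr0.le]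
    have h4 := (h3 w).trans_lt hw
    have h5 : (r * ‖w‖) ^ 2 < ε₀ ^ 2 := by
      have : r ^ 2 * (m * ‖w‖ ^ 2) < ε₀ ^ 2 * m :=
        (mul_le_mul_of_nonneg_left h4.le (by positivity)).trans_lt hr2
      rw [mul_pow]
      nlinarith
    exact lt_of_pow_lt_pow_left₀ 2 hε₀.le h5
  have htime : ∀ t : ℝ, |t| < r * ε₀ → t / r ∈ Ioo (-ε₀) ε₀ := by
    intro t ht
    refine abs_lt.1 ?_
    rw [abs_div, abs_of_pos hr0, div_lt_iff₀ hr0]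
    linarith
  let Y : EuclideanSpace ℝ (Fin d) × EuclideanSpace ℝ (Fin d) → ℝ → EuclideanSpace ℝ (Fin d) :=
    fun x t => (Z (x.1, r • x.2) (t / r)).1
  have hYd : ∀ q ∈ U, ∀ w, chartMetric c (c q) w w < R → ∀ t, |t| < r * ε₀ →
      Y (c q, w) t ∈ c.target ∧
      HasDerivAt (Y (c q, w)) (r⁻¹ • (Z (c q, r • w) (t / r)).2) t ∧
      HasDerivAt (fun s => r⁻¹ • (Z (c q, r • w) (s / r)).2)
        (-chartChristoffel c (Y (c q, w) t) (r⁻¹ • (Z (c q, r • w) (t / r)).2)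
          (r⁻¹ • (Z (c q, r • w) (t / r)).2)) t := by
    intro q hq w hw t ht
    obtain ⟨h1, h2⟩ := (hZ _ (hball q hq w hw)).2 _ (htime t ht)
    have h3 : HasDerivAt (fun s => Z (c q, r • w) (s / r))
        (r⁻¹ • spray c (Z (c q, r • w) (t / r))) t := by
      refine (HasDerivAt.scomp t h2 ((hasDerivAt_id t).div_const r)).congr_deriv ?_
      rw [one_div]
    refine ⟨h1.1, h3.fst, ?_⟩
    have h4 : HasDerivAt (fun s => (Z (c q, r • w) (s / r)).2)
        (r⁻¹ • spray c (Z (c q, r • w) (t / r))).2 t := h3.snd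
    refine (h4.const_smul r⁻¹).congr_deriv ?_
    simp only [spray, Prod.smul_snd, map_smul, smul_apply, smul_neg, Y]
  have hYt : ∀ t : ℝ, |t| < r * ε₀ → ∀ᶠ s in 𝓝 t, |s| < r * ε₀ := fun t ht =>
    (isOpen_lt continuous_abs continuous_const).mem_nhds ht
  have hcY : ∀ q ∈ U, ∀ w, chartMetric c (c q) w w < R → ∀ t, |t| < r * ε₀ →
      deriv (c ∘ fun s => c.symm (Y (c q, w) s)) t = r⁻¹ • (Z (c q, r • w) (t / r)).2 ∧
      (c ∘ fun s => c.symm (Y (c q, w) s)) =ᶠ[𝓝 t] Y (c q, w) := by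
    intro q hq w hw t ht
    have h1 : (c ∘ fun s => c.symm (Y (c q, w) s)) =ᶠ[𝓝 t] Y (c q, w) := by
      filter_upwards [hYt t ht] with s hs using c.right_inv (hYd q hq w hw s hs).1
    exact ⟨h1.deriv_eq.trans (hYd q hq w hw t ht).2.1.deriv, h1⟩
  have h00 : |(0 : ℝ)| < r * ε₀ := by rw [abs_zero]; positivity
  refine ⟨r * ε₀, by positivity, c, U, Y, hpU, ?_⟩
  refine ⟨hc, hUo', fun q hq => (hU q hq).1, ?_, fun q hq w hw t ht => (hYd q hq w hw t ht).1,
    ?_, ?_, ?_⟩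
  · intro q hq w hw t ht
    have hmem : (((c q, r • w), t / r) : (EuclideanSpace ℝ (Fin d) × EuclideanSpace ℝ (Fin d)) × ℝ)
        ∈ ball (c p, (0 : EuclideanSpace ℝ (Fin d))) ε₀ ×ˢ Ioo (-ε₀) ε₀ :=
      ⟨hball q hq w hw, htime t ht⟩
    have h1 := hZs.contDiffAt ((isOpen_ball.prod isOpen_Ioo).mem_nhds hmem)
    have h2 : ContDiff ℝ ∞ (fun p : (EuclideanSpace ℝ (Fin d) × EuclideanSpace ℝ (Fin d)) × ℝ =>
        ((p.1.1, r • p.1.2), p.2 / r)) := by fun_prop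
    exact (ContDiffAt.comp ((c q, w), t) (g := fun p : (EuclideanSpace ℝ (Fin d) ×
      EuclideanSpace ℝ (Fin d)) × ℝ => Z p.1 p.2) h1 h2.contDiffAt).fst
  · intro q hq w hw
    simp only [Y, zero_div]
    rw [(hZ _ (hball q hq w hw)).1]
  · intro q hq w hw t ht
    obtain ⟨h1, h2, h3⟩ := hYd q hq w hw t ht
    refine ⟨c.map_target h1, (c.continuousAt_symm h1).comp h2.continuousAt, ?_⟩
    have hde : deriv (c ∘ fun s => c.symm (Y (c q, w) s)) =ᶠ[𝓝 t]
        fun s => r⁻¹ • (Z (c q, r • w) (s / r)).2 := by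
      filter_upwards [hYt t ht] with s hs using (hcY q hq w hw s hs).1
    filter_upwards [hYt t ht, hde.eventuallyEq_nhds] with s hs hde'
    obtain ⟨g1, g2, g3⟩ := hYd q hq w hw s hs
    obtain ⟨e1, e2⟩ := hcY q hq w hw s hs
    rw [e1, c.right_inv g1]
    exact ⟨g2.congr_of_eventuallyEq e2, g3.congr_of_eventuallyEq hde'⟩
  · intro q hq w hw
    rw [(hcY q hq w hw 0 h00).1, zero_div, (hZ _ (hball q hq w hw)).1, smul_smul,
      inv_mul_cancel₀ hr0.ne', one_smul]

/-- On a compact manifold the geodesics of bounded speed exist for a uniform time. -/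
theorem exists_uniform_isLocalGeodesicFlow [CompactSpace M] {R : ℝ} (hR : 0 < R) :
    ∃ ε > 0, ∀ p : M, ∃ c U Y, p ∈ U ∧ IsLocalGeodesicFlow (M := M) (d := d) c U R ε Y := by
  have := isCompact_univ.induction_on (X := M) (p := fun S => ∃ ε > 0, ∀ p ∈ S, ∃ c U Y, p ∈ U ∧
    IsLocalGeodesicFlow (M := M) (d := d) c U R ε Y) ⟨1, one_pos, by simp⟩ ?_ ?_ ?_
  · obtain ⟨ε, hε, h⟩ := this
    exact ⟨ε, hε, fun p => h p (mem_univ p)⟩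
  · rintro S S' hSS' ⟨ε, hε, h⟩
    exact ⟨ε, hε, fun p hp => h p (hSS' hp)⟩
  · rintro S S' ⟨ε, hε, h⟩ ⟨ε', hε', h'⟩
    refine ⟨min ε ε', lt_min hε hε', ?_⟩
    rintro p (hp | hp)
    · obtain ⟨c, U, Y, hpU, hf⟩ := h p hp
      exact ⟨c, U, Y, hpU, hf.mono (min_le_left _ _)⟩
    · obtain ⟨c, U, Y, hpU, hf⟩ := h' p hp
      exact ⟨c, U, Y, hpU, hf.mono (min_le_right _ _)⟩
  · intro p _
    obtain ⟨ε, hε, c, U, Y, hpU, hf⟩ := exists_isLocalGeodesicFlow (d := d) p hR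
    exact ⟨U, mem_nhdsWithin_of_mem_nhds (hf.isOpen.mem_nhds hpU), ε, hε,
      fun q hq => ⟨c, U, Y, hq, hf⟩⟩

end Completeness

/-! ### Existence and smooth dependence of geodesics -/

section Existence

variable {d : ℕ} {M : Type*} [TopologicalSpace M] [ChartedSpace (EuclideanSpace ℝ (Fin d)) M]
  [IsManifold (𝓡 d) ∞ M] [Bundle.RiemannianBundle (fun x : M => TangentSpace (𝓡 d) x)]
  {c c' : OpenPartialHomeomorph M (EuclideanSpace ℝ (Fin d))} {γ γ' : ℝ → M} {t : ℝ}

/-- The components in the chart `c` of a tangent vector at `p`. -/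
def components (c : OpenPartialHomeomorph M (EuclideanSpace ℝ (Fin d))) (p : M)
    (v : EuclideanSpace ℝ (Fin d)) : EuclideanSpace ℝ (Fin d) :=
  mfderiv (𝓡 d) (𝓡 d) c p v

/-- The tangent vector with given components in the chart `c`, at the point with coordinates `y`. -/
def ofComponents (c : OpenPartialHomeomorph M (EuclideanSpace ℝ (Fin d)))
    (y w : EuclideanSpace ℝ (Fin d)) : EuclideanSpace ℝ (Fin d) :=
  mfderiv (𝓡 d) (𝓡 d) c.symm y w

theorem velocity_congr (h : γ =ᶠ[𝓝 t] γ') : velocity (d := d) γ t = velocity γ' t := by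
  rw [velocity, velocity, h.mfderiv_eq]
  rfl

theorem ofComponents_components (hc : c ∈ IsManifold.maximalAtlas (𝓡 d) ∞ M) {p : M}
    (hp : p ∈ c.source) (v : EuclideanSpace ℝ (Fin d)) :
    ofComponents c (c p) (components c p v) = v :=
  congrArg (fun L => L v) ((mdifferentiable_of_mem_maximalAtlas hc).symm_comp_deriv hp)

theorem chartMetric_components (hc : c ∈ IsManifold.maximalAtlas (𝓡 d) ∞ M) {p : M}
    (hp : p ∈ c.source) (v w : EuclideanSpace ℝ (Fin d)) :
    chartMetric c (c p) (components c p v) (components c p w) = tangentInner p v w := by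
  have h : _ = tangentInner _ (ofComponents _ _ _) (ofComponents _ _ _) :=
    chartMetric_eq_tangentInner c (c p) (components c p v) (components c p w)
  rw [ofComponents_components hc hp, ofComponents_components hc hp, c.left_inv hp] at h
  exact h

variable [IsContMDiffRiemannianBundle (𝓡 d) ∞ (EuclideanSpace ℝ (Fin d))
    (fun x : M => TangentSpace (𝓡 d) x)]

theorem IsGeodesicAt.eventuallyEq (h : IsGeodesicAt (d := d) γ t) (h' : IsGeodesicAt (d := d) γ' t)
    (h0 : γ t = γ' t) (h1 : velocity (d := d) γ t = velocity γ' t) : γ =ᶠ[𝓝 t] γ' := by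
  have hc := chart_mem_maximalAtlas_infty (d := d) (γ t)
  have g1 := h.isChartGeodesicAt hc (mem_chart_source _ _)
  have g2 := h'.isChartGeodesicAt hc (h0 ▸ mem_chart_source _ _)
  refine g1.eventuallyEq g2 hc h0 ?_
  have e1 : deriv _ t = components _ (γ t) (velocity γ t) := g1.deriv_eq hc
  have e2 : deriv _ t = components _ (γ' t) (velocity γ' t) := g2.deriv_eq hc
  rw [e1, e2, h0, h1]

theorem IsLocalGeodesicFlow.exists_isGeodesicAt {U : Set M} {R ε : ℝ}
    {Y : EuclideanSpace ℝ (Fin d) × EuclideanSpace ℝ (Fin d) → ℝ → EuclideanSpace ℝ (Fin d)}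
    (h : IsLocalGeodesicFlow c U R ε Y) (hε : 0 < ε) {q : M} (hq : q ∈ U)
    {v : EuclideanSpace ℝ (Fin d)} (hv : tangentInner q v v < R) (a : ℝ) :
    let η := fun s => c.symm (Y (c q, components c q v) (s - a))
    (∀ t ∈ ball a ε, IsGeodesicAt (d := d) η t) ∧ η a = q ∧ SphericalMean.velocity η a = v := by
  intro η
  have hqc := h.subset hq
  rw [← chartMetric_components h.mem_atlas hqc] at hv
  have hg : ∀ t ∈ ball a ε, IsChartGeodesicAt c η t := by
    intro t ht
    rw [mem_ball, Real.dist_eq] at ht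
    have := (h.geodesic q hq _ hv (t - a) ht).comp_sub a
    rwa [sub_add_cancel] at this
  have h0 : η a = q := by
    simp only [η, sub_self]
    rw [h.init q hq _ hv, c.left_inv hqc]
  refine ⟨fun t ht => ⟨c, h.mem_atlas, hg t ht⟩, h0, ?_⟩
  have h1 := hg a (mem_ball_self hε)
  have h2 : deriv (c ∘ η) a = components c q v := by
    have := deriv_comp_sub_const
      (f := c ∘ fun s => c.symm (Y (c q, components c q v) s)) a a
    rw [sub_self, h.velocity q hq _ hv] at this
    exact this
  have h3 : SphericalMean.velocity η a = ofComponents c (c (η a)) (deriv (c ∘ η) a) :=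
    h1.velocity_eq h.mem_atlas
  rw [h3, h2, h0]
  exact ofComponents_components h.mem_atlas hqc v

/-- Geodesics on two overlapping intervals with the same initial data can be glued. -/
theorem exists_isGeodesicAt_union [T2Space M] {J J' : Set ℝ} (hJ : IsOpen J) (hJ' : IsOpen J')
    (hJJ' : IsPreconnected (J ∩ J')) (h : ∀ s ∈ J, IsGeodesicAt (d := d) γ s)
    (h' : ∀ s ∈ J', IsGeodesicAt (d := d) γ' s) (ht : t ∈ J) (ht' : t ∈ J') (h0 : γ t = γ' t)
    (h1 : velocity (d := d) γ t = velocity γ' t) :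
    ∃ η : ℝ → M, (∀ s ∈ J ∪ J', IsGeodesicAt (d := d) η s) ∧ EqOn η γ J := by
  classical
  have heq : EqOn γ γ' (J ∩ J') := eqOn_of_isGeodesicAt hJJ' (fun s hs => h s hs.1)
    (fun s hs => h' s hs.2) ⟨ht, ht'⟩ ((h t ht).eventuallyEq (h' t ht') h0 h1)
  have e1 : EqOn (J.piecewise γ γ') γ J := fun s hs => piecewise_eq_of_mem _ _ _ hs
  have e2 : EqOn (J.piecewise γ γ') γ' J' := by
    intro s hs
    by_cases hsJ : s ∈ J
    · rw [piecewise_eq_of_mem _ _ _ hsJ, heq ⟨hsJ, hs⟩]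
    · rw [piecewise_eq_of_notMem _ _ _ hsJ]
  refine ⟨J.piecewise γ γ', ?_, e1⟩
  rintro s (hs | hs)
  · exact (h s hs).congr (e1.eventuallyEq_of_mem (hJ.mem_nhds hs)).symm
  · exact (h' s hs).congr (e2.eventuallyEq_of_mem (hJ'.mem_nhds hs)).symm

/-- On a compact manifold, geodesics exist for all times: since the speed is constant, a geodesic can
be extended on both sides by a uniform amount, again and again. -/
theorem exists_isGeodesic [T2Space M] [CompactSpace M] (x : M) (v : EuclideanSpace ℝ (Fin d)) :
    ∃ γ : ℝ → M, IsGeodesic (d := d) γ ∧ γ 0 = x ∧ velocity (d := d) γ 0 = v := by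
  set R := |tangentInner x v v| + 1
  have hR : tangentInner x v v < R := (le_abs_self _).trans_lt (lt_add_one _)
  obtain ⟨ε, hε, hflow⟩ := exists_uniform_isLocalGeodesicFlow (M := M) (d := d) (R := R)
    (by positivity)
  have hloc : ∀ (q : M) (w : EuclideanSpace ℝ (Fin d)), tangentInner q w w < R → ∀ a,
      ∃ η : ℝ → M, (∀ t ∈ ball a ε, IsGeodesicAt (d := d) η t) ∧ η a = q ∧ velocity (d := d) η a = w := by
    intro q w hw a
    obtain ⟨c, U, Y, hqU, hf⟩ := hflow q
    exact ⟨_, hf.exists_isGeodesicAt hε hqU hw a⟩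
  -- a geodesic on an open interval around `0` extends by `ε` beyond any of its points
  have hext : ∀ (a b s : ℝ), (0 : ℝ) ∈ Ioo a b → s ∈ Ioo a b → ∀ γ : ℝ → M,
      (∀ t ∈ Ioo a b, IsGeodesicAt (d := d) γ t) → γ 0 = x → velocity (d := d) γ 0 = v →
      ∃ η : ℝ → M, (∀ t ∈ Ioo a b ∪ Ioo (s - ε) (s + ε), IsGeodesicAt (d := d) η t) ∧ η 0 = x ∧
        velocity (d := d) η 0 = v := by
    intro a b s h0 hs γ hγ h1 h2
    have hsp : speedSq (d := d) γ s < R := by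
      have := speedSq_eq_of_isGeodesicAt isOpen_Ioo isPreconnected_Ioo hγ hs h0
      rwa [this, speedSq, h1, h2]
    obtain ⟨η, hη, h3, h4⟩ := hloc (γ s) (velocity γ s) hsp s
    rw [Real.ball_eq_Ioo] at hη
    obtain ⟨ζ, hζ, he⟩ := exists_isGeodesicAt_union isOpen_Ioo isOpen_Ioo
      (by rw [Ioo_inter_Ioo]; exact isPreconnected_Ioo) hγ hη hs
      ⟨by linarith, by linarith⟩ h3.symm h4.symm
    exact ⟨ζ, hζ, (he h0).trans h1, (velocity_congr
      (he.eventuallyEq_of_mem (isOpen_Ioo.mem_nhds h0))).trans h2⟩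
  have hstep : ∀ n : ℕ, ∃ γ : ℝ → M, (∀ t ∈ Ioo (-((n + 1) * (ε / 2))) ((n + 1) * (ε / 2)),
      IsGeodesicAt (d := d) γ t) ∧ γ 0 = x ∧ velocity (d := d) γ 0 = v := by
    intro n
    induction n with
    | zero =>
      obtain ⟨η, hη, h⟩ := hloc x v hR 0
      rw [Real.ball_eq_Ioo] at hη
      exact ⟨η, fun t ht => hη t ⟨by simp at ht; linarith, by simp at ht; linarith⟩, h⟩
    | succ n ih =>
      obtain ⟨γ, hγ, h1, h2⟩ := ih
      set T : ℝ := (n + 1) * (ε / 2) with hT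
      have hT0 : ε / 2 ≤ T := by
        rw [hT]
        have : (0 : ℝ) ≤ n := n.cast_nonneg
        nlinarith
      obtain ⟨η, hη, h3, h4⟩ := hext (-T) T (T - ε / 2 + ε / 4) ⟨by linarith, by linarith⟩
        ⟨by linarith, by linarith⟩ γ hγ h1 h2
      have hη' : ∀ t ∈ Ioo (-T) (T + ε / 2), IsGeodesicAt (d := d) η t := by
        intro t ht
        refine hη t ?_
        rcases lt_or_ge t T with h | h
        · exact Or.inl ⟨ht.1, h⟩
        · exact Or.inr ⟨by linarith, by linarith [ht.2]⟩
      obtain ⟨ζ, hζ, h5, h6⟩ := hext (-T) (T + ε / 2) (-(T - ε / 2 + ε / 4))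
        ⟨by linarith, by linarith⟩ ⟨by linarith, by linarith⟩ η hη' h3 h4
      refine ⟨ζ, fun t ht => hζ t ?_, h5, h6⟩
      have hT' : ((n + 1 : ℕ) + 1 : ℝ) * (ε / 2) = T + ε / 2 := by
        rw [hT]; push_cast; ring
      rw [hT'] at ht
      rcases lt_or_ge (-T) t with h | h
      · exact Or.inl ⟨h, ht.2⟩
      · exact Or.inr ⟨by linarith [ht.1], by linarith⟩
  have hall : ∀ T : ℝ, ∃ γ : ℝ → M, (∀ t ∈ Ioo (-T) T, IsGeodesicAt (d := d) γ t) ∧ γ 0 = x ∧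
      velocity (d := d) γ 0 = v := by
    intro T
    obtain ⟨n, hn⟩ := exists_nat_gt (T / (ε / 2))
    obtain ⟨γ, hγ, h⟩ := hstep n
    rw [div_lt_iff₀ (by positivity)] at hn
    exact ⟨γ, fun t ht => hγ t ⟨by nlinarith [ht.1], by nlinarith [ht.2]⟩, h⟩
  -- the geodesics on the intervals `(-T, T)` agree with each other and define one on `ℝ`
  choose Γ hΓ hΓ0 hΓ1 using hall
  have hagree : ∀ S T t : ℝ, |t| < S → |t| < T → Γ S t = Γ T t := by
    intro S T t hS hT
    have hS' := abs_lt.1 hS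
    have hT' := abs_lt.1 hT
    have h0 : 0 < min S T := (abs_nonneg t).trans_lt (lt_min hS hT)
    have hsub : ∀ s ∈ Ioo (-(min S T)) (min S T), s ∈ Ioo (-S) S ∧ s ∈ Ioo (-T) T := by
      intro s hs
      have h1 := min_le_left S T
      have h2 := min_le_right S T
      exact ⟨⟨by linarith [hs.1], by linarith [hs.2]⟩, ⟨by linarith [hs.1], by linarith [hs.2]⟩⟩
    have hz : (0 : ℝ) ∈ Ioo (-(min S T)) (min S T) := ⟨by linarith, h0⟩
    refine eqOn_of_isGeodesicAt (isPreconnected_Ioo (a := -(min S T)) (b := min S T))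
      (fun s hs => hΓ S s (hsub s hs).1) (fun s hs => hΓ T s (hsub s hs).2) hz ?_
      (abs_lt.1 (lt_min hS hT))
    exact (hΓ S 0 (hsub 0 hz).1).eventuallyEq (hΓ T 0 (hsub 0 hz).2) ((hΓ0 S).trans (hΓ0 T).symm)
      ((hΓ1 S).trans (hΓ1 T).symm)
  have hloc' : ∀ t : ℝ, (Γ (|t| + 2)) =ᶠ[𝓝 t] fun s => Γ (|s| + 1) s := by
    intro t
    have : ∀ᶠ s in 𝓝 t, |s| < |t| + 1 :=
      (isOpen_lt continuous_abs continuous_const).mem_nhds (show |t| < |t| + 1 from lt_add_one _)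
    filter_upwards [this] with s hs
    exact hagree _ _ _ (by linarith) (by linarith)
  refine ⟨fun s => Γ (|s| + 1) s, isGeodesic_iff.2 fun t => ?_, hΓ0 _, ?_⟩
  · refine (hΓ (|t| + 2) t ?_).congr (hloc' t)
    exact abs_lt.1 (by linarith)
  · rw [← velocity_congr (hloc' 0)]
    exact hΓ1 _

theorem geodesic_spec [T2Space M] [CompactSpace M] (x : M) (v : TangentSpace (𝓡 d) x) :
    IsGeodesic (d := d) (geodesic (⟨x, v⟩ : TangentBundle (𝓡 d) M)) ∧
      geodesic (⟨x, v⟩ : TangentBundle (𝓡 d) M) 0 = x ∧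
      velocity (geodesic (⟨x, v⟩ : TangentBundle (𝓡 d) M)) 0 = v := by
  have hex : ∃ γ : ℝ → M, IsGeodesic (d := d) γ ∧
      (⟨γ 0, mfderiv 𝓘(ℝ, ℝ) (𝓡 d) γ 0 (1 : ℝ)⟩ : TangentBundle (𝓡 d) M) = ⟨x, v⟩ := by
    obtain ⟨γ, hγ, h0, h1⟩ := exists_isGeodesic (d := d) x v
    exact ⟨γ, hγ, Bundle.TotalSpace.ext h0 (heq_of_eq h1)⟩
  have heq : geodesic (⟨x, v⟩ : TangentBundle (𝓡 d) M) = hex.choose := by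
    funext t
    rw [geodesic, dif_pos hex]
  rw [heq]
  obtain ⟨h1, h2⟩ := hex.choose_spec
  refine ⟨h1, congrArg Bundle.TotalSpace.proj h2, ?_⟩
  have h3 : ∀ z z' : TangentBundle (𝓡 d) M, z = z' →
      (z.2 : EuclideanSpace ℝ (Fin d)) = (z'.2 : EuclideanSpace ℝ (Fin d)) := by
    rintro z _ rfl; rfl
  exact h3 _ _ h2

/-- A family of geodesics whose position and velocity at time `a` depend smoothly on the parameter
is smooth for nearby times. -/
theorem IsLocalGeodesicFlow.contMDiffAt [T2Space M] {X : Type*} [NormedAddCommGroup X]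
    [NormedSpace ℝ X] {U : Set M} {R ε : ℝ}
    {Y : EuclideanSpace ℝ (Fin d) × EuclideanSpace ℝ (Fin d) → ℝ → EuclideanSpace ℝ (Fin d)}
    (h : IsLocalGeodesicFlow c U R ε Y) {Γ : X → ℝ → M} (hΓ : ∀ ξ, IsGeodesic (d := d) (Γ ξ))
    {a : ℝ} {ξ₀ : X} (h0 : Γ ξ₀ a ∈ U) (hR : speedSq (d := d) (Γ ξ₀) a < R)
    (hcont : ContinuousAt (fun ξ => Γ ξ a) ξ₀)
    (h1 : ContDiffAt ℝ ∞ (fun ξ => c (Γ ξ a)) ξ₀)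
    (h2 : ContDiffAt ℝ ∞ (fun ξ => deriv (c ∘ Γ ξ) a) ξ₀) {t : ℝ} (ht : t ∈ ball a ε) :
    ContMDiffAt 𝓘(ℝ, ℝ × X) (𝓡 d) ∞ (fun p : ℝ × X => Γ p.2 p.1) (t, ξ₀) := by
  have hε : 0 < ε := pos_of_mem_ball ht
  have hc := h.mem_atlas
  have hg : ∀ ξ, Γ ξ a ∈ U → IsChartGeodesicAt c (Γ ξ) a := fun ξ hξ =>
    (isGeodesic_iff.1 (hΓ ξ) a).isChartGeodesicAt hc (h.subset hξ)
  have hU : ∀ᶠ ξ in 𝓝 ξ₀, Γ ξ a ∈ U := hcont.eventually_mem (h.isOpen.mem_nhds h0)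
  have hR' : ∀ᶠ ξ in 𝓝 ξ₀, speedSq (d := d) (Γ ξ) a < R := by
    have hm : ContinuousAt (chartMetric c) (c (Γ ξ₀ a)) :=
      ((contDiffOn_chartMetric hc).contDiffAt
        (c.open_target.mem_nhds (c.map_source (h.subset h0)))).continuousAt
    have h3 : ContinuousAt (fun ξ => chartMetric c (c (Γ ξ a)) (deriv (c ∘ Γ ξ) a)
        (deriv (c ∘ Γ ξ) a)) ξ₀ :=
      ((hm.comp (f := fun ξ => c (Γ ξ a)) h1.continuousAt).clm_apply h2.continuousAt).clm_apply
        h2.continuousAt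
    rw [(hg ξ₀ h0).speedSq_eq hc] at hR
    filter_upwards [h3.eventually_lt continuousAt_const hR, hU] with ξ hξ hξ'
    rwa [(hg ξ hξ').speedSq_eq hc]
  have key : ∀ ξ, Γ ξ a ∈ U → speedSq (d := d) (Γ ξ) a < R → ∀ s ∈ ball a ε,
      Γ ξ s = c.symm (Y (c (Γ ξ a), deriv (c ∘ Γ ξ) a) (s - a)) := by
    intro ξ hξ hξR s hs
    obtain ⟨k1, k2, k3⟩ := h.exists_isGeodesicAt hε hξ hξR a
    have e1 : deriv (c ∘ Γ ξ) a = components c (Γ ξ a) (SphericalMean.velocity (Γ ξ) a) :=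
      (hg ξ hξ).deriv_eq hc
    rw [e1]
    refine eqOn_of_isGeodesicAt (γ := Γ ξ) (convex_ball a ε).isPreconnected
      (fun s _ => isGeodesic_iff.1 (hΓ ξ) s) k1 (mem_ball_self hε) ?_ hs
    exact (isGeodesic_iff.1 (hΓ ξ) a).eventuallyEq (k1 a (mem_ball_self hε)) k2.symm k3.symm
  have hw : chartMetric c (c (Γ ξ₀ a)) (deriv (c ∘ Γ ξ₀) a) (deriv (c ∘ Γ ξ₀) a) < R := by
    rwa [(hg ξ₀ h0).speedSq_eq hc] at hR
  have hta : |t - a| < ε := by rwa [mem_ball, Real.dist_eq] at ht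
  have hY := h.smooth _ h0 _ hw (t - a) hta
  have hF : ContDiffAt ℝ ∞ (fun p : ℝ × X =>
      Y (c (Γ p.2 a), deriv (c ∘ Γ p.2) a) (p.1 - a)) (t, ξ₀) := by
    have e1 : ContDiffAt ℝ ∞ (fun p : ℝ × X => c (Γ p.2 a)) (t, ξ₀) :=
      ContDiffAt.comp (t, ξ₀) (g := fun ξ => c (Γ ξ a)) h1 contDiffAt_snd
    have e2 : ContDiffAt ℝ ∞ (fun p : ℝ × X => deriv (c ∘ Γ p.2) a) (t, ξ₀) :=
      ContDiffAt.comp (t, ξ₀) (g := fun ξ => deriv (c ∘ Γ ξ) a) h2 contDiffAt_snd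
    exact ContDiffAt.comp (t, ξ₀) (g := fun p : (EuclideanSpace ℝ (Fin d) ×
      EuclideanSpace ℝ (Fin d)) × ℝ => Y p.1 p.2) hY
      ((e1.prodMk e2).prodMk (contDiffAt_fst.sub contDiffAt_const))
  have hsymm := contMDiffAt_symm_of_mem_maximalAtlas hc (h.target _ h0 _ hw (t - a) hta)
  refine (hsymm.comp (t, ξ₀) hF.contMDiffAt).congr_of_eventuallyEq ?_
  have hev : ∀ᶠ p : ℝ × X in 𝓝 (t, ξ₀), p.1 ∈ ball a ε ∧ Γ p.2 a ∈ U ∧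
      speedSq (d := d) (Γ p.2) a < R :=
    (((continuousAt_fst : Tendsto Prod.fst (𝓝 (t, ξ₀)) (𝓝 t))).eventually
      (isOpen_ball.mem_nhds ht)).and
      ((continuousAt_snd : Tendsto Prod.snd (𝓝 (t, ξ₀)) (𝓝 ξ₀)).eventually (hU.and hR'))
  filter_upwards [hev] with p hp
  exact key p.2 hp.2.1 hp.2.2 p.1 hp.1

/-- A family of geodesics from a fixed point, with initial velocity linear in the parameter, is
smooth. -/
theorem contMDiff_geodesic_family [T2Space M] [CompactSpace M] {X : Type*} [NormedAddCommGroup X]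
    [NormedSpace ℝ X] {Γ : X → ℝ → M} (hΓ : ∀ ξ, IsGeodesic (d := d) (Γ ξ)) {x : M}
    (h0 : ∀ ξ, Γ ξ 0 = x) (L : X →L[ℝ] EuclideanSpace ℝ (Fin d))
    (h1 : ∀ ξ, velocity (Γ ξ) 0 = L ξ) :
    ContMDiff 𝓘(ℝ, ℝ × X) (𝓡 d) ∞ (fun p : ℝ × X => Γ p.2 p.1) := by
  rintro ⟨t, ξ₀⟩
  set R := |tangentInner x (L ξ₀) (L ξ₀)| + 1
  obtain ⟨ε, hε, hflow⟩ := exists_uniform_isLocalGeodesicFlow (M := M) (d := d) (R := R)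
    (by positivity)
  have hR : ∀ a, speedSq (d := d) (Γ ξ₀) a < R := by
    intro a
    rw [speedSq_eq_of_isGeodesicAt isOpen_univ isPreconnected_univ
      (fun s _ => isGeodesic_iff.1 (hΓ ξ₀) s) (mem_univ a) (mem_univ 0), speedSq, h0, h1]
    exact (le_abs_self _).trans_lt (lt_add_one _)
  have hstep : ∀ n : ℕ, ∀ t : ℝ, |t| < (n + 1) * ε →
      ContMDiffAt 𝓘(ℝ, ℝ × X) (𝓡 d) ∞ (fun p : ℝ × X => Γ p.2 p.1) (t, ξ₀) := by
    intro n
    induction n with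
    | zero =>
      intro t ht
      obtain ⟨c, U, Y, hU, hf⟩ := hflow x
      refine hf.contMDiffAt hΓ (a := 0) (by rwa [h0]) (hR 0) ?_ ?_ ?_ (by simpa using ht)
      · simp only [h0]
        exact continuousAt_const
      · simp only [h0]
        exact contDiffAt_const
      · have : ∀ ξ, deriv (c ∘ Γ ξ) 0 = mfderiv (𝓡 d) (𝓡 d) c x (L ξ) := by
          intro ξ
          have e := ((isGeodesic_iff.1 (hΓ ξ) 0).isChartGeodesicAt hf.mem_atlas
            (by rw [h0]; exact hf.subset hU)).deriv_eq hf.mem_atlas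
          have e' : deriv (c ∘ Γ ξ) 0 = components c (Γ ξ 0) (velocity (Γ ξ) 0) := e
          rw [e', h0, h1]
          rfl
        let A : EuclideanSpace ℝ (Fin d) →L[ℝ] EuclideanSpace ℝ (Fin d) :=
          mfderiv (𝓡 d) (𝓡 d) c x
        have this' : (fun ξ => deriv (c ∘ Γ ξ) 0) = fun ξ => A (L ξ) := funext this
        rw [this']
        exact (A.comp L).contDiff.contDiffAt
    | succ n ih =>
      intro t ht
      -- `a` is within reach of the previous case, and `t` is at distance less than `ε` from `a`
      set a : ℝ := t * ((n + 1) / (n + 2)) with ha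
      have hn : (0 : ℝ) < n + 2 := by positivity
      have hta : t - a = t / (n + 2) := by rw [ha]; field_simp; ring
      have ht' : |t| / (n + 2) < ε := by
        rw [div_lt_iff₀ hn]
        push_cast at ht
        linarith
      have haε : |a| < (n + 1) * ε := by
        rw [ha, abs_mul, abs_of_nonneg (by positivity : (0 : ℝ) ≤ (n + 1) / (n + 2))]
        calc |t| * ((n + 1) / (n + 2)) = (n + 1) * (|t| / (n + 2)) := by ring
          _ < _ := by gcongr
      have hsm := ih a haε
      obtain ⟨c, U, Y, hU, hf⟩ := hflow (Γ ξ₀ a)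
      have hc := hf.mem_atlas
      have hcE : ContDiffAt ℝ ∞ (fun p : ℝ × X => c (Γ p.2 p.1)) (a, ξ₀) :=
        ((contMDiffAt_of_mem_maximalAtlas hc (hf.subset hU)).comp (a, ξ₀) hsm).contDiffAt
      have hpair : ContDiffAt ℝ ∞ (fun ξ : X => (a, ξ)) ξ₀ := contDiffAt_const.prodMk contDiffAt_id
      refine hf.contMDiffAt hΓ (a := a) hU (hR a) ?_ ?_ ?_ ?_
      · exact hsm.continuousAt.comp (f := fun ξ : X => (a, ξ)) hpair.continuousAt
      · exact hcE.comp ξ₀ hpair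
      · have hd : ContDiffAt ℝ ∞ (fun ξ : X => fderiv ℝ (fun p : ℝ × X => c (Γ p.2 p.1)) (a, ξ)
            ((1 : ℝ), (0 : X))) ξ₀ :=
          ((hcE.fderiv_right (m := ∞) le_rfl).comp ξ₀ hpair).clm_apply contDiffAt_const
        refine hd.congr_of_eventuallyEq ?_
        have hdiff : ∀ᶠ p in 𝓝 (a, ξ₀), DifferentiableAt ℝ (fun p : ℝ × X => c (Γ p.2 p.1)) p :=
          ((hcE.of_le (m := 1) (by simp)).eventually (by simp)).mono
            fun p hp => hp.differentiableAt (by simp)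
        filter_upwards [hpair.continuousAt.eventually hdiff] with ξ hξ
        have e1 : HasDerivAt (fun s : ℝ => (s, ξ)) ((1 : ℝ), (0 : X)) a :=
          (hasDerivAt_id a).prodMk (hasDerivAt_const a ξ)
        exact (hξ.hasFDerivAt.comp_hasDerivAt a e1).deriv
      · rw [mem_ball, Real.dist_eq, hta, abs_div, abs_of_pos hn]
        exact ht'
  obtain ⟨n, hn⟩ := exists_nat_gt (|t| / ε)
  rw [div_lt_iff₀ hε] at hn
  exact hstep n t (by nlinarith)

end Existence

/-! ### Directional derivatives -/

section DirectionalDerivative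

variable {X F : Type*} [NormedAddCommGroup X] [NormedSpace ℝ X] [NormedAddCommGroup F]
  [NormedSpace ℝ F]

/-- The derivative of `f` in the direction `v`. -/
def dirDeriv (v : X) (f : X → F) (x : X) : F := fderiv ℝ f x v

theorem contDiffAt_dirDeriv {f : X → F} {x : X} (hf : ContDiffAt ℝ ∞ f x) (v : X) :
    ContDiffAt ℝ ∞ (dirDeriv v f) x :=
  (hf.fderiv_right (m := ∞) le_rfl).clm_apply contDiffAt_const

theorem dirDeriv_dirDeriv {f : X → F} {x : X} (hf : ContDiffAt ℝ ∞ f x) (v w : X) :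
    dirDeriv w (dirDeriv v f) x = fderiv ℝ (fderiv ℝ f) x w v := by
  have h1 : DifferentiableAt ℝ (fderiv ℝ f) x :=
    (hf.fderiv_right (m := ∞) le_rfl).differentiableAt (by simp)
  have h2 := h1.hasFDerivAt.clm_apply (hasFDerivAt_const v x)
  have h3 : fderiv ℝ (dirDeriv v f) x = _ := h2.fderiv
  rw [dirDeriv, h3]
  simp

theorem dirDeriv_comm {f : X → F} {x : X} (hf : ContDiffAt ℝ ∞ f x) (v w : X) :
    dirDeriv w (dirDeriv v f) x = dirDeriv v (dirDeriv w f) x := by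
  rw [dirDeriv_dirDeriv hf, dirDeriv_dirDeriv hf]
  exact hf.isSymmSndFDerivAt (by simpa using ENat.LEInfty.out) w v

theorem hasDerivAt_fst {f : ℝ × X → F} {t : ℝ} {ξ : X} (hf : DifferentiableAt ℝ f (t, ξ)) :
    HasDerivAt (fun s => f (s, ξ)) (dirDeriv (1, 0) f (t, ξ)) t :=
  hf.hasFDerivAt.comp_hasDerivAt t ((hasDerivAt_id t).prodMk (hasDerivAt_const t ξ))

theorem hasDerivAt_line {f : X → F} {x : X} (hf : DifferentiableAt ℝ f x) (v : X) :
    HasDerivAt (fun r : ℝ => f (x + r • v)) (dirDeriv v f x) 0 := by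
  have h1 : HasDerivAt (fun r : ℝ => x + r • v) v 0 := by
    simpa using ((hasDerivAt_id (0 : ℝ)).smul_const v).const_add x
  exact HasFDerivAt.comp_hasDerivAt_of_eq (x := (0 : ℝ)) hf.hasFDerivAt h1 (by simp)

end DirectionalDerivative

/-! ### Variations through geodesics -/

section Variation

variable {V : Type*} [NormedAddCommGroup V] [NormedSpace ℝ V] {X : Type*} [NormedAddCommGroup X]
  [NormedSpace ℝ X] {U : Set V} {g : V → V →L[ℝ] V →L[ℝ] ℝ} {Γ : V → V →L[ℝ] V →L[ℝ] V}
  {H : ℝ × X → V} {p : ℝ × X} {t : ℝ} {ξ k : X}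

/-- In coordinates, `H (t, ξ)` is, near `p`, a smooth family of geodesics with parameter `ξ`. -/
structure IsGeodesicVariation (U : Set V) (Γ : V → V →L[ℝ] V →L[ℝ] V) (H : ℝ × X → V)
    (p : ℝ × X) : Prop where
  mem : H p ∈ U
  eventually_smooth : ∀ᶠ q in 𝓝 p, ContDiffAt ℝ ∞ H q
  eqn : ∀ᶠ q in 𝓝 p, dirDeriv (1, 0) (dirDeriv (1, 0) H) q =
    -Γ (H q) (dirDeriv (1, 0) H q) (dirDeriv (1, 0) H q)

/-- The covariant derivative in the direction of time of the variation field `∂H/∂k`. -/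
def covariantVariation (Γ : V → V →L[ℝ] V →L[ℝ] V) (H : ℝ × X → V) (k : X) (p : ℝ × X) : V :=
  dirDeriv (0, k) (dirDeriv (1, 0) H) p + Γ (H p) (dirDeriv (1, 0) H p) (dirDeriv (0, k) H p)

theorem IsGeodesicVariation.smooth (h : IsGeodesicVariation U Γ H p) : ContDiffAt ℝ ∞ H p :=
  h.eventually_smooth.self_of_nhds

theorem IsGeodesicVariation.hasDerivAt_velocity (h : IsGeodesicVariation U Γ H (t, ξ)) :
    HasDerivAt (fun s => dirDeriv (1, 0) H (s, ξ))
      (-Γ (H (t, ξ)) (dirDeriv (1, 0) H (t, ξ)) (dirDeriv (1, 0) H (t, ξ))) t := by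
  have h1 := hasDerivAt_fst ((contDiffAt_dirDeriv h.smooth (1, 0)).differentiableAt (by simp))
  rwa [h.eqn.self_of_nhds] at h1

theorem IsGeodesicVariation.hasDerivAt_variation (h : IsGeodesicVariation U Γ H (t, ξ)) (k : X) :
    HasDerivAt (fun s => dirDeriv (0, k) H (s, ξ))
      (dirDeriv (0, k) (dirDeriv (1, 0) H) (t, ξ)) t := by
  rw [dirDeriv_comm h.smooth]
  exact hasDerivAt_fst ((contDiffAt_dirDeriv h.smooth (0, k)).differentiableAt (by simp))

namespace IsCoordMetric

variable (hg : IsCoordMetric U g Γ)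
include hg

theorem hasDerivAt_covariantVariation (h : IsGeodesicVariation U Γ H (t, ξ)) (k : X) :
    HasDerivAt (fun s => covariantVariation Γ H k (s, ξ))
      (-coordCurvature Γ (H (t, ξ)) (dirDeriv (0, k) H (t, ξ)) (dirDeriv (1, 0) H (t, ξ))
          (dirDeriv (1, 0) H (t, ξ))
        - Γ (H (t, ξ)) (dirDeriv (1, 0) H (t, ξ)) (covariantVariation Γ H k (t, ξ))) t := by
  have hT := contDiffAt_dirDeriv h.smooth (1, 0)
  have hH := (h.smooth.differentiableAt (by simp)).hasFDerivAt
  have hT' := (hT.differentiableAt (by simp)).hasFDerivAt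
  refine hg.hasDerivAt_covariant (y := fun s => H (s, ξ)) h.mem
    (hasDerivAt_fst (h.smooth.differentiableAt (by simp))) h.hasDerivAt_velocity
    (h.hasDerivAt_variation k) ?_
  have h1 := hasDerivAt_fst ((contDiffAt_dirDeriv hT (0, k)).differentiableAt (by simp))
  refine h1.congr_deriv ?_
  rw [dirDeriv_comm hT]
  have h2 := ((((hg.hasFDerivAt_christoffel h.mem).comp (t, ξ) hH).clm_apply hT').clm_apply
    hT').neg
  have h3 := (h2.congr_of_eventuallyEq h.eqn).fderiv
  have h4 : dirDeriv (0, k) (dirDeriv (1, 0) (dirDeriv (1, 0) H)) (t, ξ) =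
    fderiv ℝ (dirDeriv (1, 0) (dirDeriv (1, 0) H)) (t, ξ) (0, k) := rfl
  have h5 : ∀ v, fderiv ℝ (dirDeriv (1, 0) H) (t, ξ) v = dirDeriv v (dirDeriv (1, 0) H) (t, ξ) :=
    fun _ => rfl
  have h6 : ∀ v, fderiv ℝ H (t, ξ) v = dirDeriv v H (t, ξ) := fun _ => rfl
  rw [h4, h3]
  simp [h5, h6, two_smul]
  rw [hg.christoffel_symm h.mem (dirDeriv (0, k) (dirDeriv (1, 0) H) (t, ξ))]
  abel

/-- The first variation formula. -/
theorem hasDerivAt_inner_velocity_variation (h : IsGeodesicVariation U Γ H (t, ξ)) (k : X) :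
    HasDerivAt (fun s => g (H (s, ξ)) (dirDeriv (1, 0) H (s, ξ)) (dirDeriv (0, k) H (s, ξ)))
      ((1 / 2) * deriv (fun r : ℝ => g (H (t, ξ + r • k)) (dirDeriv (1, 0) H (t, ξ + r • k))
        (dirDeriv (1, 0) H (t, ξ + r • k))) 0) t := by
  have hT := (contDiffAt_dirDeriv h.smooth (1, 0)).differentiableAt (by simp)
  have hH := h.smooth.differentiableAt (by simp)
  have e0 : ∀ r : ℝ, (t, ξ) + r • ((0 : ℝ), k) = (t, ξ + r • k) := fun r => by simp
  have h1 := hasDerivAt_line hH ((0 : ℝ), k)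
  have h2 := hasDerivAt_line hT ((0 : ℝ), k)
  simp only [e0] at h1 h2
  have h3 := hg.hasDerivAt_inner (by simpa using h.mem) h1 h2 h2
  have h4 := hg.hasDerivAt_inner (y := fun s => H (s, ξ)) h.mem (hasDerivAt_fst hH)
    h.hasDerivAt_velocity (h.hasDerivAt_variation k)
  refine h4.congr_deriv ?_
  rw [h3.deriv]
  simp only [neg_add_cancel, map_zero, zero_apply, zero_add, zero_smul, add_zero]
  rw [hg.symm _ h.mem (dirDeriv (1, 0) H (t, ξ)) (_ + _),
    hg.symm _ h.mem (dirDeriv (1, 0) H (t, ξ)) (_ + _), hg.christoffel_symm h.mem]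
  ring

theorem hasDerivAt_inner_variation (h : IsGeodesicVariation U Γ H (t, ξ)) (k : X) :
    HasDerivAt (fun s => g (H (s, ξ)) (dirDeriv (0, k) H (s, ξ)) (dirDeriv (0, k) H (s, ξ)))
      (2 * g (H (t, ξ)) (covariantVariation Γ H k (t, ξ)) (dirDeriv (0, k) H (t, ξ))) t := by
  have h4 := hg.hasDerivAt_inner (y := fun s => H (s, ξ)) h.mem
    (hasDerivAt_fst (h.smooth.differentiableAt (by simp)))
    (h.hasDerivAt_variation k) (h.hasDerivAt_variation k)
  refine h4.congr_deriv ?_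
  rw [hg.symm _ h.mem (dirDeriv (0, k) H (t, ξ)) (_ + _), covariantVariation]
  ring

variable (hK : ∀ v w, g (H (t, ξ)) (coordCurvature Γ (H (t, ξ)) v w w) v =
  -(g (H (t, ξ)) v v * g (H (t, ξ)) w w - g (H (t, ξ)) v w ^ 2))
  (hT1 : g (H (t, ξ)) (dirDeriv (1, 0) H (t, ξ)) (dirDeriv (1, 0) H (t, ξ)) = 1)
  (hTJ : g (H (t, ξ)) (dirDeriv (1, 0) H (t, ξ)) (dirDeriv (0, k) H (t, ξ)) = 0)
include hK hT1 hTJ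

/-- The Jacobi equation `D²J = J` for normal variations in curvature `-1`. -/
theorem hasDerivAt_covariantVariation_of_const (h : IsGeodesicVariation U Γ H (t, ξ)) :
    HasDerivAt (fun s => covariantVariation Γ H k (s, ξ)) (dirDeriv (0, k) H (t, ξ)
        - Γ (H (t, ξ)) (dirDeriv (1, 0) H (t, ξ)) (covariantVariation Γ H k (t, ξ))) t := by
  have h1 := hg.hasDerivAt_covariantVariation h k
  rw [hg.symm _ h.mem] at hTJ
  rwa [hg.inner_curvature_of_const h.mem hK hT1 hTJ, neg_neg] at h1

theorem hasDerivAt_inner_covariantVariation (h : IsGeodesicVariation U Γ H (t, ξ)) :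
    HasDerivAt (fun s => g (H (s, ξ)) (covariantVariation Γ H k (s, ξ)) (dirDeriv (0, k) H (s, ξ)))
      (g (H (t, ξ)) (dirDeriv (0, k) H (t, ξ)) (dirDeriv (0, k) H (t, ξ)) +
        g (H (t, ξ)) (covariantVariation Γ H k (t, ξ)) (covariantVariation Γ H k (t, ξ))) t := by
  have h4 := hg.hasDerivAt_inner (y := fun s => H (s, ξ)) h.mem
    (hasDerivAt_fst (h.smooth.differentiableAt (by simp)))
    (hg.hasDerivAt_covariantVariation_of_const hK hT1 hTJ h) (h.hasDerivAt_variation k)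
  refine h4.congr_deriv ?_
  rw [sub_add_cancel]
  rfl

theorem hasDerivAt_inner_covariantVariation_self (h : IsGeodesicVariation U Γ H (t, ξ)) :
    HasDerivAt (fun s => g (H (s, ξ)) (covariantVariation Γ H k (s, ξ))
        (covariantVariation Γ H k (s, ξ)))
      (2 * g (H (t, ξ)) (covariantVariation Γ H k (t, ξ)) (dirDeriv (0, k) H (t, ξ))) t := by
  have h4 := hg.hasDerivAt_inner (y := fun s => H (s, ξ)) h.mem
    (hasDerivAt_fst (h.smooth.differentiableAt (by simp)))
    (hg.hasDerivAt_covariantVariation_of_const hK hT1 hTJ h)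
    (hg.hasDerivAt_covariantVariation_of_const hK hT1 hTJ h)
  refine h4.congr_deriv ?_
  rw [sub_add_cancel, hg.symm _ h.mem (dirDeriv (0, k) H (t, ξ))]
  ring

end IsCoordMetric

end Variation

/-- A solution of `f'' = 4 f` with zero initial data vanishes. -/
theorem eq_zero_of_hasDerivAt_four_mul {f f' : ℝ → ℝ} (hf : ∀ t, HasDerivAt f (f' t) t)
    (hf' : ∀ t, HasDerivAt f' (4 * f t) t) (h0 : f 0 = 0) (h1 : f' 0 = 0) (t : ℝ) : f t = 0 := by
  -- `f'' - 4 f` factors as `(∂ + 2) (∂ - 2) f`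
  have hA : ∀ t, f' t = 2 * f t := by
    intro t
    have hd : ∀ s, HasDerivAt (fun s => Real.exp (2 * s) * (f' s - 2 * f s)) 0 s := by
      intro s
      have e := ((hasDerivAt_id s).const_mul 2).exp
      refine (e.mul ((hf' s).sub ((hf s).const_mul 2))).congr_deriv ?_
      simp; ring
    have := is_const_of_deriv_eq_zero (fun s => (hd s).differentiableAt) (fun s => (hd s).deriv) t 0
    simp [h0, h1] at this
    linarith
  have hd : ∀ s, HasDerivAt (fun s => Real.exp (-2 * s) * f s) 0 s := by
    intro s
    have e := ((hasDerivAt_id s).const_mul (-2)).exp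
    refine (e.mul (hf s)).congr_deriv ?_
    simp [hA s]
    ring
  have := is_const_of_deriv_eq_zero (fun s => (hd s).differentiableAt) (fun s => (hd s).deriv) t 0
  simpa [h0] using this

/-- The system `a' = 2b`, `b' = a + c`, `c' = 2b` satisfied by the inner products of a Jacobi field
and of its covariant derivative. The functions `b` and `c` are only given locally, as they are computed
in charts; the argument eliminates them, using that `a'' - 4 a` is constant. -/
theorem eq_sinh_sq_of_local_system {a : ℝ → ℝ} {K : ℝ}
    (h : ∀ t, ∃ b c : ℝ → ℝ, (∀ᶠ s in 𝓝 t, HasDerivAt a (2 * b s) s ∧ HasDerivAt b (a s + c s) s ∧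
      HasDerivAt c (2 * b s) s) ∧ (t = 0 → a 0 = 0 ∧ b 0 = 0 ∧ c 0 = K)) (t : ℝ) :
    a t = K * Real.sinh t ^ 2 := by
  have hloc : ∀ t, HasDerivAt a (deriv a t) t ∧ HasDerivAt (deriv a) (deriv (deriv a) t) t ∧
      HasDerivAt (fun s => deriv (deriv a) s - 4 * a s) 0 t := by
    intro t
    obtain ⟨b, c, hbc, -⟩ := h t
    have e1 : deriv a =ᶠ[𝓝 t] fun s => 2 * b s := by
      filter_upwards [hbc] with s hs using hs.1.deriv
    have e2 : deriv (deriv a) =ᶠ[𝓝 t] fun s => 2 * (a s + c s) := by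
      filter_upwards [hbc, e1.eventuallyEq_nhds] with s hs he
      rw [he.deriv_eq]
      exact (hs.2.1.const_mul 2).deriv
    obtain ⟨h1, h2, h3⟩ := hbc.self_of_nhds
    refine ⟨h1.differentiableAt.hasDerivAt, ?_, ?_⟩
    · exact ((h2.const_mul 2).congr_of_eventuallyEq e1).differentiableAt.hasDerivAt
    · have h4 := (((h1.add h3).const_mul 2).congr_of_eventuallyEq e2).sub (h1.const_mul 4)
      refine h4.congr_deriv ?_
      ring
  obtain ⟨b, c, hbc, h0⟩ := h 0
  obtain ⟨ha0, hb0, hc0⟩ := h0 rfl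
  have e1 : deriv a =ᶠ[𝓝 0] fun s => 2 * b s := by
    filter_upwards [hbc] with s hs using hs.1.deriv
  have e2 : deriv (deriv a) 0 = 2 * (a 0 + c 0) := by
    rw [e1.deriv_eq]
    exact (hbc.self_of_nhds.2.1.const_mul 2).deriv
  have hconst : ∀ t, deriv (deriv a) t = 4 * a t + 2 * K := by
    intro t
    have := is_const_of_deriv_eq_zero (fun s => (hloc s).2.2.differentiableAt)
      (fun s => (hloc s).2.2.deriv) t 0
    rw [e2, ha0, hc0] at this
    linarith
  have := eq_zero_of_hasDerivAt_four_mul (f := fun s => a s - K * Real.sinh s ^ 2)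
    (f' := fun s => deriv a s - K * (2 * Real.sinh s * Real.cosh s)) ?_ ?_ (by simp [ha0]) ?_ t
  · linarith
  · intro s
    refine ((hloc s).1.sub (((Real.hasDerivAt_sinh s).pow 2).const_mul K)).congr_deriv ?_
    simp
  · intro s
    refine ((hloc s).2.1.sub ((((Real.hasDerivAt_sinh s).const_mul 2).mul
      (Real.hasDerivAt_cosh s)).const_mul K)).congr_deriv ?_
    rw [hconst]
    linear_combination -(2 * K) * Real.cosh_sq s
  · simp [e1.eq_of_nhds, hb0]

/-! ### Geodesic polar coordinates in constant curvature -/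

section Polar

variable {d : ℕ} {M : Type*} [TopologicalSpace M] [ChartedSpace (EuclideanSpace ℝ (Fin d)) M]
  [IsManifold (𝓡 d) ∞ M] [Bundle.RiemannianBundle (fun x : M => TangentSpace (𝓡 d) x)]
  {c c' : OpenPartialHomeomorph M (EuclideanSpace ℝ (Fin d))}
  {X : Type*} [NormedAddCommGroup X] [NormedSpace ℝ X]

/-- The pullback to a vector space of the Riemannian metric of `M` under the map `f`. -/
def pullbackInner (f : X → M) (p u v : X) : ℝ :=
  tangentInner (d := d) (f p) (mfderiv 𝓘(ℝ, X) (𝓡 d) f p u) (mfderiv 𝓘(ℝ, X) (𝓡 d) f p v)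

theorem pullbackInner_add_left (f : X → M) (p u u' v : X) : pullbackInner (d := d) f p (u + u') v =
    pullbackInner (d := d) f p u v + pullbackInner (d := d) f p u' v := by
  exact (congrArg (fun w => inner ℝ w (mfderiv 𝓘(ℝ, X) (𝓡 d) f p v))
    (map_add (mfderiv 𝓘(ℝ, X) (𝓡 d) f p) u u')).trans (inner_add_left _ _ _)

theorem pullbackInner_smul_left (f : X → M) (p u v : X) (r : ℝ) :
    pullbackInner (d := d) f p (r • u) v = r * pullbackInner (d := d) f p u v := by
  exact (congrArg (fun w => inner ℝ w (mfderiv 𝓘(ℝ, X) (𝓡 d) f p v))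
    (map_smul (mfderiv 𝓘(ℝ, X) (𝓡 d) f p) r u)).trans (real_inner_smul_left _ _ _)

theorem pullbackInner_comm (f : X → M) (p u v : X) : pullbackInner (d := d) f p u v =
    pullbackInner (d := d) f p v u :=
  real_inner_comm _ _

theorem pullbackInner_add_right (f : X → M) (p u v v' : X) : pullbackInner (d := d) f p u (v + v') =
    pullbackInner (d := d) f p u v + pullbackInner (d := d) f p u v' := by
  rw [pullbackInner_comm, pullbackInner_add_left, pullbackInner_comm _ _ v,
    pullbackInner_comm _ _ v']

theorem pullbackInner_smul_right (f : X → M) (p u v : X) (r : ℝ) :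
    pullbackInner (d := d) f p u (r • v) = r * pullbackInner (d := d) f p u v := by
  rw [pullbackInner_comm, pullbackInner_smul_left, pullbackInner_comm]

theorem pullbackInner_eq (hc : c ∈ IsManifold.maximalAtlas (𝓡 d) ∞ M) {f : X → M} {p : X}
    (hf : ContMDiffAt 𝓘(ℝ, X) (𝓡 d) ∞ f p) (hp : f p ∈ c.source) (u v : X) :
    pullbackInner (d := d) f p u v =
      chartMetric c (c (f p)) (dirDeriv u (c ∘ f) p) (dirDeriv v (c ∘ f) p) := by
  have h1 : ContDiffAt ℝ ∞ (c ∘ f) p :=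
    ((contMDiffAt_of_mem_maximalAtlas hc hp).comp p hf).contDiffAt
  refine tangentInner_mfderiv (h := c ∘ f) hc (c.map_source hp) (h1.differentiableAt (by simp)) ?_
    u v
  filter_upwards [hf.continuousAt.eventually_mem (c.open_source.mem_nhds hp)] with q hq
  exact (c.left_inv hq).symm

/-- `Γ ξ` is the geodesic from `x` whose initial velocity is the image of `ξ` under the linear
isometry `L` from `ℝᵈ` onto the tangent space at `x`. -/
structure IsPolarFamily (Γ : EuclideanSpace ℝ (Fin d) → ℝ → M) (x : M)
    (L : EuclideanSpace ℝ (Fin d) →L[ℝ] EuclideanSpace ℝ (Fin d)) : Prop where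
  isGeodesic : ∀ ξ, IsGeodesic (d := d) (Γ ξ)
  init : ∀ ξ, Γ ξ 0 = x
  velocity : ∀ ξ, velocity (Γ ξ) 0 = L ξ
  isometry : ∀ u v, tangentInner x (L u) (L v) = inner ℝ u v

/-- The map `(t, ξ) ↦ exp_x (t L ξ)` defined by a family of geodesics. -/
def polarMap (Γ : X → ℝ → M) (p : ℝ × X) : M := Γ p.2 p.1

variable [IsContMDiffRiemannianBundle (𝓡 d) ∞ (EuclideanSpace ℝ (Fin d))
    (fun x : M => TangentSpace (𝓡 d) x)] [T2Space M] [CompactSpace M]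

namespace IsPolarFamily

variable {Γ : EuclideanSpace ℝ (Fin d) → ℝ → M} {x : M}
  {L : EuclideanSpace ℝ (Fin d) →L[ℝ] EuclideanSpace ℝ (Fin d)}
  {ξ k : EuclideanSpace ℝ (Fin d)} {t : ℝ}

theorem contMDiff (h : IsPolarFamily Γ x L) :
    ContMDiff 𝓘(ℝ, ℝ × EuclideanSpace ℝ (Fin d)) (𝓡 d) ∞ (polarMap Γ) :=
  contMDiff_geodesic_family h.isGeodesic h.init L h.velocity

theorem contDiffAt (h : IsPolarFamily Γ x L) (hc : c ∈ IsManifold.maximalAtlas (𝓡 d) ∞ M)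
    {p : ℝ × EuclideanSpace ℝ (Fin d)} (hp : polarMap Γ p ∈ c.source) :
    ContDiffAt ℝ ∞ (c ∘ polarMap Γ) p :=
  ((contMDiffAt_of_mem_maximalAtlas hc hp).comp p h.contMDiff.contMDiffAt).contDiffAt

theorem dirDeriv_time (h : IsPolarFamily Γ x L) (hc : c ∈ IsManifold.maximalAtlas (𝓡 d) ∞ M)
    {p : ℝ × EuclideanSpace ℝ (Fin d)} (hp : polarMap Γ p ∈ c.source) :
    dirDeriv (1, 0) (c ∘ polarMap Γ) p = deriv (c ∘ Γ p.2) p.1 :=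
  (hasDerivAt_fst (t := p.1) (ξ := p.2)
    ((h.contDiffAt hc hp).differentiableAt (by simp))).deriv.symm

theorem isGeodesicVariation (h : IsPolarFamily Γ x L)
    (hc : c ∈ IsManifold.maximalAtlas (𝓡 d) ∞ M)
    {p : ℝ × EuclideanSpace ℝ (Fin d)} (hp : polarMap Γ p ∈ c.source) :
    IsGeodesicVariation c.target (chartChristoffel c) (c ∘ polarMap Γ) p := by
  have hev : ∀ᶠ q in 𝓝 p, polarMap Γ q ∈ c.source :=
    h.contMDiff.continuous.continuousAt.eventually_mem (c.open_source.mem_nhds hp)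
  refine ⟨c.map_source hp, hev.mono fun q hq => h.contDiffAt hc hq, ?_⟩
  filter_upwards [hev.eventually_nhds] with q hq
  have hq0 := hq.self_of_nhds
  have hg : IsChartGeodesicAt c (Γ q.2) q.1 :=
    (isGeodesic_iff.1 (h.isGeodesic q.2) q.1).isChartGeodesicAt hc hq0
  have h1 := hasDerivAt_fst (t := q.1) (ξ := q.2)
    ((contDiffAt_dirDeriv (h.contDiffAt hc hq0) (1, 0)).differentiableAt (by simp))
  have h2 : (fun s => dirDeriv (1, 0) (c ∘ polarMap Γ) (s, q.2)) =ᶠ[𝓝 q.1] deriv (c ∘ Γ q.2) := by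
    have hcont : ContinuousAt (fun s : ℝ => (s, q.2)) q.1 := by fun_prop
    filter_upwards [hcont.eventually hq] with s hs using h.dirDeriv_time hc hs
  rw [h.dirDeriv_time hc hq0]
  exact (h1.congr_of_eventuallyEq h2.symm).unique hg.hasDerivAt_deriv

theorem pullbackInner_time (h : IsPolarFamily Γ x L) (p : ℝ × EuclideanSpace ℝ (Fin d)) :
    pullbackInner (d := d) (polarMap Γ) p (1, 0) (1, 0) = inner ℝ p.2 p.2 := by
  have hc := chart_mem_maximalAtlas_infty (d := d) (polarMap Γ p)
  have hp : polarMap Γ p ∈ (chartAt (EuclideanSpace ℝ (Fin d)) (polarMap Γ p)).source :=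
    mem_chart_source _ _
  have hg := (isGeodesic_iff.1 (h.isGeodesic p.2) p.1).isChartGeodesicAt hc hp
  rw [pullbackInner_eq hc h.contMDiff.contMDiffAt hp, h.dirDeriv_time hc hp]
  refine (hg.speedSq_eq hc).symm.trans ?_
  rw [speedSq_eq_of_isGeodesicAt isOpen_univ isPreconnected_univ
    (fun s _ => isGeodesic_iff.1 (h.isGeodesic p.2) s) (mem_univ p.1) (mem_univ 0), speedSq,
    h.init, h.velocity, h.isometry]

/-- All geodesics of the family start at `x`, so the variation fields vanish at time `0`. -/
theorem dirDeriv_zero (h : IsPolarFamily Γ x L) (hc : c ∈ IsManifold.maximalAtlas (𝓡 d) ∞ M)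
    (hx : x ∈ c.source) : dirDeriv (0, k) (c ∘ polarMap Γ) (0, ξ) = 0 := by
  have hp : polarMap Γ (0, ξ) ∈ c.source := by rwa [polarMap, h.init]
  have h1 := hasDerivAt_line ((h.contDiffAt hc hp).differentiableAt (by simp)) ((0 : ℝ), k)
  have h2 : (fun r : ℝ => (c ∘ polarMap Γ) ((0, ξ) + r • ((0 : ℝ), k))) = fun _ => c x := by
    funext r
    simp [polarMap, h.init]
  rw [h2] at h1
  exact h1.unique (hasDerivAt_const _ _)

/-- Gauss's lemma: by the first variation formula, the inner product of the variation field with the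
velocity is affine in time. -/
theorem pullbackInner_time_variation (h : IsPolarFamily Γ x L) (t : ℝ)
    (ξ k : EuclideanSpace ℝ (Fin d)) :
    pullbackInner (d := d) (polarMap Γ) (t, ξ) (1, 0) (0, k) = t * inner ℝ ξ k := by
  have hd : ∀ t, HasDerivAt (fun s => pullbackInner (d := d) (polarMap Γ) (s, ξ) (1, 0) (0, k)
      - s * inner ℝ ξ k) 0 t := by
    intro t
    have hc := chart_mem_maximalAtlas_infty (d := d) (polarMap Γ (t, ξ))
    have hp : polarMap Γ (t, ξ) ∈ (chartAt (EuclideanSpace ℝ (Fin d)) (polarMap Γ (t, ξ))).source :=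
      mem_chart_source _ _
    set c := chartAt (EuclideanSpace ℝ (Fin d)) (polarMap Γ (t, ξ))
    have hev : ∀ᶠ q in 𝓝 (t, ξ), polarMap Γ q ∈ c.source :=
      h.contMDiff.continuous.continuousAt.eventually_mem (c.open_source.mem_nhds hp)
    have h1 := (isCoordMetric hc).hasDerivAt_inner_velocity_variation
      (h.isGeodesicVariation hc hp) k
    have hcr : ContinuousAt (fun r : ℝ => (t, ξ + r • k)) 0 := by fun_prop
    have hcs : ContinuousAt (fun s : ℝ => (s, ξ)) t := by fun_prop
    have h2 : (fun r : ℝ => chartMetric c ((c ∘ polarMap Γ) (t, ξ + r • k))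
        (dirDeriv (1, 0) (c ∘ polarMap Γ) (t, ξ + r • k))
        (dirDeriv (1, 0) (c ∘ polarMap Γ) (t, ξ + r • k))) =ᶠ[𝓝 0]
        fun r => inner ℝ (ξ + r • k) (ξ + r • k) := by
      have hev' : ∀ᶠ q in 𝓝 (t, ξ + (0 : ℝ) • k), polarMap Γ q ∈ c.source := by simpa using hev
      filter_upwards [hcr.eventually hev'] with r hr
      have := h.pullbackInner_time (t, ξ + r • k)
      rwa [pullbackInner_eq hc h.contMDiff.contMDiffAt hr] at this
    have h3 : HasDerivAt (fun r : ℝ => inner ℝ (ξ + r • k) (ξ + r • k)) (2 * inner ℝ ξ k) 0 := by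
      have e : HasDerivAt (fun r : ℝ => ξ + r • k) k 0 := by
        simpa using ((hasDerivAt_id (0 : ℝ)).smul_const k).const_add ξ
      refine (e.inner ℝ e).congr_deriv ?_
      simp [real_inner_comm k ξ, two_mul]
    rw [h2.deriv_eq, h3.deriv] at h1
    have h4 : (fun s => pullbackInner (d := d) (polarMap Γ) (s, ξ) (1, 0) (0, k)) =ᶠ[𝓝 t]
        fun s => chartMetric c ((c ∘ polarMap Γ) (s, ξ)) (dirDeriv (1, 0) (c ∘ polarMap Γ) (s, ξ))
          (dirDeriv (0, k) (c ∘ polarMap Γ) (s, ξ)) := by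
      filter_upwards [hcs.eventually hev] with s hs
      rw [pullbackInner_eq hc h.contMDiff.contMDiffAt hs]
      rfl
    refine ((h1.congr_of_eventuallyEq h4).sub
      ((hasDerivAt_id t).mul_const (inner ℝ ξ k))).congr_deriv ?_
    ring
  have h0 := is_const_of_deriv_eq_zero (fun s => (hd s).differentiableAt) (fun s => (hd s).deriv) t 0
  have hc := chart_mem_maximalAtlas_infty (d := d) x
  have hx : polarMap Γ (0, ξ) ∈ (chartAt (EuclideanSpace ℝ (Fin d)) x).source := by
    rw [polarMap, h.init]; exact mem_chart_source _ _
  rw [pullbackInner_eq hc h.contMDiff.contMDiffAt hx, h.dirDeriv_zero hc (mem_chart_source _ _)]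
    at h0
  simp only [map_zero, zero_mul, sub_zero] at h0
  linarith

/-- The squared length of the Jacobi field of a normal variation in curvature `-1`: with its covariant
derivative it satisfies the system of `eq_sinh_sq_of_local_system`. -/
theorem pullbackInner_variation_self (h : IsPolarFamily Γ x L)
    (hM : HasConstantSectionalCurvature (d := d) M (-1)) (hξ : inner ℝ ξ ξ = (1 : ℝ))
    (hk : inner ℝ ξ k = (0 : ℝ)) (t : ℝ) :
    pullbackInner (d := d) (polarMap Γ) (t, ξ) (0, k) (0, k) = inner ℝ k k * Real.sinh t ^ 2 := by
  refine eq_sinh_sq_of_local_system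
    (a := fun t => pullbackInner (d := d) (polarMap Γ) (t, ξ) (0, k) (0, k)) (fun t => ?_) t
  have hc := chart_mem_maximalAtlas_infty (d := d) (polarMap Γ (t, ξ))
  have hp : polarMap Γ (t, ξ) ∈ (chartAt (EuclideanSpace ℝ (Fin d)) (polarMap Γ (t, ξ))).source :=
    mem_chart_source _ _
  set c := chartAt (EuclideanSpace ℝ (Fin d)) (polarMap Γ (t, ξ))
  set H := c ∘ polarMap Γ with hH
  have hcs : ContinuousAt (fun s : ℝ => (s, ξ)) t := by fun_prop
  have hev : ∀ᶠ s in 𝓝 t, polarMap Γ (s, ξ) ∈ c.source :=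
    hcs.eventually (h.contMDiff.continuous.continuousAt.eventually_mem (c.open_source.mem_nhds hp))
  have hpb : ∀ s, polarMap Γ (s, ξ) ∈ c.source → ∀ u v,
      pullbackInner (d := d) (polarMap Γ) (s, ξ) u v =
        chartMetric c (H (s, ξ)) (dirDeriv u H (s, ξ)) (dirDeriv v H (s, ξ)) :=
    fun s hs u v => pullbackInner_eq hc h.contMDiff.contMDiffAt hs u v
  have hg := isCoordMetric hc
  refine ⟨fun s => chartMetric c (H (s, ξ)) (covariantVariation (chartChristoffel c) H k (s, ξ))
      (dirDeriv (0, k) H (s, ξ)), fun s => chartMetric c (H (s, ξ))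
      (covariantVariation (chartChristoffel c) H k (s, ξ))
      (covariantVariation (chartChristoffel c) H k (s, ξ)), ?_, ?_⟩
  · filter_upwards [hev.eventually_nhds] with s hs
    have hs0 := hs.self_of_nhds
    have hv := h.isGeodesicVariation hc hs0
    have hK := fun v w => inner_coordCurvature hM hc (c.map_source hs0) v w
    have hT1 := h.pullbackInner_time (s, ξ)
    have hTJ := h.pullbackInner_time_variation s ξ k
    rw [hpb s hs0, hξ] at hT1
    rw [hpb s hs0, hk, mul_zero] at hTJ
    refine ⟨?_, ?_, hg.hasDerivAt_inner_covariantVariation_self hK hT1 hTJ hv⟩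
    · refine (hg.hasDerivAt_inner_variation hv k).congr_of_eventuallyEq ?_
      filter_upwards [hs] with r hr using hpb r hr _ _
    · rw [hpb s hs0]
      exact hg.hasDerivAt_inner_covariantVariation hK hT1 hTJ hv
  · rintro rfl
    have hx : x ∈ c.source := by rwa [polarMap, h.init] at hp
    have hz : dirDeriv (0, k) H (0, ξ) = 0 := h.dirDeriv_zero hc hx
    have hD : covariantVariation (chartChristoffel c) H k (0, ξ) = components c x (L k) := by
      rw [covariantVariation, hz, map_zero, add_zero]
      have hHs := h.contDiffAt hc hp
      have h1 := hasDerivAt_line ((contDiffAt_dirDeriv hHs (1, 0)).differentiableAt (by simp))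
        ((0 : ℝ), k)
      have h2 : (fun r : ℝ => dirDeriv (1, 0) H ((0, ξ) + r • ((0 : ℝ), k))) =
          fun r : ℝ => components c x (L (ξ + r • k)) := by
        funext r
        have e : (0, ξ) + r • ((0 : ℝ), k) = (0, ξ + r • k) := by simp
        have hr : polarMap Γ (0, ξ + r • k) ∈ c.source := by rwa [polarMap, h.init]
        have e2 : deriv (c ∘ Γ (ξ + r • k)) 0 = components c (Γ (ξ + r • k) 0)
            (SphericalMean.velocity (Γ (ξ + r • k)) 0) :=
          ((isGeodesic_iff.1 (h.isGeodesic (ξ + r • k)) 0).isChartGeodesicAt hc hr).deriv_eq hc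
        rw [e, hH, h.dirDeriv_time hc hr]
        dsimp only
        rw [e2, h.init, h.velocity]
      rw [h2] at h1
      have h3 : HasDerivAt (fun r : ℝ => components c x (L (ξ + r • k))) (components c x (L k)) 0 := by
        let A : EuclideanSpace ℝ (Fin d) →L[ℝ] EuclideanSpace ℝ (Fin d) :=
          mfderiv (𝓡 d) (𝓡 d) c x
        have e : HasDerivAt (fun r : ℝ => ξ + r • k) k 0 := by
          simpa using ((hasDerivAt_id (0 : ℝ)).smul_const k).const_add ξ
        exact (A.comp L).hasFDerivAt.comp_hasDerivAt (0 : ℝ) e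
      exact h1.unique h3
    have hH0 : H (0, ξ) = c x := by rw [hH, Function.comp_apply, polarMap, h.init]
    refine ⟨?_, ?_, ?_⟩
    · rw [hpb 0 hp, hz]; simp
    · simp [hz]
    · simp only [hD, hH0]
      rw [chartMetric_components hc hx, h.isometry]

/-- In geodesic polar coordinates the metric of curvature `-1` is `dt² + sinh² t dξ²`. -/
theorem pullbackInner_polar (h : IsPolarFamily Γ x L)
    (hM : HasConstantSectionalCurvature (d := d) M (-1)) (hξ : inner ℝ ξ ξ = (1 : ℝ))
    (hk : inner ℝ ξ k = (0 : ℝ)) (t τ : ℝ) :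
    pullbackInner (d := d) (polarMap Γ) (t, ξ) (τ, k) (τ, k) =
      τ ^ 2 + Real.sinh t ^ 2 * inner ℝ k k := by
  have e : (τ, k) = τ • ((1 : ℝ), (0 : EuclideanSpace ℝ (Fin d))) + (0, k) := by simp
  rw [e]
  simp only [pullbackInner_add_left, pullbackInner_add_right, pullbackInner_smul_left,
    pullbackInner_smul_right]
  rw [pullbackInner_comm _ _ (0, k) (1, 0), h.pullbackInner_time, h.pullbackInner_time_variation,
    h.pullbackInner_variation_self hM hξ hk, hξ, hk]
  ring

end IsPolarFamily

end Polar

/-! ### The eigenvalue equation in conformal coordinates -/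

section Conformal

variable {d : ℕ} {M : Type*} [TopologicalSpace M] [ChartedSpace (EuclideanSpace ℝ (Fin d)) M]
  [IsManifold (𝓡 d) ∞ M] [Bundle.RiemannianBundle (fun x : M => TangentSpace (𝓡 d) x)]
  [IsContMDiffRiemannianBundle (𝓡 d) ∞ (EuclideanSpace ℝ (Fin d))
    (fun x : M => TangentSpace (𝓡 d) x)]

/-- A smooth map from an open subset of `ℝᵈ` to `M` which is immersive at `z` is the inverse of a
chart near `z`. -/
theorem exists_chart_symm_eventuallyEq {f : EuclideanSpace ℝ (Fin d) → M}
    {W : Set (EuclideanSpace ℝ (Fin d))} (hW : IsOpen W) (hf : ContMDiffOn (𝓡 d) (𝓡 d) ∞ f W)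
    {z : EuclideanSpace ℝ (Fin d)} (hz : z ∈ W)
    (himm : ∀ v, v ≠ 0 → pullbackInner (d := d) f z v v ≠ 0) :
    ∃ c ∈ IsManifold.maximalAtlas (𝓡 d) ∞ M, z ∈ c.target ∧ c.symm =ᶠ[𝓝 z] f := by
  have hc := chart_mem_maximalAtlas_infty (d := d) (f z)
  have hfz : f z ∈ (chartAt (EuclideanSpace ℝ (Fin d)) (f z)).source := mem_chart_source _ _
  set c₀ := chartAt (EuclideanSpace ℝ (Fin d)) (f z)
  have hV : IsOpen (W ∩ f ⁻¹' c₀.source) := hf.continuousOn.isOpen_inter_preimage hW c₀.open_source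
  have hfC : ContDiffOn ℝ ∞ (c₀ ∘ f) (W ∩ f ⁻¹' c₀.source) := by
    refine ContMDiffOn.contDiffOn ?_
    exact (contMDiffOn_of_mem_maximalAtlas hc).comp (hf.mono inter_subset_left) inter_subset_right
  have hzV : z ∈ W ∩ f ⁻¹' c₀.source := ⟨hz, hfz⟩
  have hd : HasFDerivAt (c₀ ∘ f) (fderiv ℝ (c₀ ∘ f) z) z :=
    ((hfC.contDiffAt (hV.mem_nhds hzV)).differentiableAt (by simp)).hasFDerivAt
  have hinj : Function.Injective (fderiv ℝ (c₀ ∘ f) z) := by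
    refine (injective_iff_map_eq_zero _).2 fun v hv => ?_
    by_contra hv0
    refine himm v hv0 ?_
    rw [pullbackInner_eq hc (hf.contMDiffAt (hW.mem_nhds hz)) hfz]
    have : dirDeriv v (c₀ ∘ f) z = 0 := hv
    rw [this, map_zero]
  let f' : EuclideanSpace ℝ (Fin d) ≃L[ℝ] EuclideanSpace ℝ (Fin d) :=
    (LinearEquiv.ofInjectiveEndo (fderiv ℝ (c₀ ∘ f) z).toLinearMap hinj).toContinuousLinearEquiv
  have hf' : (f' : EuclideanSpace ℝ (Fin d) →L[ℝ] EuclideanSpace ℝ (Fin d)) =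
      fderiv ℝ (c₀ ∘ f) z := by
    ext1 v; rfl
  obtain ⟨e, he, hze, hes, hsm⟩ := exists_smooth_local_inverse hV hfC hzV f' (hf' ▸ hd)
  have hmem : ∀ y ∈ e.source, e y ∈ c₀.target := by
    intro y hy
    rw [he]
    exact c₀.map_source (hes hy).2
  refine ⟨c₀.trans e.symm, ?_, ?_, ?_⟩
  · rw [IsManifold.mem_maximalAtlas_iff_contMDiffOn]
    constructor
    · rw [OpenPartialHomeomorph.coe_trans, OpenPartialHomeomorph.trans_source]
      exact hsm.contMDiffOn.comp ((contMDiffOn_of_mem_maximalAtlas hc).mono inter_subset_left)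
        inter_subset_right
    · rw [OpenPartialHomeomorph.coe_trans_symm, OpenPartialHomeomorph.trans_target]
      refine (contMDiffOn_symm_of_mem_maximalAtlas hc).comp
        (ContMDiffOn.mono ?_ inter_subset_left) inter_subset_right
      rw [OpenPartialHomeomorph.symm_symm, he]
      exact (hfC.mono hes).contMDiffOn
  · rw [OpenPartialHomeomorph.trans_target]
    exact ⟨hze, hmem z hze⟩
  · filter_upwards [e.open_source.mem_nhds hze] with y hy
    rw [OpenPartialHomeomorph.coe_trans_symm, OpenPartialHomeomorph.symm_symm, Function.comp_apply,
      he]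
    exact c₀.left_inv (hes hy).2

theorem metric_eq_pullbackInner (c : OpenPartialHomeomorph M (EuclideanSpace ℝ (Fin d)))
    {f : EuclideanSpace ℝ (Fin d) → M} {z : EuclideanSpace ℝ (Fin d)} (h : c.symm =ᶠ[𝓝 z] f)
    (i j : Fin d) : metric c z i j =
      pullbackInner (d := d) f z (EuclideanSpace.single i 1) (EuclideanSpace.single j 1) := by
  have h1 : metric c z i j = pullbackInner (d := d) c.symm z (EuclideanSpace.single i 1)
    (EuclideanSpace.single j 1) := rfl
  rw [h1, pullbackInner, pullbackInner, h.mfderiv_eq, h.eq_of_nhds]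

/-- The Laplace eigenvalue equation in conformal coordinates: if the metric is `ρ² |dz|²`, then
`√g gⁱʲ = ρ ^ (d - 2) δⁱʲ`. -/
theorem IsLaplaceEigenfunction.conformal {F : Type*} [NormedAddCommGroup F] [NormedSpace ℝ F]
    {φ : M → F} {lam : ℝ} (hφ : IsLaplaceEigenfunction (d := d) φ lam)
    {f : EuclideanSpace ℝ (Fin d) → M} {W : Set (EuclideanSpace ℝ (Fin d))} (hW : IsOpen W)
    (hf : ContMDiffOn (𝓡 d) (𝓡 d) ∞ f W) {ρ : EuclideanSpace ℝ (Fin d) → ℝ} (hd : 2 ≤ d)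
    (hρ : ∀ z ∈ W, 0 < ρ z)
    (hconf : ∀ z ∈ W, ∀ v, pullbackInner (d := d) f z v v = ρ z ^ 2 * inner ℝ v v)
    {z : EuclideanSpace ℝ (Fin d)} (hz : z ∈ W) :
    ∑ i, pd i (fun y => (ρ y ^ (d - 2)) • pd i (φ ∘ f) y) z = -(lam * ρ z ^ d) • φ (f z) := by
  have hpol : ∀ y ∈ W, ∀ u v, pullbackInner (d := d) f y u v = ρ y ^ 2 * inner ℝ u v := by
    intro y hy u v
    have h1 := hconf y hy (u + v)
    simp only [pullbackInner_add_left, pullbackInner_add_right, inner_add_left, inner_add_right]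
      at h1
    rw [hconf y hy, hconf y hy, pullbackInner_comm f y v u, real_inner_comm u v] at h1
    linarith
  obtain ⟨c, hc, hzc, he⟩ := exists_chart_symm_eventuallyEq hW hf hz fun v hv => by
    rw [hconf z hz]
    have := hρ z hz
    have := real_inner_self_pos.2 hv
    positivity
  have hmet : ∀ᶠ y in 𝓝 z, metric c y = ρ y ^ 2 • (1 : Matrix (Fin d) (Fin d) ℝ) := by
    filter_upwards [he.eventuallyEq_nhds, hW.mem_nhds hz] with y hy hyW
    ext i j
    rw [metric_eq_pullbackInner c hy, hpol y hyW, EuclideanSpace.inner_single_left]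
    simp [Matrix.one_apply]
  have hdet : ∀ᶠ y in 𝓝 z, 0 < ρ y ∧ √(metric c y).det = ρ y ^ d ∧
      (metric c y)⁻¹ = (ρ y ^ 2)⁻¹ • (1 : Matrix (Fin d) (Fin d) ℝ) := by
    filter_upwards [hmet, hW.mem_nhds hz] with y hy hyW
    have h0 := hρ y hyW
    refine ⟨h0, ?_, ?_⟩
    · rw [hy, Matrix.det_smul, Matrix.det_one, mul_one, Fintype.card_fin, ← pow_mul, mul_comm,
        pow_mul, Real.sqrt_sq (by positivity)]
    · rw [hy]
      refine Matrix.inv_eq_left_inv ?_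
      rw [Matrix.smul_mul, Matrix.mul_smul, smul_smul, inv_mul_cancel₀ (by positivity), one_smul,
        Matrix.one_mul]
  have hu : (φ ∘ c.symm) =ᶠ[𝓝 z] φ ∘ f := he.fun_comp φ
  have hcoef : ∀ i j, (fun y => (√(metric c y).det * (metric c y)⁻¹ i j) • pd j (φ ∘ c.symm) y)
      =ᶠ[𝓝 z] fun y => if i = j then (ρ y ^ (d - 2)) • pd i (φ ∘ f) y else 0 := by
    intro i j
    filter_upwards [hdet, hu.eventuallyEq_nhds] with y hy hyu
    obtain ⟨h0, h1, h2⟩ := hy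
    rw [h1, h2, Matrix.smul_apply, Matrix.one_apply]
    split_ifs with hij
    · subst hij
      rw [pd, pd, hyu.fderiv_eq]
      congr 1
      obtain ⟨n, rfl⟩ := Nat.exists_eq_add_of_le hd
      rw [Nat.add_sub_cancel_left, pow_add, smul_eq_mul, mul_one]
      field_simp
    · simp
  have h1 := hφ.eigen c hc z hzc
  obtain ⟨h0, hdz, -⟩ := hdet.self_of_nhds
  rw [laplaceBeltrami, hdz, he.eq_of_nhds] at h1
  have h2 : ∀ i, ∑ j, pd i (fun y => (√(metric c y).det * (metric c y)⁻¹ i j) •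
      pd j (φ ∘ c.symm) y) z = pd i (fun y => (ρ y ^ (d - 2)) • pd i (φ ∘ f) y) z := by
    intro i
    rw [Finset.sum_eq_single i]
    · rw [pd, (hcoef i i).fderiv_eq]
      simp only [if_true]
      rfl
    · intro j _ hij
      rw [pd, (hcoef i j).fderiv_eq]
      simp [hij.symm]
    · simp
  simp only [h2] at h1
  rw [neg_eq_iff_eq_neg] at h1
  have h3 := congrArg (fun w => ρ z ^ d • w) h1
  simp only [smul_smul] at h3
  rw [mul_one_div_cancel (by positivity), one_smul] at h3
  rw [h3, smul_neg, neg_smul, smul_smul, mul_comm]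

end Conformal

/-! ### The uniform measure on the unit sphere -/

section SphereMeasure

variable (E : Type*) {E' : Type*} [NormedAddCommGroup E] [InnerProductSpace ℝ E] [MeasurableSpace E]
  [BorelSpace E] [FiniteDimensional ℝ E] [NormedAddCommGroup E'] [InnerProductSpace ℝ E']
  [MeasurableSpace E'] [BorelSpace E'] [FiniteDimensional ℝ E']
  {F : Type*} [NormedAddCommGroup F] [NormedSpace ℝ F]

/-- The uniform probability measure on the unit sphere of a Euclidean space. -/
def sphereMeasure : Measure (sphere (0 : E) 1) :=
  ((volume : Measure E).toSphere univ)⁻¹ • (volume : Measure E).toSphere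

variable {E}

instance : IsFiniteMeasure (sphereMeasure E) := by
  refine ⟨?_⟩
  rw [sphereMeasure, Measure.smul_apply, smul_eq_mul]
  exact (ENNReal.inv_mul_le_one _).trans_lt ENNReal.one_lt_top

theorem isProbabilityMeasure_sphereMeasure [Nontrivial E] :
    IsProbabilityMeasure (sphereMeasure E) := by
  refine ⟨?_⟩
  rw [sphereMeasure, Measure.smul_apply, smul_eq_mul]
  refine ENNReal.inv_mul_cancel ?_ (measure_ne_top _ _)
  rw [Measure.measure_univ_ne_zero]
  exact Measure.toSphere_ne_zero _

/-- A linear isometry maps the unit sphere onto the unit sphere. -/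
def sphereHomeomorph (L : E ≃ₗᵢ[ℝ] E') : sphere (0 : E) 1 ≃ₜ sphere (0 : E') 1 :=
  L.toHomeomorph.subtype fun v => by simp

theorem measurePreserving_sphereHomeomorph (L : E ≃ₗᵢ[ℝ] E') :
    MeasurePreserving (sphereHomeomorph L) (sphereMeasure E) (sphereMeasure E') := by
  have hdim : Module.finrank ℝ E = Module.finrank ℝ E' := L.toLinearEquiv.finrank_eq
  have hmap : ∀ s : Set (sphere (0 : E') 1), MeasurableSet s →
      (volume : Measure E).toSphere (sphereHomeomorph L ⁻¹' s) =
        (volume : Measure E').toSphere s := by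
    intro s hs
    have hs' : MeasurableSet (sphereHomeomorph L ⁻¹' s) :=
      (sphereHomeomorph L).continuous.measurable hs
    rw [Measure.toSphere_apply' _ hs', Measure.toSphere_apply' _ hs, hdim]
    congr 1
    have himg : Ioo (0 : ℝ) 1 • ((↑) '' (sphereHomeomorph L ⁻¹' s) : Set E) =
        L ⁻¹' (Ioo (0 : ℝ) 1 • ((↑) '' s)) := by
      ext v
      simp only [Set.mem_smul, mem_image, mem_preimage]
      constructor
      · rintro ⟨r, hr, _, ⟨w, hw, rfl⟩, rfl⟩
        exact ⟨r, hr, _, ⟨_, hw, rfl⟩, (map_smul L r (w : E)).symm⟩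
      · rintro ⟨r, hr, _, ⟨w, hw, rfl⟩, hv⟩
        refine ⟨r, hr, L.symm w, ⟨(sphereHomeomorph L).symm w, ?_, rfl⟩, ?_⟩
        · simpa using hw
        · rw [← map_smul, show r • (w : E') = L v from hv, L.symm_apply_apply]
    rw [himg]
    exact (LinearIsometryEquiv.measurePreserving L).measure_preimage_emb
      L.toHomeomorph.measurableEmbedding _
  refine ⟨(sphereHomeomorph L).continuous.measurable, ?_⟩
  ext s hs
  rw [Measure.map_apply (sphereHomeomorph L).continuous.measurable hs, sphereMeasure, sphereMeasure,
    Measure.smul_apply, Measure.smul_apply, hmap s hs, ← hmap univ MeasurableSet.univ, preimage_univ]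

theorem integral_sphere_comp (L : E ≃ₗᵢ[ℝ] E') (f : E' → F) :
    ∫ v : sphere (0 : E) 1, f (L v) ∂sphereMeasure E =
      ∫ v : sphere (0 : E') 1, f v ∂sphereMeasure E' :=
  (measurePreserving_sphereHomeomorph L).integral_comp
    (sphereHomeomorph L).measurableEmbedding fun v => f v

end SphereMeasure

/-! ### Differentiation of parametric integrals -/

section ParametricIntegral

variable {K : Type*} [TopologicalSpace K] [CompactSpace K] [T2Space K] [SecondCountableTopology K]
  [MeasurableSpace K] [OpensMeasurableSpace K] {μ : Measure K} [IsFiniteMeasure μ]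
  {F : Type*} [NormedAddCommGroup F] [NormedSpace ℝ F]

theorem integrable_of_continuous {f : K → F} (hf : Continuous f) : Integrable f μ :=
  integrableOn_univ.1 (hf.continuousOn.integrableOn_compact isCompact_univ)

/-- Differentiation under the integral sign over a compact space. -/
theorem hasDerivAt_integral_of_continuousOn {I : Set ℝ} (hI : IsOpen I) {f f' : ℝ → K → F}
    (hf : ∀ t ∈ I, Continuous (f t)) (hf' : ContinuousOn (fun p : ℝ × K => f' p.1 p.2) (I ×ˢ univ))
    (hd : ∀ t ∈ I, ∀ k, HasDerivAt (fun s => f s k) (f' t k) t) {t : ℝ} (ht : t ∈ I) :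
    HasDerivAt (fun s => ∫ k, f s k ∂μ) (∫ k, f' t k ∂μ) t := by
  obtain ⟨ε, hε, hεI⟩ := Metric.nhds_basis_closedBall.mem_iff.1 (hI.mem_nhds ht)
  have hcomp : IsCompact (closedBall t ε ×ˢ (univ : Set K)) :=
    (isCompact_closedBall t ε).prod isCompact_univ
  obtain ⟨C, hC⟩ := hcomp.exists_bound_of_continuousOn
    (hf'.mono (prod_mono_left hεI))
  have hcont' : Continuous (f' t) := by
    rw [← continuousOn_univ]
    exact hf'.comp (f := fun k : K => (t, k)) (by fun_prop) fun k _ => ⟨ht, mem_univ _⟩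
  refine (hasDerivAt_integral_of_dominated_loc_of_deriv_le (bound := fun _ => C)
    (closedBall_mem_nhds t hε) ?_ (integrable_of_continuous (hf t ht))
    hcont'.aestronglyMeasurable ?_ (integrable_const C) ?_).2
  · filter_upwards [hI.mem_nhds ht] with s hs using (hf s hs).aestronglyMeasurable
  · exact Eventually.of_forall fun k s hs => hC (s, k) ⟨hs, mem_univ _⟩
  · exact Eventually.of_forall fun k s hs => hd s (hεI hs) k

end ParametricIntegral

/-! ### Infinitesimal rotations of the sphere -/

section Rotations

variable {E : Type*} [NormedAddCommGroup E] [InnerProductSpace ℝ E] [MeasurableSpace E]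
  [BorelSpace E] [FiniteDimensional ℝ E] {F : Type*} [NormedAddCommGroup F] [NormedSpace ℝ F]

/-- Integrals over spheres of derivatives along infinitesimal rotations vanish. -/
theorem integral_fderiv_skewAdjoint {X : E →L[ℝ] E} (hX : X ∈ skewAdjoint (E →L[ℝ] E)) {r : ℝ}
    {w : E → F} {W : Set E} (hW : IsOpen W) (hw : ContDiffOn ℝ 1 w W)
    (hr : ∀ v : sphere (0 : E) 1, r • (v : E) ∈ W) :
    ∫ v : sphere (0 : E) 1, fderiv ℝ w (r • (v : E)) (X (r • (v : E))) ∂sphereMeasure E = 0 := by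
  -- the integral of `w` over the rotated sphere does not depend on the angle `θ`
  let _ : NormedAlgebra ℚ (E →L[ℝ] E) := NormedAlgebra.restrictScalars ℚ ℝ (E →L[ℝ] E)
  have hmem : ∀ θ : ℝ, NormedSpace.exp (θ • X) ∈ unitary (E →L[ℝ] E) := fun θ =>
    NormedSpace.exp_mem_unitary_of_mem_skewAdjoint (skewAdjoint.smul_mem θ hX)
  let R : ℝ → (E ≃ₗᵢ[ℝ] E) := fun θ => Unitary.linearIsometryEquiv ⟨_, hmem θ⟩
  have hR : ∀ θ v, R θ v = NormedSpace.exp (θ • X) v := fun θ v => rfl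
  have hexp : Continuous fun θ : ℝ => NormedSpace.exp (θ • X) :=
    continuous_iff_continuousAt.2 fun θ => (hasDerivAt_exp_smul_const X θ).continuousAt
  have hRW : ∀ θ (v : sphere (0 : E) 1), r • NormedSpace.exp (θ • X) (v : E) ∈ W := fun θ v =>
    hr (sphereHomeomorph (R θ) v)
  have hjoint : Continuous fun p : ℝ × sphere (0 : E) 1 =>
      r • NormedSpace.exp (p.1 • X) (p.2 : E) :=
    ((hexp.comp continuous_fst).clm_apply (continuous_subtype_val.comp continuous_snd)).const_smul r
  have hcf : ContinuousOn (fderiv ℝ w) W := hw.continuousOn_fderiv_of_isOpen hW le_rfl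
  have hder := hasDerivAt_integral_of_continuousOn (μ := sphereMeasure E) isOpen_univ
    (f := fun θ v => w (r • NormedSpace.exp (θ • X) (v : E)))
    (f' := fun θ v => fderiv ℝ w (r • NormedSpace.exp (θ • X) (v : E))
      (r • X (NormedSpace.exp (θ • X) (v : E)))) ?_ ?_ ?_ (mem_univ (0 : ℝ))
  · have hconst : (fun θ : ℝ => ∫ v : sphere (0 : E) 1, w (r • NormedSpace.exp (θ • X) (v : E))
        ∂sphereMeasure E) = fun _ => ∫ v : sphere (0 : E) 1, w (r • (v : E)) ∂sphereMeasure E := by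
      funext θ
      exact integral_sphere_comp (R θ) fun v => w (r • v)
    rw [hconst] at hder
    have h0 := hder.unique (hasDerivAt_const _ _)
    simpa using h0
  · intro θ _
    exact hw.continuousOn.comp_continuous
      (hjoint.comp (f := fun v : sphere (0 : E) 1 => (θ, v)) (by fun_prop)) (hRW θ)
  · rw [univ_prod_univ, continuousOn_univ]
    refine (hcf.comp_continuous hjoint fun p => hRW p.1 p.2).clm_apply ?_
    exact (X.continuous.comp ((hexp.comp continuous_fst).clm_apply
      (continuous_subtype_val.comp continuous_snd))).const_smul r
  · intro θ _ v
    have h1 : HasDerivAt (fun θ : ℝ => r • NormedSpace.exp (θ • X) (v : E))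
        (r • X (NormedSpace.exp (θ • X) (v : E))) θ := by
      have h2 := (hasDerivAt_exp_smul_const' X θ).clm_apply (hasDerivAt_const θ (v : E))
      simp only [map_zero, add_zero] at h2
      exact h2.const_smul r
    have h3 := ((hw.contDiffAt (hW.mem_nhds (hRW θ v))).differentiableAt (by simp)).hasFDerivAt
    exact h3.comp_hasDerivAt θ h1

/-- The second order version: the square of an infinitesimal rotation also integrates to zero. -/
theorem integral_fderiv_fderiv_skewAdjoint {X : E →L[ℝ] E} (hX : X ∈ skewAdjoint (E →L[ℝ] E))
    {r : ℝ} {w : E → F} {W : Set E} (hW : IsOpen W) (hw : ContDiffOn ℝ ∞ w W)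
    (hr : ∀ v : sphere (0 : E) 1, r • (v : E) ∈ W) :
    ∫ v : sphere (0 : E) 1, (fderiv ℝ (fderiv ℝ w) (r • (v : E)) (X (r • (v : E))) (X (r • (v : E)))
      + fderiv ℝ w (r • (v : E)) (X (X (r • (v : E))))) ∂sphereMeasure E = 0 := by
  have hw' : ContDiffOn ℝ ∞ (fderiv ℝ w) W := hw.fderiv_of_isOpen hW le_rfl
  have hw₁ : ContDiffOn ℝ ∞ (fun z => fderiv ℝ w z (X z)) W :=
    hw'.clm_apply X.contDiff.contDiffOn
  rw [← integral_fderiv_skewAdjoint hX hW (hw₁.of_le ENat.LEInfty.out) hr]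
  refine integral_congr_ae (Eventually.of_forall fun v => ?_)
  have h1 := ((hw'.contDiffAt (hW.mem_nhds (hr v))).differentiableAt (by simp)).hasFDerivAt.clm_apply
    (X.hasFDerivAt (x := r • (v : E)))
  dsimp only
  rw [h1.fderiv]
  simp [add_comm]

end Rotations

/-! ### The mean of the spherical Laplacian -/

section SphericalLaplacian

variable {d : ℕ} {F : Type*} [NormedAddCommGroup F] [NormedSpace ℝ F]

/-- The infinitesimal rotation `z ↦ zᵢ eⱼ - zⱼ eᵢ`. -/
def rotationField (i j : Fin d) : EuclideanSpace ℝ (Fin d) →L[ℝ] EuclideanSpace ℝ (Fin d) :=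
  (coord i).smulRight (EuclideanSpace.single j 1) - (coord j).smulRight (EuclideanSpace.single i 1)

theorem rotationField_apply (i j : Fin d) (z : EuclideanSpace ℝ (Fin d)) :
    rotationField i j z = z i • EuclideanSpace.single j 1 - z j • EuclideanSpace.single i 1 :=
  rfl

theorem rotationField_mem_skewAdjoint (i j : Fin d) : rotationField i j ∈
    skewAdjoint (EuclideanSpace ℝ (Fin d) →L[ℝ] EuclideanSpace ℝ (Fin d)) := by
  rw [skewAdjoint.mem_iff, ContinuousLinearMap.star_eq_adjoint, eq_comm,
    ContinuousLinearMap.eq_adjoint_iff]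
  intro x y
  simp only [neg_apply, rotationField_apply, inner_neg_left, inner_sub_left, inner_sub_right,
    inner_smul_left, inner_smul_right, EuclideanSpace.inner_single_left,
    EuclideanSpace.inner_single_right]
  simp
  ring

/-- The sum of the squares of the infinitesimal rotations, applied to a two-jet. -/
theorem sum_rotationField
    (B : EuclideanSpace ℝ (Fin d) →L[ℝ] EuclideanSpace ℝ (Fin d) →L[ℝ] F)
    (hB : ∀ u v, B u v = B v u) (l : EuclideanSpace ℝ (Fin d) →L[ℝ] F)
    (z : EuclideanSpace ℝ (Fin d)) :
    ∑ i, ∑ j, (B (rotationField i j z) (rotationField i j z) +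
        l (rotationField i j (rotationField i j z))) =
      (2 : ℝ) • (‖z‖ ^ 2 • ∑ i, B (EuclideanSpace.single i 1) (EuclideanSpace.single i 1)
        - B z z - ((d : ℝ) - 1) • l z) := by
  have hz : z = ∑ i, z i • EuclideanSpace.single i (1 : ℝ) := by
    have h1 := (EuclideanSpace.basisFun (Fin d) ℝ).sum_repr z
    simpa using h1.symm
  have hl : l z = ∑ i, z i • l (EuclideanSpace.single i 1) := by
    conv_lhs => rw [hz]
    simp
  have hBz : B z z = ∑ i, ∑ j, (z i * z j) •
      B (EuclideanSpace.single i 1) (EuclideanSpace.single j 1) := by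
    conv_lhs => rw [hz]
    simp only [map_sum, sum_apply, map_smul, smul_apply, Finset.smul_sum, smul_smul]
    rw [Finset.sum_comm]
    exact Finset.sum_congr rfl fun i _ => Finset.sum_congr rfl fun j _ => by rw [mul_comm]
  have hn : ‖z‖ ^ 2 = ∑ i, z i * z i := by
    rw [EuclideanSpace.norm_sq_eq]
    simp [sq]
  have e1 : ∀ i j, B (rotationField i j z) (rotationField i j z) =
      (z i * z i) • B (EuclideanSpace.single j 1) (EuclideanSpace.single j 1)
      + (z j * z j) • B (EuclideanSpace.single i 1) (EuclideanSpace.single i 1)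
      - (2 : ℝ) • (z i * z j) • B (EuclideanSpace.single i 1) (EuclideanSpace.single j 1) := by
    intro i j
    simp only [rotationField_apply, map_sub, map_smul, sub_apply, smul_apply, smul_sub, smul_smul]
    rw [hB (EuclideanSpace.single j 1) (EuclideanSpace.single i 1), mul_comm (z j) (z i)]
    module
  have e2 : ∀ i j, l (rotationField i j (rotationField i j z)) =
      (if i = j then (2 * z i) • l (EuclideanSpace.single i 1) else 0)
      - z j • l (EuclideanSpace.single j 1) - z i • l (EuclideanSpace.single i 1) := by
    intro i j
    rw [rotationField_apply, rotationField_apply]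
    by_cases h : i = j
    · subst h
      simp
      module
    · simp [h, Ne.symm h]
  have s1 : ∑ i, ∑ j, (z i * z i) • B (EuclideanSpace.single j 1) (EuclideanSpace.single j 1) =
      ‖z‖ ^ 2 • ∑ i, B (EuclideanSpace.single i 1) (EuclideanSpace.single i 1) := by
    rw [hn, Finset.sum_smul_sum]
  have s2 : ∑ i, ∑ j, (z j * z j) • B (EuclideanSpace.single i 1) (EuclideanSpace.single i 1) =
      ‖z‖ ^ 2 • ∑ i, B (EuclideanSpace.single i 1) (EuclideanSpace.single i 1) := by
    rw [Finset.sum_comm, s1]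
  have s3 : ∑ i, ∑ j, (2 : ℝ) • (z i * z j) •
      B (EuclideanSpace.single i 1) (EuclideanSpace.single j 1) = (2 : ℝ) • B z z := by
    rw [hBz]
    simp only [Finset.smul_sum]
  have s4 : ∑ i, (2 * z i) • l (EuclideanSpace.single i 1) = (2 : ℝ) • l z := by
    rw [hl, Finset.smul_sum]
    simp only [smul_smul]
  simp only [e1, e2, Finset.sum_add_distrib, Finset.sum_sub_distrib, Finset.sum_ite_eq,
    Finset.mem_univ, if_true]
  rw [s1, s2, s3, s4]
  simp only [Finset.sum_const, Finset.card_univ, Fintype.card_fin, ← Finset.smul_sum, ← hl]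
  rw [← Nat.cast_smul_eq_nsmul ℝ]
  module

/-- The mean over the sphere of radius `r` of the spherical part `r² Δw - ∂²w(z, z) - (d - 1) ∂w(z)` of
the Laplacian vanishes, since it is half the sum of the squares of the infinitesimal rotations. -/
theorem integral_sphere_laplacian {r : ℝ} {w : EuclideanSpace ℝ (Fin d) → F}
    {W : Set (EuclideanSpace ℝ (Fin d))} (hW : IsOpen W) (hw : ContDiffOn ℝ ∞ w W)
    (hr : ∀ v : sphere (0 : EuclideanSpace ℝ (Fin d)) 1, r • (v : EuclideanSpace ℝ (Fin d)) ∈ W) :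
    ∫ v : sphere (0 : EuclideanSpace ℝ (Fin d)) 1,
      (r ^ 2 • ∑ i, fderiv ℝ (fderiv ℝ w) (r • (v : EuclideanSpace ℝ (Fin d)))
          (EuclideanSpace.single i 1) (EuclideanSpace.single i 1)
        - fderiv ℝ (fderiv ℝ w) (r • (v : EuclideanSpace ℝ (Fin d)))
          (r • (v : EuclideanSpace ℝ (Fin d))) (r • (v : EuclideanSpace ℝ (Fin d)))
        - ((d : ℝ) - 1) • fderiv ℝ w (r • (v : EuclideanSpace ℝ (Fin d)))
          (r • (v : EuclideanSpace ℝ (Fin d)))) ∂sphereMeasure _ = 0 := by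
  have h1 : Continuous fun v : sphere (0 : EuclideanSpace ℝ (Fin d)) 1 =>
      fderiv ℝ w (r • (v : EuclideanSpace ℝ (Fin d))) :=
    (hw.continuousOn_fderiv_of_isOpen hW (by simp)).comp_continuous (by fun_prop) hr
  have h2 : Continuous fun v : sphere (0 : EuclideanSpace ℝ (Fin d)) 1 =>
      fderiv ℝ (fderiv ℝ w) (r • (v : EuclideanSpace ℝ (Fin d))) :=
    ((hw.fderiv_of_isOpen (m := ∞) hW le_rfl).continuousOn_fderiv_of_isOpen hW
      (by simp)).comp_continuous (by fun_prop) hr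
  have hX : ∀ i j, Continuous fun v : sphere (0 : EuclideanSpace ℝ (Fin d)) 1 =>
      fderiv ℝ (fderiv ℝ w) (r • (v : EuclideanSpace ℝ (Fin d)))
        (rotationField i j (r • (v : EuclideanSpace ℝ (Fin d))))
        (rotationField i j (r • (v : EuclideanSpace ℝ (Fin d)))) +
      fderiv ℝ w (r • (v : EuclideanSpace ℝ (Fin d)))
        (rotationField i j (rotationField i j (r • (v : EuclideanSpace ℝ (Fin d))))) := by
    intro i j
    exact ((h2.clm_apply (by fun_prop)).clm_apply (by fun_prop)).add (h1.clm_apply (by fun_prop))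
  have h3 : ∫ v : sphere (0 : EuclideanSpace ℝ (Fin d)) 1, ∑ i, ∑ j,
      (fderiv ℝ (fderiv ℝ w) (r • (v : EuclideanSpace ℝ (Fin d)))
        (rotationField i j (r • (v : EuclideanSpace ℝ (Fin d))))
        (rotationField i j (r • (v : EuclideanSpace ℝ (Fin d)))) +
      fderiv ℝ w (r • (v : EuclideanSpace ℝ (Fin d)))
        (rotationField i j (rotationField i j (r • (v : EuclideanSpace ℝ (Fin d))))))
        ∂sphereMeasure _ = 0 := by
    rw [integral_finsetSum]
    · refine Finset.sum_eq_zero fun i _ => ?_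
      rw [integral_finsetSum]
      · exact Finset.sum_eq_zero fun j _ => integral_fderiv_fderiv_skewAdjoint
          (rotationField_mem_skewAdjoint i j) hW hw hr
      · exact fun j _ => integrable_of_continuous (hX i j)
    · exact fun i _ => integrable_of_continuous (continuous_finsetSum _ fun j _ => hX i j)
  have h4 : ∀ v : sphere (0 : EuclideanSpace ℝ (Fin d)) 1, _ := fun v =>
    sum_rotationField (fderiv ℝ (fderiv ℝ w) (r • (v : EuclideanSpace ℝ (Fin d))))
      (fun a b => (hw.contDiffAt (hW.mem_nhds (hr v))).isSymmSndFDerivAt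
        (by simpa using ENat.LEInfty.out) a b) (fderiv ℝ w (r • (v : EuclideanSpace ℝ (Fin d))))
      (r • (v : EuclideanSpace ℝ (Fin d)))
  simp only [h4] at h3
  rw [integral_smul, smul_eq_zero] at h3
  have h5 := h3.resolve_left two_ne_zero
  have h6 : ∀ v : sphere (0 : EuclideanSpace ℝ (Fin d)) 1,
      ‖r • (v : EuclideanSpace ℝ (Fin d))‖ ^ 2 = r ^ 2 := by
    intro v
    rw [norm_smul, norm_eq_of_mem_sphere, mul_one, Real.norm_eq_abs, sq_abs]
  simpa only [h6] using h5

end SphericalLaplacian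

/-! ### The ball model -/

section Ball

variable {d : ℕ}

/-- Polar coordinates on the ball model: a point at Euclidean distance `r` from the centre has
hyperbolic distance `2 artanh r`. -/
def ballPolar (z : EuclideanSpace ℝ (Fin d)) : ℝ × EuclideanSpace ℝ (Fin d) :=
  (Real.log (1 + ‖z‖) - Real.log (1 - ‖z‖), ‖z‖⁻¹ • z)

/-- The conformal factor of the ball model of hyperbolic space. -/
def ballFactor (z : EuclideanSpace ℝ (Fin d)) : ℝ := 2 / (1 - ‖z‖ ^ 2)

theorem isOpen_puncturedBall :
    IsOpen (ball (0 : EuclideanSpace ℝ (Fin d)) 1 \ {0}) :=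
  isOpen_ball.sdiff isClosed_singleton

theorem norm_of_mem_puncturedBall {z : EuclideanSpace ℝ (Fin d)} (hz : z ∈ ball 0 1 \ {0}) :
    0 < ‖z‖ ∧ ‖z‖ < 1 :=
  ⟨norm_pos_iff.2 hz.2, mem_ball_zero_iff.1 hz.1⟩

theorem ballFactor_pos {z : EuclideanSpace ℝ (Fin d)} (hz : z ∈ ball 0 1 \ {0}) :
    0 < ballFactor z := by
  obtain ⟨h0, h1⟩ := norm_of_mem_puncturedBall hz
  exact div_pos two_pos (by nlinarith)

theorem contDiffAt_ballPolar {z : EuclideanSpace ℝ (Fin d)} (hz : z ∈ ball 0 1 \ {0}) :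
    ContDiffAt ℝ ∞ ballPolar z := by
  obtain ⟨h0, h1⟩ := norm_of_mem_puncturedBall hz
  have hn : ContDiffAt ℝ ∞ (fun z : EuclideanSpace ℝ (Fin d) => ‖z‖) z := contDiffAt_norm ℝ hz.2
  exact (((contDiffAt_const.add hn).log (by positivity)).sub
    ((contDiffAt_const.sub hn).log (by linarith))).prodMk ((hn.inv h0.ne').smul contDiffAt_id)

theorem fderiv_ballPolar {z : EuclideanSpace ℝ (Fin d)} (hz : z ∈ ball 0 1 \ {0})
    (v : EuclideanSpace ℝ (Fin d)) : fderiv ℝ ballPolar z v =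
      (ballFactor z * (inner ℝ z v / ‖z‖), ‖z‖⁻¹ • v - (inner ℝ z v / ‖z‖ ^ 3) • z) := by
  obtain ⟨h0, h1⟩ := norm_of_mem_puncturedBall hz
  have hl : HasDerivAt (fun r : ℝ => z + r • v) v 0 := by
    simpa using ((hasDerivAt_id (0 : ℝ)).smul_const v).const_add z
  have hn : HasDerivAt (fun r : ℝ => ‖z + r • v‖) (inner ℝ z v / ‖z‖) 0 := by
    have h2 := hl.norm_sq.sqrt (by simpa using h0.ne')
    simp only [Real.sqrt_sq (norm_nonneg _), zero_smul, add_zero] at h2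
    refine h2.congr_deriv ?_
    rw [mul_div_mul_left _ _ two_ne_zero]
  have hA := (hn.const_add 1).log (by simpa using by positivity)
  have hB := (hn.const_sub 1).log (by simpa using by linarith)
  have hC := (hn.inv (by simpa using h0.ne')).smul hl
  have h3 := hasDerivAt_line ((contDiffAt_ballPolar hz).differentiableAt (by simp)) v
  have h4 := h3.unique ((hA.sub hB).prodMk hC)
  rw [dirDeriv] at h4
  rw [h4]
  simp only [zero_smul, add_zero]
  have h5 : 1 - ‖z‖ ≠ 0 := by linarith
  have h6 : 1 + ‖z‖ ≠ 0 := by positivity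
  have h7 : 1 - ‖z‖ ^ 2 ≠ 0 := by
    have : 1 - ‖z‖ ^ 2 = (1 - ‖z‖) * (1 + ‖z‖) := by ring
    rw [this]; exact mul_ne_zero h5 h6
  refine Prod.ext ?_ ?_
  · simp only [ballFactor]
    field_simp
    ring
  · have h8 : -(inner ℝ z v / ‖z‖) / ‖z‖ ^ 2 = -(inner ℝ z v / ‖z‖ ^ 3) := by
      field_simp
    simp only [h8, neg_smul, sub_eq_add_neg, Pi.inv_apply, zero_smul, add_zero]

theorem sinh_ballPolar {z : EuclideanSpace ℝ (Fin d)} (hz : z ∈ ball 0 1 \ {0}) :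
    Real.sinh (ballPolar z).1 = ballFactor z * ‖z‖ := by
  obtain ⟨h0, h1⟩ := norm_of_mem_puncturedBall hz
  have h5 : 1 - ‖z‖ ≠ 0 := by linarith
  have h6 : 1 + ‖z‖ ≠ 0 := by positivity
  have h7 : 1 - ‖z‖ ^ 2 ≠ 0 := by
    have : 1 - ‖z‖ ^ 2 = (1 - ‖z‖) * (1 + ‖z‖) := by ring
    rw [this]; exact mul_ne_zero h5 h6
  rw [ballPolar, ← Real.log_div h6 h5, Real.sinh_log (div_pos (by positivity) (by linarith)),
    ballFactor]
  field_simp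
  ring

theorem hasFDerivAt_ballFactor_pow {z : EuclideanSpace ℝ (Fin d)} (hz : z ∈ ball 0 1 \ {0})
    (n : ℕ) : HasFDerivAt (fun y : EuclideanSpace ℝ (Fin d) => ballFactor y ^ n)
      ((n * ballFactor z ^ (n + 1)) • innerSL ℝ z) z := by
  obtain ⟨h0, h1⟩ := norm_of_mem_puncturedBall hz
  have h7 : 1 - ‖z‖ ^ 2 ≠ 0 := by nlinarith
  have h2 : HasFDerivAt (fun y : EuclideanSpace ℝ (Fin d) => ‖y‖ ^ 2) (2 • innerSL ℝ z) z :=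
    (hasStrictFDerivAt_norm_sq z).hasFDerivAt
  have h3 : HasDerivAt (fun x : ℝ => (2 / (1 - x)) ^ n)
      (n * (2 / (1 - ‖z‖ ^ 2)) ^ (n - 1) * (2 / (1 - ‖z‖ ^ 2) ^ 2)) (‖z‖ ^ 2) := by
    have := ((hasDerivAt_const (‖z‖ ^ 2) (2 : ℝ)).div
      ((hasDerivAt_id (‖z‖ ^ 2)).const_sub 1) h7).pow n
    refine this.congr_deriv ?_
    simp
  refine (h3.comp_hasFDerivAt z h2).congr_fderiv ?_
  rw [← Nat.cast_smul_eq_nsmul ℝ, smul_smul, ballFactor]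
  congr 1
  rcases n with _ | n
  · simp
  · have h4 : (2 / (1 - ‖z‖ ^ 2)) ^ (n + 1 + 1) =
        (2 / (1 - ‖z‖ ^ 2)) ^ n * (4 / (1 - ‖z‖ ^ 2) ^ 2) := by
      rw [show (4 : ℝ) / (1 - ‖z‖ ^ 2) ^ 2 = (2 / (1 - ‖z‖ ^ 2)) ^ 2 by rw [div_pow]; norm_num]
      ring
    rw [Nat.add_sub_cancel, h4]
    push_cast
    ring

variable {M : Type*} [TopologicalSpace M] [ChartedSpace (EuclideanSpace ℝ (Fin d)) M]
  [IsManifold (𝓡 d) ∞ M] [Bundle.RiemannianBundle (fun x : M => TangentSpace (𝓡 d) x)]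
  [IsContMDiffRiemannianBundle (𝓡 d) ∞ (EuclideanSpace ℝ (Fin d))
    (fun x : M => TangentSpace (𝓡 d) x)] [T2Space M] [CompactSpace M]
  {Γ : EuclideanSpace ℝ (Fin d) → ℝ → M} {x : M}
  {L : EuclideanSpace ℝ (Fin d) →L[ℝ] EuclideanSpace ℝ (Fin d)}
  {F : Type*} [NormedAddCommGroup F] [NormedSpace ℝ F] {φ : M → F} {lam : ℝ}

theorem IsPolarFamily.contMDiffOn_ball (h : IsPolarFamily Γ x L) :
    ContMDiffOn (𝓡 d) (𝓡 d) ∞ (polarMap Γ ∘ ballPolar) (ball 0 1 \ {0}) := fun z hz =>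
  (h.contMDiff.contMDiffAt.comp z (contDiffAt_ballPolar hz).contMDiffAt).contMDiffWithinAt

/-- The exponential map at `x` is a local isometry from the ball model of hyperbolic space. -/
theorem IsPolarFamily.pullbackInner_ball (h : IsPolarFamily Γ x L)
    (hM : HasConstantSectionalCurvature (d := d) M (-1)) {z : EuclideanSpace ℝ (Fin d)}
    (hz : z ∈ ball 0 1 \ {0}) (v : EuclideanSpace ℝ (Fin d)) :
    pullbackInner (d := d) (polarMap Γ ∘ ballPolar) z v v = ballFactor z ^ 2 * inner ℝ v v := by
  obtain ⟨h0, h1⟩ := norm_of_mem_puncturedBall hz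
  have hcomp : pullbackInner (d := d) (polarMap Γ ∘ ballPolar) z v v =
      pullbackInner (d := d) (polarMap Γ) (ballPolar z) (fderiv ℝ ballPolar z v)
        (fderiv ℝ ballPolar z v) := by
    rw [pullbackInner, mfderiv_comp z
      ((h.contMDiff.contMDiffAt (x := ballPolar z)).mdifferentiableAt (by simp))
      (((contDiffAt_ballPolar hz).differentiableAt (by simp)).mdifferentiableAt), mfderiv_eq_fderiv]
    rfl
  have hzz : inner ℝ z z = ‖z‖ ^ 2 := real_inner_self_eq_norm_sq z
  have hpol := h.pullbackInner_polar hM (ξ := ‖z‖⁻¹ • z)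
    (k := ‖z‖⁻¹ • v - (inner ℝ z v / ‖z‖ ^ 3) • z) ?_ ?_ (ballPolar z).1
    (ballFactor z * (inner ℝ z v / ‖z‖))
  · rw [hcomp, fderiv_ballPolar hz]
    refine hpol.trans ?_
    rw [sinh_ballPolar hz]
    simp only [inner_sub_left, inner_sub_right, real_inner_smul_left, real_inner_smul_right, hzz,
      real_inner_comm z v]
    field_simp
    ring
  · rw [real_inner_smul_left, real_inner_smul_right, hzz]
    field_simp
  · rw [real_inner_smul_left, inner_sub_right, real_inner_smul_right, real_inner_smul_right, hzz]
    field_simp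
    ring

/-- A Laplace eigenfunction solves the hyperbolic eigenvalue equation in the ball model. -/
theorem IsPolarFamily.laplace_ball (h : IsPolarFamily Γ x L) (hd : 2 ≤ d)
    (hM : HasConstantSectionalCurvature (d := d) M (-1))
    (hφ : IsLaplaceEigenfunction (d := d) φ lam) {z : EuclideanSpace ℝ (Fin d)}
    (hz : z ∈ ball 0 1 \ {0}) :
    ∑ i, fderiv ℝ (fderiv ℝ (φ ∘ polarMap Γ ∘ ballPolar)) z (EuclideanSpace.single i 1)
        (EuclideanSpace.single i 1) +
      (((d : ℝ) - 2) * ballFactor z) • fderiv ℝ (φ ∘ polarMap Γ ∘ ballPolar) z z =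
      -(lam * ballFactor z ^ 2) • (φ ∘ polarMap Γ ∘ ballPolar) z := by
  have h1 := hφ.conformal isOpen_puncturedBall h.contMDiffOn_ball (ρ := ballFactor) hd
    (fun y hy => ballFactor_pos hy) (fun y hy v => h.pullbackInner_ball hM hy v) hz
  set u := φ ∘ polarMap Γ ∘ ballPolar with hu
  have hus : ContDiffAt ℝ ∞ u z :=
    ((hφ.smooth.contMDiffAt.comp z
      (h.contMDiffOn_ball.contMDiffAt (isOpen_puncturedBall.mem_nhds hz)))).contDiffAt
  have h2 : ∀ i, pd i (fun y => (ballFactor y ^ (d - 2)) • pd i u y) z =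
      ballFactor z ^ (d - 2) • (fderiv ℝ (fderiv ℝ u) z (EuclideanSpace.single i 1)
        (EuclideanSpace.single i 1) + (((d : ℝ) - 2) * ballFactor z * z i) •
          fderiv ℝ u z (EuclideanSpace.single i 1)) := by
    intro i
    have e1 : HasFDerivAt (pd i u) _ z :=
      (((hus.fderiv_right (m := ∞) le_rfl).differentiableAt (by simp)).hasFDerivAt).clm_apply
        (hasFDerivAt_const (EuclideanSpace.single i (1 : ℝ)) z)
    have e2 : HasFDerivAt (fun y => (ballFactor y ^ (d - 2)) • pd i u y) _ z :=
      (hasFDerivAt_ballFactor_pow hz (d - 2)).smul e1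
    rw [pd, e2.fderiv]
    simp only [add_apply, smul_apply, ContinuousLinearMap.smulRight_apply, innerSL_apply_apply,
      EuclideanSpace.inner_single_right, ContinuousLinearMap.comp_apply,
      ContinuousLinearMap.flip_apply, zero_apply, map_zero, zero_add, pd, Nat.cast_sub hd]
    simp
    module
  have hz' : z = ∑ i, z i • EuclideanSpace.single i (1 : ℝ) := by
    have h1 := (EuclideanSpace.basisFun (Fin d) ℝ).sum_repr z
    simpa using h1.symm
  have h3 : fderiv ℝ u z z = ∑ i, z i • fderiv ℝ u z (EuclideanSpace.single i 1) := by
    refine (congrArg (fderiv ℝ u z) hz').trans ?_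
    simp only [map_sum, map_smul]
  have hρ := ballFactor_pos hz
  have hpow : ballFactor z ^ d = ballFactor z ^ (d - 2) * ballFactor z ^ 2 := by
    rw [← pow_add, Nat.sub_add_cancel hd]
  simp only [h2] at h1
  rw [← Finset.smul_sum, hpow, show -(lam * (ballFactor z ^ (d - 2) * ballFactor z ^ 2)) =
    ballFactor z ^ (d - 2) * -(lam * ballFactor z ^ 2) by ring, mul_smul] at h1
  have h4 := smul_right_injective F (pow_pos hρ (d - 2)).ne' h1
  have h5 : u z = φ ((polarMap Γ ∘ ballPolar) z) := rfl
  rw [h5, h3, Finset.smul_sum, ← Finset.sum_add_distrib]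
  simpa only [smul_smul] using h4

end Ball

/-! ### The radial eigenvalue equation -/

section RadialEquation

variable {F F₁ : Type*} [NormedAddCommGroup F] [NormedSpace ℝ F] [NormedAddCommGroup F₁]
  [NormedSpace ℝ F₁] {m lam : ℝ}

/-- The radial eigenvalue equation `f'' + m coth t f' + λ f = 0` on hyperbolic space of dimension
`m + 1`, multiplied by `sinh t` so that it makes sense at `t = 0`. -/
structure IsRadialSolution (m lam : ℝ) (f f' f'' : ℝ → F) : Prop where
  hasDerivAt : ∀ t, HasDerivAt f (f' t) t
  hasDerivAt_deriv : ∀ t, HasDerivAt f' (f'' t) t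
  eqn : ∀ t, 0 ≤ t →
    Real.sinh t • f'' t + (m * Real.cosh t) • f' t + (lam * Real.sinh t) • f t = 0

namespace IsRadialSolution

variable {f f' f'' g g' g'' : ℝ → F}

theorem clm_comp (h : IsRadialSolution m lam f f' f'') (T : F →L[ℝ] F₁) :
    IsRadialSolution m lam (fun t => T (f t)) (fun t => T (f' t)) (fun t => T (f'' t)) where
  hasDerivAt t := T.hasFDerivAt.comp_hasDerivAt t (h.hasDerivAt t)
  hasDerivAt_deriv t := T.hasFDerivAt.comp_hasDerivAt t (h.hasDerivAt_deriv t)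
  eqn t ht := by
    have := congrArg T (h.eqn t ht)
    simpa using this

theorem sub (h : IsRadialSolution m lam f f' f'') (hg : IsRadialSolution m lam g g' g'') :
    IsRadialSolution m lam (fun t => f t - g t) (fun t => f' t - g' t)
      (fun t => f'' t - g'' t) where
  hasDerivAt t := (h.hasDerivAt t).sub (hg.hasDerivAt t)
  hasDerivAt_deriv t := (h.hasDerivAt_deriv t).sub (hg.hasDerivAt_deriv t)
  eqn t ht := by
    have h1 := h.eqn t ht
    have h2 := hg.eqn t ht
    calc _ = (Real.sinh t • f'' t + (m * Real.cosh t) • f' t + (lam * Real.sinh t) • f t)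
        - (Real.sinh t • g'' t + (m * Real.cosh t) • g' t + (lam * Real.sinh t) • g t) := by module
      _ = 0 := by rw [h1, h2, sub_zero]

theorem deriv_zero (h : IsRadialSolution m lam f f' f'') (hm : 0 < m) : f' 0 = 0 := by
  have := h.eqn 0 le_rfl
  simpa [hm.ne'] using this

theorem eq_zero_real {f f' f'' : ℝ → ℝ} (h : IsRadialSolution m lam f f' f'') (hm : 0 < m)
    (h0 : f 0 = 0) {t : ℝ} (ht : 0 ≤ t) : f t = 0 := by
  -- the energy `f'² + f²` satisfies a Gronwall inequality since `coth ≥ 0`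
  set K := |1 - lam| with hK
  have hd : ∀ s, HasDerivAt (fun s => Real.exp (-(K * s)) * (f' s ^ 2 + f s ^ 2))
      (Real.exp (-(K * s)) * (2 * f' s * (f'' s + f s) - K * (f' s ^ 2 + f s ^ 2))) s := by
    intro s
    have e1 : HasDerivAt (fun s => Real.exp (-(K * s))) (Real.exp (-(K * s)) * -(K * 1)) s :=
      (((hasDerivAt_id s).const_mul K).neg).exp
    refine (e1.mul (((h.hasDerivAt_deriv s).pow 2).add ((h.hasDerivAt s).pow 2))).congr_deriv ?_
    simp
    ring
  have hanti : AntitoneOn (fun s => Real.exp (-(K * s)) * (f' s ^ 2 + f s ^ 2)) (Ici 0) := by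
    refine antitoneOn_of_deriv_nonpos (convex_Ici 0)
      (fun s _ => (hd s).continuousAt.continuousWithinAt)
      (fun s _ => (hd s).differentiableAt.differentiableWithinAt) fun s hs => ?_
    rw [interior_Ici] at hs
    have hs0 : 0 < s := hs
    rw [(hd s).deriv]
    refine mul_nonpos_of_nonneg_of_nonpos (Real.exp_pos _).le ?_
    have hsinh := Real.sinh_pos_iff.2 hs0
    have hcosh := Real.cosh_pos s
    have e := h.eqn s hs0.le
    simp only [smul_eq_mul] at e
    have e2 : Real.sinh s * (2 * f' s * (f'' s + f s) - K * (f' s ^ 2 + f s ^ 2)) =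
        -(2 * m * Real.cosh s * f' s ^ 2)
          + Real.sinh s * (2 * (1 - lam) * (f' s * f s) - K * (f' s ^ 2 + f s ^ 2)) := by
      linear_combination 2 * f' s * e
    have e3 : 2 * (1 - lam) * (f' s * f s) ≤ K * (f' s ^ 2 + f s ^ 2) := by
      calc 2 * (1 - lam) * (f' s * f s) ≤ |2 * (1 - lam) * (f' s * f s)| := le_abs_self _
        _ = K * (2 * (|f' s| * |f s|)) := by
          rw [abs_mul, abs_mul, abs_mul, abs_two, hK]; ring
        _ ≤ K * (f' s ^ 2 + f s ^ 2) := by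
          refine mul_le_mul_of_nonneg_left ?_ (abs_nonneg _)
          rw [← sq_abs (f' s), ← sq_abs (f s)]
          nlinarith [sq_nonneg (|f' s| - |f s|)]
    have e4 : Real.sinh s * (2 * f' s * (f'' s + f s) - K * (f' s ^ 2 + f s ^ 2)) ≤ 0 := by
      rw [e2]
      have p1 : 0 ≤ 2 * m * Real.cosh s * f' s ^ 2 := by positivity
      have p2 := mul_nonpos_of_nonneg_of_nonpos hsinh.le (sub_nonpos.2 e3)
      linarith
    exact nonpos_of_mul_nonpos_right e4 hsinh
  have h1 := hanti (mem_Ici.2 le_rfl) (mem_Ici.2 ht) ht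
  simp only [h0, h.deriv_zero hm] at h1
  have h2 : Real.exp (-(K * t)) * (f' t ^ 2 + f t ^ 2) ≤ 0 := by simpa using h1
  have h3 : f' t ^ 2 + f t ^ 2 ≤ 0 := nonpos_of_mul_nonpos_right h2 (Real.exp_pos _)
  nlinarith [sq_nonneg (f' t), sq_nonneg (f t)]

/-- The radial equation has at most one solution with given value at `0` which is regular there. -/
theorem eq_of_eq_zero (h : IsRadialSolution m lam f f' f'') (hg : IsRadialSolution m lam g g' g'')
    (hm : 0 < m) (h0 : f 0 = g 0) {t : ℝ} (ht : 0 ≤ t) : f t = g t := by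
  rw [← sub_eq_zero]
  refine SeparatingDual.eq_zero_of_forall_dual_eq_zero (R := ℝ) fun T => ?_
  exact ((h.sub hg).clm_comp T).eq_zero_real hm (by simp [h0]) ht

/-- For negative `lam` a radial solution which is positive at `0` increases near `0`, because
`(sinhⁿ f')' = -lam sinhⁿ f > 0`. -/
theorem nonneg_of_le {f f' f'' : ℝ → ℝ} {n : ℕ} (hn : n ≠ 0) (h : IsRadialSolution n lam f f' f'')
    (h0 : 0 < f 0) (hle : ∀ t, 0 ≤ t → f t ≤ f 0) : 0 ≤ lam := by
  by_contra! hlam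
  obtain ⟨δ, hδ, hpos⟩ : ∃ δ > 0, ∀ t, |t| < δ → 0 < f t := by
    have := (h.hasDerivAt 0).continuousAt.eventually (lt_mem_nhds h0)
    obtain ⟨δ, hδ, hb⟩ := Metric.eventually_nhds_iff.1 this
    exact ⟨δ, hδ, fun t ht => hb (by simpa using ht)⟩
  have hd : ∀ s, HasDerivAt (fun s => Real.sinh s ^ n * f' s)
      (n * Real.sinh s ^ (n - 1) * Real.cosh s * f' s + Real.sinh s ^ n * f'' s) s := fun s =>
    ((Real.hasDerivAt_sinh s).pow n).mul (h.hasDerivAt_deriv s)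
  have hmono : StrictMonoOn (fun s => Real.sinh s ^ n * f' s) (Icc 0 (δ / 2)) := by
    refine strictMonoOn_of_deriv_pos (convex_Icc 0 _)
      (fun s _ => (hd s).continuousAt.continuousWithinAt) fun s hs => ?_
    rw [interior_Icc] at hs
    have hsinh := Real.sinh_pos_iff.2 hs.1
    have hfs := hpos s (by rw [abs_of_pos hs.1]; linarith [hs.2])
    rw [(hd s).deriv]
    have e := h.eqn s hs.1.le
    simp only [smul_eq_mul] at e
    have hpow : Real.sinh s ^ n = Real.sinh s ^ (n - 1) * Real.sinh s := by
      rw [← pow_succ, Nat.sub_add_cancel (Nat.one_le_iff_ne_zero.2 hn)]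
    have e2 : n * Real.sinh s ^ (n - 1) * Real.cosh s * f' s + Real.sinh s ^ n * f'' s =
        (-lam) * (Real.sinh s ^ n * f s) := by
      rw [hpow]
      linear_combination Real.sinh s ^ (n - 1) * e
    rw [e2]
    have : 0 < -lam := by linarith
    positivity
  have hf' : ∀ s ∈ Ioc 0 (δ / 2), 0 < f' s := by
    intro s hs
    have h1 := hmono ⟨le_rfl, by positivity⟩ ⟨hs.1.le, hs.2⟩ hs.1
    simp only [Real.sinh_zero, zero_pow hn, zero_mul] at h1
    exact pos_of_mul_pos_right h1 (pow_pos (Real.sinh_pos_iff.2 hs.1) n).le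
  have hmono' : StrictMonoOn f (Icc 0 (δ / 2)) := by
    refine strictMonoOn_of_deriv_pos (convex_Icc 0 _)
      (fun s _ => (h.hasDerivAt s).continuousAt.continuousWithinAt) fun s hs => ?_
    rw [interior_Icc] at hs
    rw [(h.hasDerivAt s).deriv]
    exact hf' s ⟨hs.1, hs.2.le⟩
  have h1 := hmono' ⟨le_rfl, by positivity⟩ ⟨by positivity, le_rfl⟩ (half_pos hδ)
  exact (hle _ (half_pos hδ).le).not_gt h1

end IsRadialSolution

end RadialEquation

/-! ### Spherical means solve the radial equation -/

section PolarMean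

variable {d : ℕ} {M : Type*} [TopologicalSpace M] [ChartedSpace (EuclideanSpace ℝ (Fin d)) M]
  [IsManifold (𝓡 d) ∞ M] [Bundle.RiemannianBundle (fun x : M => TangentSpace (𝓡 d) x)]
  [IsContMDiffRiemannianBundle (𝓡 d) ∞ (EuclideanSpace ℝ (Fin d))
    (fun x : M => TangentSpace (𝓡 d) x)] [T2Space M] [CompactSpace M]
  {Γ : EuclideanSpace ℝ (Fin d) → ℝ → M} {x : M}
  {L : EuclideanSpace ℝ (Fin d) →L[ℝ] EuclideanSpace ℝ (Fin d)}
  {F : Type*} [NormedAddCommGroup F] [NormedSpace ℝ F] {φ : M → F} {lam : ℝ}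

/-- The mean of `φ` over the geodesic sphere of radius `t`. -/
def polarMean (Γ : EuclideanSpace ℝ (Fin d) → ℝ → M) (φ : M → F) (t : ℝ) : F :=
  ∫ v : sphere (0 : EuclideanSpace ℝ (Fin d)) 1, φ (polarMap Γ (t, v)) ∂sphereMeasure _

/-- The Euclidean radius, in the ball model, of the hyperbolic sphere of radius `t`; this is
`tanh (t / 2)`. -/
def ballRadius (t : ℝ) : ℝ := Real.sinh t / (1 + Real.cosh t)

theorem hasDerivAt_ballRadius (t : ℝ) : HasDerivAt ballRadius (1 + Real.cosh t)⁻¹ t := by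
  have h0 : 1 + Real.cosh t ≠ 0 := by have := Real.cosh_pos t; positivity
  refine ((Real.hasDerivAt_sinh t).div ((Real.hasDerivAt_cosh t).const_add 1) h0).congr_deriv ?_
  have := Real.cosh_sq t
  field_simp
  linear_combination this

theorem ballRadius_mem {t : ℝ} (ht : 0 < t) : 0 < ballRadius t ∧ ballRadius t < 1 := by
  have h1 := Real.cosh_pos t
  have h2 := Real.sinh_pos_iff.2 ht
  have h3 := Real.sinh_lt_cosh t
  exact ⟨by unfold ballRadius; positivity, (div_lt_one (by positivity)).2 (by linarith)⟩

theorem one_sub_ballRadius_sq (t : ℝ) : 1 - ballRadius t ^ 2 = 2 / (1 + Real.cosh t) := by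
  have h0 : 1 + Real.cosh t ≠ 0 := by have := Real.cosh_pos t; positivity
  have := Real.cosh_sq t
  rw [ballRadius]
  field_simp
  linear_combination this

theorem log_ballRadius {t : ℝ} (ht : 0 < t) :
    Real.log (1 + ballRadius t) - Real.log (1 - ballRadius t) = t := by
  obtain ⟨h0, h1⟩ := ballRadius_mem ht
  have hc : 1 + Real.cosh t ≠ 0 := by have := Real.cosh_pos t; positivity
  have h2 : (1 + ballRadius t) / (1 - ballRadius t) = Real.exp t := by
    have h3 : 1 - ballRadius t ≠ 0 := by linarith
    have h4 : 1 + Real.cosh t - Real.sinh t ≠ 0 := by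
      have := Real.sinh_lt_cosh t
      linarith
    have := Real.cosh_sq t
    rw [div_eq_iff h3, ← Real.cosh_add_sinh, ballRadius]
    field_simp
    linear_combination -this
  rw [← Real.log_div (by positivity) (by linarith), h2, Real.log_exp]

theorem smul_sphere_mem_puncturedBall {t : ℝ} (ht : 0 < t)
    (v : sphere (0 : EuclideanSpace ℝ (Fin d)) 1) :
    ballRadius t • (v : EuclideanSpace ℝ (Fin d)) ∈ ball 0 1 \ {0} := by
  obtain ⟨h0, h1⟩ := ballRadius_mem ht
  have hn : ‖ballRadius t • (v : EuclideanSpace ℝ (Fin d))‖ = ballRadius t := by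
    rw [norm_smul, norm_eq_of_mem_sphere, mul_one, Real.norm_of_nonneg h0.le]
  exact ⟨by rw [mem_ball_zero_iff, hn]; exact h1, fun h => by
    rw [mem_singleton_iff] at h; rw [h, norm_zero] at hn; exact h0.ne hn⟩

theorem ballPolar_smul {t : ℝ} (ht : 0 < t) (v : sphere (0 : EuclideanSpace ℝ (Fin d)) 1) :
    ballPolar (ballRadius t • (v : EuclideanSpace ℝ (Fin d))) = (t, ↑v) := by
  obtain ⟨h0, h1⟩ := ballRadius_mem ht
  have hn : ‖ballRadius t • (v : EuclideanSpace ℝ (Fin d))‖ = ballRadius t := by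
    rw [norm_smul, norm_eq_of_mem_sphere, mul_one, Real.norm_of_nonneg h0.le]
  rw [ballPolar, hn, log_ballRadius ht, smul_smul, inv_mul_cancel₀ h0.ne', one_smul]

theorem ballFactor_smul {t : ℝ} (ht : 0 < t) (v : sphere (0 : EuclideanSpace ℝ (Fin d)) 1) :
    ballFactor (ballRadius t • (v : EuclideanSpace ℝ (Fin d))) = 1 + Real.cosh t := by
  obtain ⟨h0, h1⟩ := ballRadius_mem ht
  have hn : ‖ballRadius t • (v : EuclideanSpace ℝ (Fin d))‖ = ballRadius t := by
    rw [norm_smul, norm_eq_of_mem_sphere, mul_one, Real.norm_of_nonneg h0.le]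
  rw [ballFactor, hn, one_sub_ballRadius_sq]
  have := Real.cosh_pos t
  field_simp

/-- The relation between the radial derivatives and the eigenvalue equation in the ball model, at
one point: `A`, `B` and `S` stand for the second and first radial derivative and for the Laplacian
with respect to the Euclidean metric. -/
theorem radial_algebra {A B S U : F} {r s c D : ℝ} (hc0 : 1 + c ≠ 0) (hs : s = (1 + c) * r)
    (hc : c = 1 + (1 + c) * r ^ 2)
    (hpde : S + ((D - 2) * (1 + c)) • r • B = -(lam * (1 + c) ^ 2) • U) :
    s ^ 2 • ((1 + c)⁻¹ ^ 2 • A - (s * (1 + c)⁻¹ ^ 2) • B)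
      + ((D - 1) * (c * s)) • (1 + c)⁻¹ • B + (lam * s ^ 2) • U =
    (-1 : ℝ) • (r ^ 2 • S - r • r • A - (D - 1) • r • B) := by
  have hS : S = -(lam * (1 + c) ^ 2) • U - ((D - 2) * (1 + c) * r) • B := by
    rw [← hpde, smul_smul]; abel
  have k1 : s * (1 + c)⁻¹ = r := by rw [hs]; field_simp
  have c1 : s ^ 2 * (1 + c)⁻¹ ^ 2 = r ^ 2 := by rw [← mul_pow, k1]
  have c2 : s ^ 2 * (s * (1 + c)⁻¹ ^ 2) = r ^ 2 * s := by rw [← c1]; ring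
  have c3 : (D - 1) * (c * s) * (1 + c)⁻¹ = (D - 1) * (c * r) := by rw [← k1]; ring
  have c4 : (D - 1) * (c * r) - r ^ 2 * s - (D - 2) * (1 + c) * r ^ 3 = (D - 1) * r := by
    rw [hs]; linear_combination (D - 1) * r * hc
  have c5 : lam * s ^ 2 = lam * (1 + c) ^ 2 * r ^ 2 := by rw [hs]; ring
  rw [hS]
  simp only [smul_sub, smul_smul, c1, c2, c3, c5]
  rw [← c4]
  module

set_option maxHeartbeats 800000 in
/-- The spherical means of a Laplace eigenfunction solve the radial equation: in the ball model the
equation for the integrand holds up to the spherical part of the Laplacian, whose mean vanishes. -/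
theorem IsPolarFamily.exists_isRadialSolution (h : IsPolarFamily Γ x L) (hd : 2 ≤ d)
    (hM : HasConstantSectionalCurvature (d := d) M (-1))
    (hφ : IsLaplaceEigenfunction (d := d) φ lam) :
    ∃ f' f'' : ℝ → F, IsRadialSolution ((d : ℝ) - 1) lam (polarMean Γ φ) f' f'' := by
  set G : ℝ × EuclideanSpace ℝ (Fin d) → F := φ ∘ polarMap Γ with hG
  have hGs : ContDiff ℝ ∞ G := (hφ.smooth.comp h.contMDiff).contDiff
  set e : ℝ × EuclideanSpace ℝ (Fin d) := (1, 0) with he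
  have hG1 : ContDiff ℝ ∞ (dirDeriv e G) :=
    contDiff_iff_contDiffAt.2 fun p => contDiffAt_dirDeriv hGs.contDiffAt e
  have hG2 : ContDiff ℝ ∞ (dirDeriv e (dirDeriv e G)) :=
    contDiff_iff_contDiffAt.2 fun p => contDiffAt_dirDeriv hG1.contDiffAt e
  have hcs : ∀ {H : ℝ × EuclideanSpace ℝ (Fin d) → F}, ContDiff ℝ ∞ H → ∀ t : ℝ,
      Continuous fun v : sphere (0 : EuclideanSpace ℝ (Fin d)) 1 => H (t, v) := fun hH t =>
    hH.continuous.comp (by fun_prop)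
  have hder : ∀ H : ℝ × EuclideanSpace ℝ (Fin d) → F, ContDiff ℝ ∞ H →
      ContDiff ℝ ∞ (dirDeriv e H) → ∀ t, HasDerivAt
        (fun s => ∫ v : sphere (0 : EuclideanSpace ℝ (Fin d)) 1, H (s, v) ∂sphereMeasure _)
        (∫ v : sphere (0 : EuclideanSpace ℝ (Fin d)) 1, dirDeriv e H (t, v) ∂sphereMeasure _) t := by
    intro H hH hH' t
    refine hasDerivAt_integral_of_continuousOn isOpen_univ (fun s _ => hcs hH s) ?_
      (fun s _ v => hasDerivAt_fst (hH.contDiffAt.differentiableAt (by simp))) (mem_univ t)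
    exact (hH'.continuous.comp (by fun_prop)).continuousOn
  set f' : ℝ → F := fun t =>
    ∫ v : sphere (0 : EuclideanSpace ℝ (Fin d)) 1, dirDeriv e G (t, v) ∂sphereMeasure _
  set f'' : ℝ → F := fun t => ∫ v : sphere (0 : EuclideanSpace ℝ (Fin d)) 1,
    dirDeriv e (dirDeriv e G) (t, v) ∂sphereMeasure _
  have hf : ∀ t, HasDerivAt (polarMean Γ φ) (f' t) t := hder G hGs hG1
  have hf' : ∀ t, HasDerivAt f' (f'' t) t := hder _ hG1 hG2
  have hf'' : Continuous f'' := by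
    have hG3 : ContDiff ℝ ∞ (dirDeriv e (dirDeriv e (dirDeriv e G))) :=
      contDiff_iff_contDiffAt.2 fun p => contDiffAt_dirDeriv hG2.contDiffAt e
    exact continuous_iff_continuousAt.2 fun t => (hder _ hG2 hG3 t).continuousAt
  have hpos : ∀ t, 0 < t → Real.sinh t • f'' t + (((d : ℝ) - 1) * Real.cosh t) • f' t +
      (lam * Real.sinh t) • polarMean Γ φ t = 0 := by
    intro t ht
    set u : EuclideanSpace ℝ (Fin d) → F := φ ∘ polarMap Γ ∘ ballPolar with hu
    have hus : ContDiffOn ℝ ∞ u (ball 0 1 \ {0}) :=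
      (hφ.smooth.comp_contMDiffOn h.contMDiffOn_ball).contDiffOn
    have hus' : ContDiffOn ℝ ∞ (fderiv ℝ u) (ball 0 1 \ {0}) :=
      hus.fderiv_of_isOpen isOpen_puncturedBall le_rfl
    have hr0 := (ballRadius_mem ht).1
    have hc0 : 1 + Real.cosh t ≠ 0 := by have := Real.cosh_pos t; positivity
    have hsinh : Real.sinh t = (1 + Real.cosh t) * ballRadius t := by
      rw [ballRadius]; field_simp
    have hcosh : Real.cosh t = 1 + (1 + Real.cosh t) * ballRadius t ^ 2 := by
      have e := one_sub_ballRadius_sq t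
      rw [eq_div_iff hc0] at e
      linear_combination e
    have hGu : ∀ s, 0 < s → ∀ v : sphere (0 : EuclideanSpace ℝ (Fin d)) 1,
        G (s, v) = u (ballRadius s • (v : EuclideanSpace ℝ (Fin d))) := by
      intro s hs v
      simp only [hG, hu, Function.comp_apply, ballPolar_smul hs]
    have hline : ∀ s (v : sphere (0 : EuclideanSpace ℝ (Fin d)) 1), HasDerivAt
        (fun s => ballRadius s • (v : EuclideanSpace ℝ (Fin d)))
        ((1 + Real.cosh s)⁻¹ • (v : EuclideanSpace ℝ (Fin d))) s := fun s v =>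
      (hasDerivAt_ballRadius s).smul_const _
    have hG1u : ∀ s, 0 < s → ∀ v : sphere (0 : EuclideanSpace ℝ (Fin d)) 1,
        dirDeriv e G (s, v) = (1 + Real.cosh s)⁻¹ •
          fderiv ℝ u (ballRadius s • (v : EuclideanSpace ℝ (Fin d))) v := by
      intro s hs v
      have e1 := hasDerivAt_fst (t := s) (ξ := (v : EuclideanSpace ℝ (Fin d)))
        (hGs.contDiffAt.differentiableAt (by simp))
      have e2 := ((hus.contDiffAt (isOpen_puncturedBall.mem_nhds
        (smul_sphere_mem_puncturedBall hs v))).differentiableAt (by simp)).hasFDerivAt.comp_hasDerivAt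
          s (hline s v)
      have e3 : (fun r => G (r, (v : EuclideanSpace ℝ (Fin d)))) =ᶠ[𝓝 s]
          u ∘ fun r => ballRadius r • (v : EuclideanSpace ℝ (Fin d)) := by
        filter_upwards [lt_mem_nhds hs] with r hr using hGu r hr v
      rw [← map_smul]
      exact (e1.congr_of_eventuallyEq e3.symm).unique e2
    have hG2u : ∀ v : sphere (0 : EuclideanSpace ℝ (Fin d)) 1,
        dirDeriv e (dirDeriv e G) (t, v) = ((1 + Real.cosh t)⁻¹ ^ 2) •
          fderiv ℝ (fderiv ℝ u) (ballRadius t • (v : EuclideanSpace ℝ (Fin d))) v v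
          - (Real.sinh t * (1 + Real.cosh t)⁻¹ ^ 2) •
            fderiv ℝ u (ballRadius t • (v : EuclideanSpace ℝ (Fin d))) v := by
      intro v
      have e1 := hasDerivAt_fst (t := t) (ξ := (v : EuclideanSpace ℝ (Fin d)))
        (hG1.contDiffAt.differentiableAt (by simp))
      have e2 := (((hus'.contDiffAt (isOpen_puncturedBall.mem_nhds
        (smul_sphere_mem_puncturedBall ht v))).differentiableAt (by simp)).hasFDerivAt.comp_hasDerivAt
          t (hline t v)).clm_apply (hasDerivAt_const t (v : EuclideanSpace ℝ (Fin d)))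
      have e4 := (((Real.hasDerivAt_cosh t).const_add 1).inv hc0).smul e2
      have e3 : (fun r => dirDeriv e G (r, (v : EuclideanSpace ℝ (Fin d)))) =ᶠ[𝓝 t]
          fun r => (1 + Real.cosh r)⁻¹ •
            fderiv ℝ u (ballRadius r • (v : EuclideanSpace ℝ (Fin d))) v := by
        filter_upwards [lt_mem_nhds ht] with r hr using hG1u r hr v
      have e5 := (e1.congr_of_eventuallyEq e3.symm).unique e4
      refine e5.trans ?_
      simp only [Function.comp_apply, map_smul, smul_apply, map_zero, add_zero, Pi.inv_apply]
      rw [smul_smul, ← sq, neg_div, neg_smul, ← sub_eq_add_neg, div_eq_mul_inv, inv_pow]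
    -- multiplied by `sinh t`, the integrand is a multiple of the spherical part of the Laplacian
    have hint : ∀ v : sphere (0 : EuclideanSpace ℝ (Fin d)) 1,
        Real.sinh t ^ 2 • dirDeriv e (dirDeriv e G) (t, v)
          + (((d : ℝ) - 1) * (Real.cosh t * Real.sinh t)) • dirDeriv e G (t, v)
          + (lam * Real.sinh t ^ 2) • G (t, v) =
        (-1 : ℝ) • (ballRadius t ^ 2 • ∑ i,
          fderiv ℝ (fderiv ℝ u) (ballRadius t • (v : EuclideanSpace ℝ (Fin d)))
            (EuclideanSpace.single i 1) (EuclideanSpace.single i 1)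
          - fderiv ℝ (fderiv ℝ u) (ballRadius t • (v : EuclideanSpace ℝ (Fin d)))
            (ballRadius t • (v : EuclideanSpace ℝ (Fin d)))
            (ballRadius t • (v : EuclideanSpace ℝ (Fin d)))
          - ((d : ℝ) - 1) • fderiv ℝ u (ballRadius t • (v : EuclideanSpace ℝ (Fin d)))
            (ballRadius t • (v : EuclideanSpace ℝ (Fin d)))) := by
      intro v
      have hpde := h.laplace_ball hd hM hφ (smul_sphere_mem_puncturedBall ht v)
      rw [ballFactor_smul ht v, ← hu] at hpde
      rw [hG1u t ht v, hG2u v, hGu t ht v]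
      simp only [map_smul, smul_apply] at hpde ⊢
      exact radial_algebra hc0 hsinh hcosh hpde
    have hsph := integral_sphere_laplacian isOpen_puncturedBall hus
      (smul_sphere_mem_puncturedBall (d := d) ht)
    have hsum : Real.sinh t ^ 2 • f'' t + (((d : ℝ) - 1) * (Real.cosh t * Real.sinh t)) • f' t +
        (lam * Real.sinh t ^ 2) • polarMean Γ φ t = 0 := by
      have i1 := integrable_of_continuous (μ := sphereMeasure _) (hcs hGs t)
      have i2 := integrable_of_continuous (μ := sphereMeasure _) (hcs hG1 t)
      have i3 := integrable_of_continuous (μ := sphereMeasure _) (hcs hG2 t)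
      have e0 : polarMean Γ φ t = ∫ v : sphere (0 : EuclideanSpace ℝ (Fin d)) 1, G (t, v)
        ∂sphereMeasure _ := rfl
      rw [e0, ← integral_smul, ← integral_smul, ← integral_smul, ← integral_add, ← integral_add]
      · simp only [hint]
        rw [integral_smul, hsph, smul_zero]
      · exact (i3.smul _).add (i2.smul _)
      · exact i1.smul _
      · exact i3.smul _
      · exact i2.smul _
    have hs0 := Real.sinh_pos_iff.2 ht
    refine smul_right_injective F hs0.ne' ?_
    simp only [smul_zero, smul_add, smul_smul]
    rw [← hsum]
    module
  refine ⟨f', f'', hf, hf', fun t ht => ?_⟩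
  -- at `t = 0` the equation holds by continuity
  have hcont : Continuous fun t => Real.sinh t • f'' t + (((d : ℝ) - 1) * Real.cosh t) • f' t +
      (lam * Real.sinh t) • polarMean Γ φ t := by
    have c0 : Continuous (polarMean Γ φ) :=
      continuous_iff_continuousAt.2 fun t => (hf t).continuousAt
    have c1 : Continuous f' := continuous_iff_continuousAt.2 fun t => (hf' t).continuousAt
    have := Real.continuous_sinh
    have := Real.continuous_cosh
    fun_prop
  have hcl := (isClosed_singleton (x := (0 : F))).preimage hcont
  have hsub : closure (Ioi (0 : ℝ)) ⊆ _ := hcl.closure_subset_iff.2 fun s hs => hpos s hs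
  rw [closure_Ioi] at hsub
  exact hsub ht

end PolarMean

/-! ### The spherical functions -/

section Eigenvalue

/-- Differentiation under the sign of an interval integral. -/
theorem hasDerivAt_intervalIntegral_of_continuous {F : Type*} [NormedAddCommGroup F]
    [NormedSpace ℝ F] {f f' : ℝ → ℝ → F} (hf : ∀ t, Continuous (f t))
    (hf' : Continuous fun p : ℝ × ℝ => f' p.1 p.2)
    (hd : ∀ t θ, HasDerivAt (fun s => f s θ) (f' t θ) t) (a b t : ℝ) :
    HasDerivAt (fun s => ∫ θ in a..b, f s θ) (∫ θ in a..b, f' t θ) t := by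
  obtain ⟨C, hC⟩ := ((isCompact_closedBall t 1).prod (isCompact_uIcc (a := a) (b := b))
    ).exists_bound_of_continuousOn hf'.continuousOn
  have hcont' : Continuous (f' t) := hf'.comp (f := fun θ : ℝ => (t, θ)) (by fun_prop)
  refine (intervalIntegral.hasDerivAt_integral_of_dominated_loc_of_deriv_le (bound := fun _ => C)
    (closedBall_mem_nhds t one_pos)
    (Eventually.of_forall fun s => (hf s).aestronglyMeasurable)
    ((hf t).intervalIntegrable a b) hcont'.aestronglyMeasurable ?_ (by simp) ?_).2
  · exact Eventually.of_forall fun θ hθ s hs => hC (s, θ) ⟨hs, uIoc_subset_uIcc hθ⟩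
  · exact Eventually.of_forall fun θ _ s _ => hd s θ

/-- The Poisson kernel expression `cosh t + cos θ sinh t`. -/
def horo (t θ : ℝ) : ℝ := Real.cosh t + Real.cos θ * Real.sinh t

/-- The time derivative of `horo`. -/
def horoDeriv (t θ : ℝ) : ℝ := Real.sinh t + Real.cos θ * Real.cosh t

theorem cosh_add_mul_sinh_pos (t : ℝ) {x : ℝ} (h0 : -1 ≤ x) (h1 : x ≤ 1) :
    0 < Real.cosh t + x * Real.sinh t := by
  have e1 : Real.cosh t + x * Real.sinh t =
      ((1 + x) * Real.exp t + (1 - x) * Real.exp (-t)) / 2 := by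
    rw [Real.cosh_eq, Real.sinh_eq]; ring
  rw [e1]
  have p1 := Real.exp_pos t
  have p2 := Real.exp_pos (-t)
  rcases lt_or_ge x 0 with h | h
  · have : 0 < (1 - x) * Real.exp (-t) := mul_pos (by linarith) p2
    have : 0 ≤ (1 + x) * Real.exp t := mul_nonneg (by linarith) p1.le
    linarith
  · have : 0 ≤ (1 - x) * Real.exp (-t) := mul_nonneg (by linarith) p2.le
    have : 0 < (1 + x) * Real.exp t := mul_pos (by linarith) p1
    linarith

theorem horo_pos (t θ : ℝ) : 0 < horo t θ :=
  cosh_add_mul_sinh_pos t (Real.neg_one_le_cos θ) (Real.cos_le_one θ)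

theorem horo_ne_zero (t θ : ℝ) : horo t θ ≠ 0 := (horo_pos t θ).ne'

theorem hasDerivAt_horo (t θ : ℝ) : HasDerivAt (fun s => horo s θ) (horoDeriv t θ) t :=
  (Real.hasDerivAt_cosh t).add ((Real.hasDerivAt_sinh t).const_mul _)

theorem hasDerivAt_horoDeriv (t θ : ℝ) : HasDerivAt (fun s => horoDeriv s θ) (horo t θ) t :=
  (Real.hasDerivAt_sinh t).add ((Real.hasDerivAt_cosh t).const_mul _)

theorem hasDerivAt_horo_angle (t θ : ℝ) :
    HasDerivAt (fun s => horo t s) (-(Real.sin θ * Real.sinh t)) θ := by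
  refine (((Real.hasDerivAt_cos θ).mul_const (Real.sinh t)).const_add _).congr_deriv ?_
  ring

theorem continuous_horo : Continuous fun p : ℝ × ℝ => horo p.1 p.2 := by
  have := Real.continuous_cosh
  have := Real.continuous_sinh
  unfold horo
  fun_prop

theorem continuous_horoDeriv : Continuous fun p : ℝ × ℝ => horoDeriv p.1 p.2 := by
  have := Real.continuous_cosh
  have := Real.continuous_sinh
  unfold horoDeriv
  fun_prop

theorem horoDeriv_sq (t θ : ℝ) : horoDeriv t θ ^ 2 = horo t θ ^ 2 - Real.sin θ ^ 2 := by
  have h1 := Real.cosh_sq t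
  have h2 := Real.sin_sq_add_cos_sq θ
  rw [horoDeriv, horo]
  linear_combination (Real.cos θ ^ 2 - 1) * h1 + h2

theorem cosh_mul_horoDeriv (t θ : ℝ) :
    Real.cosh t * horoDeriv t θ - Real.sinh t * horo t θ = Real.cos θ := by
  have h1 := Real.cosh_sq t
  rw [horoDeriv, horo]
  linear_combination Real.cos θ * h1

/-- The complex power `(cosh t + cos θ sinh t) ^ s`, written as an exponential. -/
def horoPow (s : ℂ) (t θ : ℝ) : ℂ := Complex.exp (s * (Real.log (horo t θ) : ℝ))

theorem horoPow_eq_cpow (s : ℂ) (t θ : ℝ) : horoPow s t θ = (horo t θ : ℂ) ^ s := by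
  rw [Complex.cpow_def_of_ne_zero (by exact_mod_cast horo_ne_zero t θ), horoPow,
    Complex.ofReal_log (horo_pos t θ).le, mul_comm]

theorem continuous_horoPow (s : ℂ) : Continuous fun p : ℝ × ℝ => horoPow s p.1 p.2 := by
  have h1 : Continuous fun p : ℝ × ℝ => Real.log (horo p.1 p.2) :=
    continuous_horo.log fun p => horo_ne_zero p.1 p.2
  unfold horoPow
  fun_prop

theorem hasDerivAt_horoPow (s : ℂ) (t θ : ℝ) : HasDerivAt (fun r => horoPow s r θ)
    (horoPow s t θ * (s * (horoDeriv t θ / horo t θ : ℝ))) t :=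
  (((hasDerivAt_horo t θ).log (horo_ne_zero t θ)).ofReal_comp.const_mul s).cexp

theorem hasDerivAt_horoPow_angle (s : ℂ) (t θ : ℝ) : HasDerivAt (fun r => horoPow s t r)
    (horoPow s t θ * (s * (-(Real.sin θ * Real.sinh t) / horo t θ : ℝ))) θ :=
  (((hasDerivAt_horo_angle t θ).log (horo_ne_zero t θ)).ofReal_comp.const_mul s).cexp

/-- The normalising constant, equal to `Γ(d/2) / (√π Γ((d-1)/2))` for `n = d - 2`. -/
def sphereConst (n : ℕ) : ℝ :=
  Real.Gamma (((n : ℝ) + 2) / 2) / (√Real.pi * Real.Gamma (((n : ℝ) + 1) / 2))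

/-- The spherical function of parameter `s` on hyperbolic space of dimension `n + 2`, as an integral
over the angle. -/
def sphericalFun (n : ℕ) (s : ℂ) (t : ℝ) : ℂ :=
  sphereConst n * ∫ θ in (0 : ℝ)..Real.pi, horoPow s t θ * (Real.sin θ ^ n : ℝ)

theorem integral_sin_pow_eq_Gamma (n : ℕ) : ∫ θ in (0 : ℝ)..Real.pi, Real.sin θ ^ n =
    √Real.pi * Real.Gamma (((n : ℝ) + 1) / 2) / Real.Gamma (((n : ℝ) + 2) / 2) := by
  induction n using Nat.twoStepInduction with
  | zero =>
    have : Real.Gamma (1 / 2) = √Real.pi := Real.Gamma_one_half_eq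
    simp only [pow_zero, Nat.cast_zero, zero_add]
    rw [this, div_self two_ne_zero, Real.Gamma_one, Real.mul_self_sqrt Real.pi_pos.le]
    simp
  | one =>
    have h1 : Real.Gamma (((1 : ℕ) + 2 : ℝ) / 2) = (1 / 2) * √Real.pi := by
      rw [← Real.Gamma_one_half_eq, ← Real.Gamma_add_one (by norm_num)]
      norm_num
    have h2 : (((1 : ℕ) : ℝ) + 1) / 2 = 1 := by norm_num
    have hpi : √Real.pi ≠ 0 := by positivity
    rw [h1, h2, Real.Gamma_one]
    simp only [pow_one, integral_sin, Real.cos_zero, Real.cos_pi]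
    field_simp
    norm_num
  | more n ih _ =>
    rw [integral_sin_pow, ih]
    have h1 : Real.Gamma ((((n + 2 : ℕ) : ℝ) + 1) / 2) =
        (((n : ℝ) + 1) / 2) * Real.Gamma (((n : ℝ) + 1) / 2) := by
      rw [← Real.Gamma_add_one (by positivity)]
      congr 1; push_cast; ring
    have h2 : Real.Gamma ((((n + 2 : ℕ) : ℝ) + 2) / 2) =
        (((n : ℝ) + 2) / 2) * Real.Gamma (((n : ℝ) + 2) / 2) := by
      rw [← Real.Gamma_add_one (by positivity)]
      congr 1; push_cast; ring
    have h3 : Real.Gamma (((n : ℝ) + 2) / 2) ≠ 0 := (Real.Gamma_pos_of_pos (by positivity)).ne'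
    have h4 : ((n : ℝ) + 2) ≠ 0 := by positivity
    rw [h1, h2]
    simp
    field_simp

theorem sphericalFun_zero (n : ℕ) (s : ℂ) : sphericalFun n s 0 = 1 := by
  have h1 : ∀ θ, horoPow s 0 θ = 1 := by intro θ; simp [horoPow, horo]
  simp only [sphericalFun, h1, one_mul]
  rw [intervalIntegral.integral_ofReal, integral_sin_pow_eq_Gamma, ← Complex.ofReal_mul,
    ← Complex.ofReal_one, sphereConst]
  congr 1
  have h3 : Real.Gamma (((n : ℝ) + 2) / 2) ≠ 0 := (Real.Gamma_pos_of_pos (by positivity)).ne'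
  have h4 : Real.Gamma (((n : ℝ) + 1) / 2) ≠ 0 := (Real.Gamma_pos_of_pos (by positivity)).ne'
  have hpi : √Real.pi ≠ 0 := by positivity
  field_simp

/-- The algebraic identity behind `exists_isRadialSolution_sphericalFun`. Here `K` is the integrand
`P ^ s`, with `P = horo t θ`, `Q = horoDeriv t θ`, `C = cosh t`, `S = sinh t`, `c = cos θ`, `σ = sin θ`,
`W = σ ^ n` and `N = n + 1`. -/
theorem horoPow_total_derivative_aux {K σ P Q C S c s N W : ℂ} (hP : P ≠ 0)
    (q1 : Q ^ 2 = P ^ 2 - σ ^ 2) (q2 : C * Q - S * P = c) :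
    s * ((K * (s * (-(σ * S) / P)) * P⁻¹ + K * (-(-(σ * S)) / P ^ 2)) * (W * σ)
      + K * P⁻¹ * (N * W * c)) =
    S * (K * ((s * (Q / P)) ^ 2 + s * (1 - (Q / P) ^ 2)) * W) + N * C * (K * (s * (Q / P)) * W)
      + -(s * (s + N)) * S * (K * W) := by
  field_simp
  linear_combination s * K * W * ((1 - s) * S * q1 - N * P * q2)

/-- The spherical function solves the radial equation: the equation for the integrand holds up to a
total derivative in `θ`. -/
theorem exists_isRadialSolution_sphericalFun (n : ℕ) {s : ℂ} {lam : ℝ}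
    (hs : (lam : ℂ) = -(s * (s + (n + 1)))) :
    ∃ f' f'' : ℝ → ℂ, IsRadialSolution ((n : ℝ) + 1) lam (sphericalFun n s) f' f'' := by
  set K : ℝ → ℝ → ℂ := horoPow s with hK
  have hKc := continuous_horoPow s
  have hq : Continuous fun p : ℝ × ℝ => horoDeriv p.1 p.2 / horo p.1 p.2 :=
    continuous_horoDeriv.div continuous_horo fun p => horo_ne_zero p.1 p.2
  set w : ℝ → ℂ := fun θ => (Real.sin θ ^ n : ℝ) with hw
  have hwc : Continuous w := by rw [hw]; fun_prop
  set K' : ℝ → ℝ → ℂ := fun t θ => K t θ * (s * (horoDeriv t θ / horo t θ : ℝ))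
  set K'' : ℝ → ℝ → ℂ := fun t θ => K t θ * ((s * (horoDeriv t θ / horo t θ : ℝ)) ^ 2 +
    s * (1 - (horoDeriv t θ / horo t θ) ^ 2 : ℝ))
  have hK'c : Continuous fun p : ℝ × ℝ => K' p.1 p.2 :=
    hKc.mul (continuous_const.mul (Complex.continuous_ofReal.comp hq))
  have hK''c : Continuous fun p : ℝ × ℝ => K'' p.1 p.2 :=
    hKc.mul (((continuous_const.mul (Complex.continuous_ofReal.comp hq)).pow 2).add
      (continuous_const.mul (Complex.continuous_ofReal.comp (continuous_const.sub (hq.pow 2)))))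
  have hd1 : ∀ t θ, HasDerivAt (fun r => K r θ * w θ) (K' t θ * w θ) t := fun t θ =>
    (hasDerivAt_horoPow s t θ).mul_const _
  have hd2 : ∀ t θ, HasDerivAt (fun r => K' r θ * w θ) (K'' t θ * w θ) t := by
    intro t θ
    have e1 := ((hasDerivAt_horoDeriv t θ).div (hasDerivAt_horo t θ)
      (horo_ne_zero t θ)).ofReal_comp.const_mul s
    refine (((hasDerivAt_horoPow s t θ).mul e1).mul_const (w θ)).congr_deriv ?_
    have e2 : (horo t θ * horo t θ - horoDeriv t θ * horoDeriv t θ) / horo t θ ^ 2 =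
        1 - (horoDeriv t θ / horo t θ) ^ 2 := by
      have := horo_ne_zero t θ
      field_simp
    rw [e2]
    simp only [K'', hK, Pi.div_apply]
    ring
  have hslice : ∀ {k : ℝ → ℝ → ℂ}, (Continuous fun p : ℝ × ℝ => k p.1 p.2) → ∀ t,
      Continuous fun θ => k t θ * w θ := fun hk t =>
    (hk.comp (f := fun θ : ℝ => (t, θ)) (by fun_prop)).mul hwc
  have hjoint : ∀ {k : ℝ → ℝ → ℂ}, (Continuous fun p : ℝ × ℝ => k p.1 p.2) →
      Continuous fun p : ℝ × ℝ => k p.1 p.2 * w p.2 := fun hk =>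
    hk.mul (hwc.comp continuous_snd)
  refine ⟨fun t => sphereConst n * ∫ θ in (0 : ℝ)..Real.pi, K' t θ * w θ,
    fun t => sphereConst n * ∫ θ in (0 : ℝ)..Real.pi, K'' t θ * w θ, ⟨fun t => ?_, fun t => ?_,
    fun t _ => ?_⟩⟩
  · exact (hasDerivAt_intervalIntegral_of_continuous (hslice hKc) (hjoint hK'c) hd1 0 _ t).const_mul _
  · exact (hasDerivAt_intervalIntegral_of_continuous (hslice hK'c) (hjoint hK''c) hd2 0 _ t).const_mul _
  · -- the left hand side of the equation is the integral of a derivative in `θ` of a function which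
    -- vanishes at both ends, thanks to the factor `sin θ ^ (n + 1)`
    have hW : ∀ θ, HasDerivAt
        (fun r => s * (K t r * (horo t r : ℂ)⁻¹ * (Real.sin r ^ (n + 1) : ℝ)))
        (Real.sinh t * (K'' t θ * w θ) + ((n : ℝ) + 1) * Real.cosh t * (K' t θ * w θ)
          + lam * Real.sinh t * (K t θ * w θ)) θ := by
      intro θ
      have hP : (horo t θ : ℂ) ≠ 0 := by exact_mod_cast horo_ne_zero t θ
      have e1 := (hasDerivAt_horo_angle t θ).ofReal_comp.inv hP
      have e2 := ((Real.hasDerivAt_sin θ).pow (n + 1)).ofReal_comp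
      refine ((((hasDerivAt_horoPow_angle s t θ).mul e1).mul e2).const_mul s).congr_deriv ?_
      have q1 : (horoDeriv t θ : ℂ) ^ 2 = (horo t θ : ℂ) ^ 2 - (Real.sin θ : ℂ) ^ 2 := by
        exact_mod_cast horoDeriv_sq t θ
      have q2 : (Real.cosh t : ℂ) * horoDeriv t θ - Real.sinh t * horo t θ = Real.cos θ := by
        exact_mod_cast cosh_mul_horoDeriv t θ
      have key := horoPow_total_derivative_aux (K := K t θ) (s := s) (N := (n : ℂ) + 1)
        (W := (Real.sin θ : ℂ) ^ n) hP q1 q2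
      simp only [K', K'', hw, hK, hs, Pi.mul_apply, Pi.pow_apply, Pi.inv_apply,
        Complex.ofReal_mul, Complex.ofReal_pow, Complex.ofReal_div, Complex.ofReal_neg,
        Complex.ofReal_sub, Complex.ofReal_one, Complex.ofReal_natCast, Nat.add_sub_cancel,
        Nat.cast_add, Nat.cast_one, Complex.ofReal_add, pow_succ (Real.sin θ : ℂ) n] at key ⊢
      exact key
    have hftc := intervalIntegral.integral_eq_sub_of_hasDerivAt (a := 0) (b := Real.pi)
      (fun θ _ => hW θ) ?_
    · have i1 := (hslice hKc t).intervalIntegrable (μ := volume) 0 Real.pi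
      have i2 := (hslice hK'c t).intervalIntegrable (μ := volume) 0 Real.pi
      have i3 := (hslice hK''c t).intervalIntegrable (μ := volume) 0 Real.pi
      rw [intervalIntegral.integral_add ((i3.const_mul _).add (i2.const_mul _)) (i1.const_mul _),
        intervalIntegral.integral_add (i3.const_mul _) (i2.const_mul _),
        intervalIntegral.integral_const_mul, intervalIntegral.integral_const_mul,
        intervalIntegral.integral_const_mul] at hftc
      simp only [Real.sin_pi, Real.sin_zero, ne_eq, Nat.add_one_ne_zero, not_false_eq_true,
        zero_pow, Complex.ofReal_zero, mul_zero, sub_zero] at hftc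
      simp only [sphericalFun, Complex.real_smul, Complex.ofReal_mul, Complex.ofReal_add,
        Complex.ofReal_one, Complex.ofReal_natCast, hw] at hftc ⊢
      linear_combination (sphereConst n : ℂ) * hftc
    · refine Continuous.intervalIntegrable ?_ _ _
      exact ((continuous_const.mul (hslice hK''c t)).add (continuous_const.mul
        (hslice hK'c t))).add (continuous_const.mul (hslice hKc t))

end Eigenvalue

/-! ### Formulas for the eigenvalue -/

section EigenvalueFormula

theorem image_cos_Ioo : Real.cos '' Ioo 0 Real.pi = Ioo (-1) 1 := by
  ext x
  constructor
  · rintro ⟨θ, ⟨h0, h1⟩, rfl⟩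
    refine ⟨?_, ?_⟩
    · rw [← Real.cos_pi]
      exact Real.cos_lt_cos_of_nonneg_of_le_pi h0.le le_rfl h1
    · rw [← Real.cos_zero]
      exact Real.cos_lt_cos_of_nonneg_of_le_pi le_rfl h1.le h0
  · rintro ⟨h0, h1⟩
    exact ⟨Real.arccos x, ⟨Real.arccos_pos.2 h1, Real.arccos_lt_pi.2 h0⟩,
      Real.cos_arccos h0.le h1.le⟩

/-- The substitution `x = cos θ` in the integral formula for the spherical function. -/
theorem sphericalFun_eq_integral_cpow (n : ℕ) (s : ℂ) (t : ℝ) :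
    sphericalFun n s t = sphereConst n * ∫ x in (-1 : ℝ)..1,
      ((Real.cosh t + x * Real.sinh t : ℝ) : ℂ) ^ s *
        (((1 - x ^ 2) ^ (((n : ℝ) - 1) / 2) : ℝ) : ℂ) := by
  rw [sphericalFun]
  congr 1
  rw [intervalIntegral.integral_of_le Real.pi_pos.le, intervalIntegral.integral_of_le (by norm_num),
    integral_Ioc_eq_integral_Ioo, integral_Ioc_eq_integral_Ioo, ← image_cos_Ioo,
    integral_image_eq_integral_abs_deriv_smul measurableSet_Ioo
      (fun θ _ => (Real.hasDerivAt_cos θ).hasDerivWithinAt)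
      (Real.injOn_cos.mono Ioo_subset_Icc_self)]
  refine setIntegral_congr_fun measurableSet_Ioo fun θ hθ => ?_
  have hsin : 0 < Real.sin θ := Real.sin_pos_of_pos_of_lt_pi hθ.1 hθ.2
  have h1 : Real.sin θ ^ n = Real.sin θ * (1 - Real.cos θ ^ 2) ^ (((n : ℝ) - 1) / 2) := by
    rw [← Real.sin_sq, ← Real.rpow_natCast (Real.sin θ) 2, ← Real.rpow_mul hsin.le]
    nth_rewrite 2 [← Real.rpow_one (Real.sin θ)]
    rw [← Real.rpow_add hsin, ← Real.rpow_natCast]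
    congr 1
    push_cast
    ring
  simp only [abs_neg, abs_of_pos hsin, horoPow_eq_cpow, horo, h1, Complex.real_smul,
    Complex.ofReal_mul]
  ring

theorem horoPow_sub_one (s : ℂ) (t θ : ℝ) :
    horoPow (s - 1) t θ = horoPow s t θ / (horo t θ : ℂ) := by
  rw [horoPow, horoPow, sub_mul, one_mul, Complex.exp_sub, ← Complex.ofReal_exp (Real.log _),
    Real.exp_log (horo_pos t θ)]

theorem horo_angle_zero (t : ℝ) : horo t 0 = Real.exp t := by
  rw [horo, Real.cos_zero, one_mul, Real.cosh_add_sinh]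

theorem horo_angle_pi (t : ℝ) : horo t Real.pi = Real.exp (-t) := by
  rw [horo, Real.cos_pi, ← Real.cosh_sub_sinh]
  ring

theorem sphereConst_one : sphereConst 1 = 1 / 2 := by
  have h1 : Real.Gamma (((1 : ℕ) + 2 : ℝ) / 2) = (1 / 2) * √Real.pi := by
    rw [← Real.Gamma_one_half_eq, ← Real.Gamma_add_one (by norm_num)]
    norm_num
  have h2 : (((1 : ℕ) : ℝ) + 1) / 2 = 1 := by norm_num
  have hpi : √Real.pi ≠ 0 := by positivity
  rw [sphereConst, h1, h2, Real.Gamma_one]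
  field_simp

theorem continuous_horoPow_mul_sin (s : ℂ) (t : ℝ) (n : ℕ) :
    Continuous fun θ => horoPow s t θ * (Real.sin θ ^ n : ℝ) :=
  ((continuous_horoPow s).comp (f := fun θ : ℝ => (t, θ)) (by fun_prop)).mul (by fun_prop)

/-- In dimension three the integrand of the spherical function has the elementary primitive
`-(cosh t + cos θ sinh t) ^ (iu) / (iu sinh t)`. -/
theorem sphericalFun_one_of_ne_zero {u : ℂ} (hu : u ≠ 0) {t : ℝ} (ht : 0 < t) :
    sphericalFun 1 (Complex.I * u - 1) t = Complex.sin (u * t) / (u * Real.sinh t) := by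
  have hS : (Real.sinh t : ℂ) ≠ 0 := by exact_mod_cast (Real.sinh_pos_iff.2 ht).ne'
  have hd : ∀ θ ∈ uIcc 0 Real.pi, HasDerivAt
      (fun r => -(Complex.I * u * Real.sinh t)⁻¹ * horoPow (Complex.I * u) t r)
      (horoPow (Complex.I * u - 1) t θ * (Real.sin θ ^ 1 : ℝ)) θ := by
    intro θ _
    refine ((hasDerivAt_horoPow_angle (Complex.I * u) t θ).const_mul _).congr_deriv ?_
    have hP : (horo t θ : ℂ) ≠ 0 := by exact_mod_cast horo_ne_zero t θ
    simp only [horoPow_sub_one, pow_one, Complex.ofReal_div, Complex.ofReal_neg,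
      Complex.ofReal_mul]
    field_simp
  rw [sphericalFun, intervalIntegral.integral_eq_sub_of_hasDerivAt hd
    ((continuous_horoPow_mul_sin _ t 1).intervalIntegrable _ _), sphereConst_one, horoPow, horoPow,
    horo_angle_zero, horo_angle_pi, Real.log_exp, Real.log_exp, Complex.sin]
  have e1 : Complex.I * u * (-t : ℝ) = -(u * t) * Complex.I := by push_cast; ring
  have e2 : Complex.I * u * (t : ℝ) = u * t * Complex.I := by ring
  rw [e1, e2]
  generalize Complex.exp (-(u * t) * Complex.I) = A
  generalize Complex.exp (u * t * Complex.I) = B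
  push_cast at hS ⊢
  field_simp
  linear_combination (B - A) * Complex.I_sq

/-- The parameter `u = 0` in dimension three, where the primitive is a logarithm. -/
theorem sphericalFun_one_neg_one {t : ℝ} (ht : 0 < t) :
    sphericalFun 1 (-1) t = (t / Real.sinh t : ℝ) := by
  have hS : Real.sinh t ≠ 0 := (Real.sinh_pos_iff.2 ht).ne'
  have hd : ∀ θ ∈ uIcc 0 Real.pi, HasDerivAt
      (fun r => ((-(Real.sinh t)⁻¹ * Real.log (horo t r) : ℝ) : ℂ))
      (horoPow (-1) t θ * (Real.sin θ ^ 1 : ℝ)) θ := by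
    intro θ _
    refine ((((hasDerivAt_horo_angle t θ).log (horo_ne_zero t θ)).const_mul
      (-(Real.sinh t)⁻¹)).ofReal_comp).congr_deriv ?_
    have hP := horo_ne_zero t θ
    rw [horoPow_eq_cpow, Complex.cpow_neg_one, ← Complex.ofReal_inv, ← Complex.ofReal_mul]
    congr 1
    field_simp
  rw [sphericalFun, intervalIntegral.integral_eq_sub_of_hasDerivAt hd
    ((continuous_horoPow_mul_sin _ t 1).intervalIntegrable _ _), sphereConst_one,
    horo_angle_zero, horo_angle_pi, Real.log_exp, Real.log_exp, ← Complex.ofReal_sub,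
    ← Complex.ofReal_mul]
  congr 1
  field_simp
  ring

/-- By uniqueness for the radial equation, spherical functions depend on their parameter `s` only through the eigenvalue
`-s (s + n + 1)`. -/
theorem sphericalFun_eq_of_eigenvalue_eq (n : ℕ) {s s' : ℂ} {lam : ℝ}
    (hs : (lam : ℂ) = -(s * (s + (n + 1)))) (hs' : (lam : ℂ) = -(s' * (s' + (n + 1))))
    {t : ℝ} (ht : 0 ≤ t) : sphericalFun n s t = sphericalFun n s' t := by
  obtain ⟨f', f'', hf⟩ := exists_isRadialSolution_sphericalFun n hs
  obtain ⟨g', g'', hg⟩ := exists_isRadialSolution_sphericalFun n hs'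
  exact hf.eq_of_eq_zero hg (by positivity) (by simp only [sphericalFun_zero]) ht

/-- A spherical function with real eigenvalue is real: its complex conjugate solves the same radial
equation. -/
theorem ofReal_re_sphericalFun (n : ℕ) {s : ℂ} {lam : ℝ}
    (hs : (lam : ℂ) = -(s * (s + (n + 1)))) {t : ℝ} (ht : 0 ≤ t) :
    ((sphericalFun n s t).re : ℂ) = sphericalFun n s t := by
  obtain ⟨f', f'', hf⟩ := exists_isRadialSolution_sphericalFun n hs
  have h := (hf.clm_comp (Complex.conjCLE : ℂ →L[ℝ] ℂ)).eq_of_eq_zero hf (by positivity)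
    (by simp [sphericalFun_zero]) ht
  exact Complex.conj_eq_iff_re.1 h

/-- A parameter `s` with `-s (s + n + 1) = lam`, namely `i u - (n + 1) / 2` with
`u² = lam - (n + 1)² / 4`. -/
def sphericalParam (n : ℕ) (lam : ℝ) : ℂ :=
  Complex.I * ((lam : ℂ) - ((n : ℂ) + 1) ^ 2 / 4) ^ (2⁻¹ : ℂ) - ((n : ℂ) + 1) / 2

theorem eigenvalue_eq_of_sq (n : ℕ) {lam u : ℂ} (h : lam = ((n : ℂ) + 1) ^ 2 / 4 + u ^ 2) :
    lam = -((Complex.I * u - ((n : ℂ) + 1) / 2) *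
      ((Complex.I * u - ((n : ℂ) + 1) / 2) + (n + 1))) := by
  linear_combination h + u ^ 2 * Complex.I_sq

theorem eigenvalue_sphericalParam (n : ℕ) (lam : ℝ) :
    (lam : ℂ) = -(sphericalParam n lam * (sphericalParam n lam + (n + 1))) := by
  apply eigenvalue_eq_of_sq
  have h := Complex.cpow_ofNat_inv_pow ((lam : ℂ) - ((n : ℂ) + 1) ^ 2 / 4) 2
  rw [h]
  ring

/-- The eigenvalue `ν_t(lam)` of the spherical mean of radius `t` in dimension `n + 2`. For `t ≥ 0` the
spherical function itself is real, see `ofReal_meanEigenvalue`. -/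
def meanEigenvalue (n : ℕ) (t lam : ℝ) : ℝ := (sphericalFun n (sphericalParam n lam) t).re

theorem meanEigenvalue_zero (n : ℕ) (lam : ℝ) : meanEigenvalue n 0 lam = 1 := by
  simp [meanEigenvalue, sphericalFun_zero]

theorem ofReal_meanEigenvalue (n : ℕ) {s : ℂ} {lam : ℝ}
    (hs : (lam : ℂ) = -(s * (s + (n + 1)))) {t : ℝ} (ht : 0 ≤ t) :
    (meanEigenvalue n t lam : ℂ) = sphericalFun n s t := by
  rw [meanEigenvalue, ofReal_re_sphericalFun n (eigenvalue_sphericalParam n lam) ht]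
  exact sphericalFun_eq_of_eigenvalue_eq n (eigenvalue_sphericalParam n lam) hs ht

theorem exists_isRadialSolution_meanEigenvalue (n : ℕ) (lam : ℝ) : ∃ f' f'' : ℝ → ℝ,
    IsRadialSolution ((n : ℝ) + 1) lam (fun t => meanEigenvalue n t lam) f' f'' := by
  obtain ⟨f', f'', hf⟩ :=
    exists_isRadialSolution_sphericalFun n (eigenvalue_sphericalParam n lam)
  exact ⟨_, _, hf.clm_comp Complex.reCLM⟩

end EigenvalueFormula

/-! ### Spherical means of eigenfunctions -/

section GeodesicMeans

variable {d : ℕ} {M : Type*} [TopologicalSpace M] [ChartedSpace (EuclideanSpace ℝ (Fin d)) M]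
  [IsManifold (𝓡 d) ∞ M] [Bundle.RiemannianBundle (fun x : M => TangentSpace (𝓡 d) x)]
  [IsContMDiffRiemannianBundle (𝓡 d) ∞ (EuclideanSpace ℝ (Fin d))
    (fun x : M => TangentSpace (𝓡 d) x)] [T2Space M] [CompactSpace M]

variable (d) in
/-- An isometry from `ℝᵈ` onto the Euclidean space `TₓM`. -/
def tangentFrame (x : M) : EuclideanSpace ℝ (Fin d) ≃ₗᵢ[ℝ] TangentSpace (𝓡 d) x :=
  ((stdOrthonormalBasis ℝ (TangentSpace (𝓡 d) x)).reindex
    (finCongr (finrank_euclideanSpace_fin (𝕜 := ℝ) (n := d)))).repr.symm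

variable (d) in
/-- The geodesics issuing from `x`, parametrised by `ℝᵈ` through `tangentFrame`. -/
def frameGeodesic (x : M) (ξ : EuclideanSpace ℝ (Fin d)) (t : ℝ) : M :=
  geodesic (⟨x, tangentFrame d x ξ⟩ : TangentBundle (𝓡 d) M) t

variable (d) in
theorem isPolarFamily_frameGeodesic (x : M) : ∃ L, IsPolarFamily (frameGeodesic d x) x L := by
  let L₀ : EuclideanSpace ℝ (Fin d) →ₗ[ℝ] EuclideanSpace ℝ (Fin d) :=
    { toFun := fun ξ => tangentFrame d x ξ
      map_add' := (tangentFrame d x).map_add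
      map_smul' := (tangentFrame d x).map_smul }
  exact ⟨LinearMap.toContinuousLinearMap L₀, fun ξ => (geodesic_spec x _).1,
    fun ξ => (geodesic_spec x _).2.1, fun ξ => (geodesic_spec x _).2.2,
    fun u v => (tangentFrame d x).inner_map_map u v⟩

theorem sphericalMean_eq_polarMean {F : Type*} [NormedAddCommGroup F] [NormedSpace ℝ F]
    (t : ℝ) (φ : M → F) (x : M) :
    sphericalMean d t φ x = polarMean (frameGeodesic d x) φ t :=
  (integral_sphere_comp (tangentFrame d x)
    fun v => φ (geodesic (⟨x, v⟩ : TangentBundle (𝓡 d) M) t)).symm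

theorem sphericalMean_zero (hd : 2 ≤ d) {F : Type*} [NormedAddCommGroup F] [NormedSpace ℝ F]
    [CompleteSpace F] (φ : M → F) (x : M) : sphericalMean d 0 φ x = φ x := by
  have : Nontrivial (EuclideanSpace ℝ (Fin d)) :=
    Module.nontrivial_of_finrank_pos (R := ℝ) (by rw [finrank_euclideanSpace_fin]; omega)
  have := isProbabilityMeasure_sphereMeasure (E := EuclideanSpace ℝ (Fin d))
  rw [sphericalMean_eq_polarMean, polarMean]
  simp [polarMap, frameGeodesic, (geodesic_spec x _).2.1]

theorem norm_sphericalMean_le (hd : 2 ≤ d) {F : Type*} [NormedAddCommGroup F] [NormedSpace ℝ F]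
    {φ : M → F} {C : ℝ} (hC : ∀ y, ‖φ y‖ ≤ C) (t : ℝ) (x : M) :
    ‖sphericalMean d t φ x‖ ≤ C := by
  have : Nontrivial (EuclideanSpace ℝ (Fin d)) :=
    Module.nontrivial_of_finrank_pos (R := ℝ) (by rw [finrank_euclideanSpace_fin]; omega)
  have := isProbabilityMeasure_sphereMeasure (E := EuclideanSpace ℝ (Fin d))
  rw [sphericalMean_eq_polarMean, polarMean]
  simpa using norm_integral_le_of_norm_le_const (μ := sphereMeasure (EuclideanSpace ℝ (Fin d)))
    (Eventually.of_forall fun v => hC (polarMap (frameGeodesic d x) (t, v)))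

theorem exists_isRadialSolution_sphericalMean (hd : 2 ≤ d) {F : Type*} [NormedAddCommGroup F]
    [NormedSpace ℝ F] (hM : HasConstantSectionalCurvature (d := d) M (-1)) {φ : M → F} {lam : ℝ}
    (hφ : IsLaplaceEigenfunction (d := d) φ lam) (x : M) : ∃ f' f'' : ℝ → F,
      IsRadialSolution ((d : ℝ) - 1) lam (fun t => sphericalMean d t φ x) f' f'' := by
  obtain ⟨L, hL⟩ := isPolarFamily_frameGeodesic d x
  obtain ⟨f', f'', h⟩ := hL.exists_isRadialSolution hd hM hφ
  exact ⟨f', f'', (funext fun t => sphericalMean_eq_polarMean (d := d) t φ x) ▸ h⟩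

/-- The spherical mean and `t ↦ ν_t(lam) φ(x)` solve the same radial equation and agree at `t = 0`,
hence coincide. -/
theorem sphericalMean_eq_smul {n : ℕ} (hn : d = n + 2) {F : Type*} [NormedAddCommGroup F]
    [NormedSpace ℝ F] [CompleteSpace F] (hM : HasConstantSectionalCurvature (d := d) M (-1))
    {φ : M → F} {lam : ℝ} (hφ : IsLaplaceEigenfunction (d := d) φ lam) {t : ℝ} (ht : 0 ≤ t)
    (x : M) : sphericalMean d t φ x = meanEigenvalue n t lam • φ x := by
  have hd : 2 ≤ d := by omega
  have hm : (d : ℝ) - 1 = (n : ℝ) + 1 := by rw [hn]; push_cast; ring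
  obtain ⟨f', f'', hf⟩ := exists_isRadialSolution_sphericalMean hd hM hφ x
  obtain ⟨g', g'', hg⟩ := exists_isRadialSolution_meanEigenvalue n lam
  rw [hm] at hf
  exact hf.eq_of_eq_zero (hg.clm_comp (ContinuousLinearMap.toSpanSingleton ℝ (φ x)))
    (by positivity) (by simp [sphericalMean_zero hd, meanEigenvalue_zero]) ht

/-- The eigenvalue is nonnegative: at a point `x` where `|φ|` is maximal, the spherical means
`A_t φ(x)` are bounded by their value at `t = 0`. -/
theorem eigenvalue_nonneg (hd : 2 ≤ d) [Nonempty M] {𝕜 : Type*} [RCLike 𝕜]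
    (hM : HasConstantSectionalCurvature (d := d) M (-1)) {φ : M → 𝕜} {lam : ℝ}
    (hφ : IsLaplaceEigenfunction (d := d) φ lam) : 0 ≤ lam := by
  obtain ⟨x, hx⟩ := hφ.smooth.continuous.norm.exists_forall_ge_of_hasCompactSupport
    (HasCompactSupport.of_compactSpace _)
  have hpos : 0 < ‖φ x‖ := by
    obtain ⟨y, hy⟩ := Function.ne_iff.1 hφ.ne_zero
    exact (norm_pos_iff.2 hy).trans_le (hx y)
  obtain ⟨f', f'', hf⟩ := exists_isRadialSolution_sphericalMean hd hM hφ x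
  have hm : (d : ℝ) - 1 = ((d - 1 : ℕ) : ℝ) := by rw [Nat.cast_sub (by omega), Nat.cast_one]
  rw [hm] at hf
  have h0 : inner ℝ (φ x) (sphericalMean d 0 φ x) = ‖φ x‖ ^ 2 := by
    rw [sphericalMean_zero hd, real_inner_self_eq_norm_sq]
  refine (hf.clm_comp (innerSL ℝ (φ x))).nonneg_of_le (n := d - 1) (by omega) ?_ fun t _ => ?_
  · simp only [innerSL_apply_apply, h0]
    positivity
  · simp only [innerSL_apply_apply, h0]
    calc inner ℝ (φ x) (sphericalMean d t φ x) ≤ ‖φ x‖ * ‖sphericalMean d t φ x‖ :=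
          real_inner_le_norm _ _
      _ ≤ ‖φ x‖ * ‖φ x‖ := by gcongr; exact norm_sphericalMean_le hd hx t x
      _ = ‖φ x‖ ^ 2 := (sq _).symm

end GeodesicMeans

end SphericalMean

end

theorem mainTheorem5 (d : ℕ) (hd : 2 ≤ d) :
    ∃ ν : ℝ → ℝ → ℝ,
      -- Laplace-Beltrami eigenfunctions are eigenfunctions of the spherical means
      (∀ (M : Type u) [TopologicalSpace M] [T2Space M] [CompactSpace M] [ConnectedSpace M]
        [ChartedSpace (EuclideanSpace ℝ (Fin d)) M] [IsManifold (𝓡 d) ∞ M]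
        [Bundle.RiemannianBundle (fun x : M => TangentSpace (𝓡 d) x)]
        [IsContMDiffRiemannianBundle (𝓡 d) ∞ (EuclideanSpace ℝ (Fin d))
          (fun x : M => TangentSpace (𝓡 d) x)],
        SphericalMean.HasConstantSectionalCurvature (d := d) M (-1) →
        ∀ (𝕜 : Type v) [RCLike 𝕜] (φ : M → 𝕜) (lam : ℝ),
          SphericalMean.IsLaplaceEigenfunction (d := d) φ lam →
          0 ≤ lam ∧
          ∀ t : ℝ, 0 ≤ t → ∀ x : M, SphericalMean.sphericalMean d t φ x = ν t lam • φ x) ∧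
      -- the explicit eigenvalue
      (∀ (t : ℝ), 0 ≤ t → ∀ (u : ℂ) (lam : ℝ),
        (u.im = 0 ∨ (u.re = 0 ∧ |u.im| ≤ ((d : ℝ) - 1) / 2)) →
        (lam : ℂ) = ((d : ℂ) - 1) ^ 2 / 4 + u ^ 2 →
        (ν t lam : ℂ) =
            ((Real.Gamma ((d : ℝ) / 2) / (√Real.pi * Real.Gamma (((d : ℝ) - 1) / 2)) : ℝ) : ℂ) *
              ∫ x in (-1 : ℝ)..1,
                ((Real.cosh t + x * Real.sinh t : ℝ) : ℂ) ^
                    (Complex.I * u - ((d : ℂ) - 1) / 2) *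
                  (((1 - x ^ 2) ^ (((d : ℝ) - 3) / 2) : ℝ) : ℂ) ∧
        -- the closed form in dimension three
        (d = 3 → 0 < t →
          (u ≠ 0 → (ν t lam : ℂ) = Complex.sin (u * t) / (u * (Real.sinh t : ℂ))) ∧
          (u = 0 → ν t lam = t / Real.sinh t))) := by
  obtain ⟨n, hn⟩ : ∃ n, d = n + 2 := ⟨d - 2, by omega⟩
  refine ⟨SphericalMean.meanEigenvalue n, ?_, fun t ht u lam _ hlam => ?_⟩
  · intro M _ _ _ _ _ _ _ _ hM 𝕜 _ φ lam hφ
    exact ⟨SphericalMean.eigenvalue_nonneg hd hM hφ, fun t ht x =>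
      SphericalMean.sphericalMean_eq_smul hn hM hφ ht x⟩
  · have hd1 : (d : ℂ) - 1 = n + 1 := by rw [hn]; push_cast; ring
    have hd2 : (d : ℝ) = n + 2 := by rw [hn]; push_cast; ring
    have hconst : SphericalMean.sphereConst n =
        Real.Gamma ((d : ℝ) / 2) / (√Real.pi * Real.Gamma (((d : ℝ) - 1) / 2)) := by
      rw [SphericalMean.sphereConst, hd2]
      congr 4
      ring
    have hexp : ((d : ℝ) - 3) / 2 = ((n : ℝ) - 1) / 2 := by rw [hd2]; ring
    rw [hd1] at hlam ⊢
    have hν := SphericalMean.ofReal_meanEigenvalue n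
      (SphericalMean.eigenvalue_eq_of_sq n hlam) ht
    refine ⟨?_, fun h3 ht0 => ?_⟩
    · rw [hν, SphericalMean.sphericalFun_eq_integral_cpow, hconst, hexp]
    · obtain rfl : n = 1 := by omega
      have hs : Complex.I * u - (((1 : ℕ) : ℂ) + 1) / 2 = Complex.I * u - 1 := by norm_num
      rw [hs] at hν
      refine ⟨fun hu => ?_, fun hu => ?_⟩
      · rw [hν, SphericalMean.sphericalFun_one_of_ne_zero hu ht0]
      · rw [hu, mul_zero, zero_sub, SphericalMean.sphericalFun_one_neg_one ht0] at hν
        exact_mod_cast hν
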